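/- Let $m,n\ge 0$ be integers with $m\neq n$, let $1\le \ell\le m+n$, and put $\bar i=0$ for $1\le i\le m$, $\bar i=1$ for $m<i\le m+n$. The level $0$ double Yangian $\mathrm{DY}_0=\mathrm{DY}_0(\mathfrak{gl}_{m|n})$ is the unital associative $\mathbb Z_2$-graded algebra over $\mathbb C$ with generators $t_{ij}^{(r)}, t_{ij}^{(-r)}$ ($1\le i,j\le m+n$, $r\ge 1$) of parity $\bar i+\bar j$. Put $$t_{ij}(u)=\delta_{ij}+\sum_{r\ge1}t_{ij}^{(r)}u^{-r},\qquad t^+_{ij}(u)=\delta_{ij}-\sum_{r\ge1}t_{ij}^{(-r)}u^{r-1},$$ and $T(u)=\sum_{i,j}(-1)^{\bar i\bar j+\bar j}e_{ij}\otimes t_{ij}(u)$, $T^+(u)=\sum_{i,j}(-1)^{\bar i\bar j+\bar j}e_{ij}\otimes t^+_{ij}(u)$. With $R(u)=1-u^{-1}\sum_{i,j}(-1)^{\bar j}e_{ij}\otimes e_{ji}$, the defining relations are $$R(u-v)X_1(u)Y_2(v)=Y_2(v)X_1(u)R(u-v)\qquad\text{for }(X,Y)=(T,T),\ (T^+,T^+),\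 (T,T^+),$$ equivalently (with the supercommutator on the left, and $x_{ij}(u)$, $y_{ij}(u)$ the series that form $X$, $Y$) $$(u-v)\,[x_{ij}(u),y_{kl}(v)]=(-1)^{\bar i\bar j+\bar i\bar k+\bar j\bar k}\bigl(x_{kj}(u)y_{il}(v)-y_{kj}(v)x_{il}(u)\bigr).$$ Let $\deg_2 t_{ij}^{(r)}=r-1$, $\deg_2 t_{ij}^{(-r)}=-r$ for $r\ge 1$. For $d\in\mathbb Z$ let $\mathrm{DY}_0^{(d)}$ be the span of the monomials in the generators of total degree at most $d$. Let $\widehat{\mathrm{DY}}_0$ be the (Hausdorff) completion of $\mathrm{DY}_0$ for the topology in which the subspaces $\mathrm{DY}_0^{(-N)}$, $N\ge0$, form a basis of neighbourhoods of $0$, and filter it by the closures $F_d$ of the images of the $\mathrm{DY}_0^{(d)}$. It contains the extended double Yangian, the span of the products $xy$ with $x$ in the completion (the closure) of the subalgebra generated by the $t_{ij}^{(-r)}$ and $y$ in the subalgebra generated by the $t_{ij}^{(r)}$. Let $G=\mathrm{diag}(\varepsilon_1,\dots,\varepsilon_{m+n})$, with $\varepsilon_i=1$ for $i\le\ell$ and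 $\varepsilon_i=-1$ for $i>\ell$. Define elements $b_{ij}^{(r)},b_{ij}^{(-r)}$ ($r\ge 1$) of the extended double Yangian by $$T(u)\,G\,T(-u)^{-1}=\sum_{i,j}(-1)^{\bar i\bar j+\bar j}e_{ij}\otimes\Bigl(\delta_{ij}\varepsilon_i+\sum_{r\ge1}b_{ij}^{(r)}u^{-r}\Bigr),$$ $$T^+(u)\,G\,T^+(-u)^{-1}=\sum_{i,j}(-1)^{\bar i\bar j+\bar j}e_{ij}\otimes\Bigl(\delta_{ij}\varepsilon_i-\sum_{r\ge1}b_{ij}^{(-r)}u^{r-1}\Bigr).$$ One has $b_{ij}^{(r)}\in F_{r-1}$ and $b_{ij}^{(-r)}\in F_{-r}$. Let $\mathrm B(\mathfrak{gl}_{m|n})$, $\mathrm B^+(\mathfrak{gl}_{m|n})$ and $\mathrm{DB}(\mathfrak{gl}_{m|n})$ be the unital subalgebras generated by all $b_{ij}^{(r)}$, by all $b_{ij}^{(-r)}$, and by all $b_{ij}^{(r)}$ and $b_{ij}^{(-r)}$ ($r\ge1$), respectively. For such a subalgebra $S$ put $\mathrm{gr}_2S=\bigoplus_{d\in\mathbb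 Z}(S\cap F_d)/(S\cap F_{d-1})$. Let $I_0$ be the set of pairs $(i,j)$ such that $i,j\le\ell$ or $i,j>\ell$, and $I_1$ the set of all other pairs. Let $\overline\Gamma$ be the family of the images of the elements $b_{ij}^{(2r-1)}$ with $(i,j)\in I_0$ and $b_{ij}^{(2r)}$ with $(i,j)\in I_1$, $r\ge 1$, where the image of $b_{ij}^{(s)}$ is taken in the component of degree $s-1$. Let $\overline\Gamma^+$ be the family of the images of the elements $b_{ij}^{(-2r)}$ with $(i,j)\in I_0$ and $b_{ij}^{(-2r+1)}$ with $(i,j)\in I_1$, $r\ge1$, where the image of $b_{ij}^{(-s)}$ is taken in the component of degree $-s$. **Theorem.** The family $\overline\Gamma$ generates the algebra $\mathrm{gr}_2\,\mathrm B(\mathfrak{gl}_{m|n})$, the family $\overline\Gamma^+$ generates the algebra $\mathrm{gr}_2\,\mathrm B^+(\mathfrak{gl}_{m|n})$, and the union $\overline\Gamma\cup\overline\Gamma^+$ generates the algebra $\mathrm{gr}_2\,\mathrm{DB}(\mathfrak{gl}_{m|n})$. -/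

import Mathlib

open scoped DirectSum

noncomputable section

namespace DYang

section Graded

variable {A : Type*} [Ring A] [Algebra ℂ A]

/-- The degree `d` component `F d / F (d - 1)` of the associated graded algebra. -/
def GrPiece (F : ℤ → Submodule ℂ A) (d : ℤ) : Type _ :=
  ↥(F d) ⧸ (F (d - 1)).submoduleOf (F d)

instance (F : ℤ → Submodule ℂ A) (d : ℤ) : AddCommGroup (GrPiece F d) :=
  inferInstanceAs (AddCommGroup (↥(F d) ⧸ (F (d - 1)).submoduleOf (F d)))

instance (F : ℤ → Submodule ℂ A) (d : ℤ) : Module ℂ (GrPiece F d) :=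
  inferInstanceAs (Module ℂ (↥(F d) ⧸ (F (d - 1)).submoduleOf (F d)))

/-- The class of an element of `F d` in `F d / F (d - 1)`. -/
def grMk (F : ℤ → Submodule ℂ A) (d : ℤ) : ↥(F d) →ₗ[ℂ] GrPiece F d :=
  ((F (d - 1)).submoduleOf (F d)).mkQ

theorem grMk_surjective (F : ℤ → Submodule ℂ A) (d : ℤ) : Function.Surjective (grMk F d) :=
  Submodule.mkQ_surjective _

theorem grMk_eq_zero (F : ℤ → Submodule ℂ A) (d : ℤ) (x : ↥(F d)) (h : x.1 ∈ F (d - 1)) :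
    grMk F d x = 0 :=
  (Submodule.Quotient.mk_eq_zero ((F (d - 1)).submoduleOf (F d))).2 h

theorem gr_sigma_eq (F : ℤ → Submodule ℂ A) {i j : ℤ} (h : i = j) (x : ↥(F i)) (y : ↥(F j)) (hxy : x.1 = y.1) :
    GradedMonoid.mk (A := GrPiece F) i (grMk F i x) =
      GradedMonoid.mk (A := GrPiece F) j (grMk F j y) := by
  subst h
  rw [Subtype.ext hxy]

variable (F : ℤ → Submodule ℂ A) [hF : IsRingFiltration F (fun d => F (d - 1))]

/-- Multiplication `F i × F j → F (i + j)`. -/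
def filtMul (i j : ℤ) : ↥(F i) →ₗ[ℂ] ↥(F j) →ₗ[ℂ] ↥(F (i + j)) :=
  LinearMap.mk₂ ℂ (fun x y => ⟨x.1 * y.1, SetLike.mul_mem_graded x.2 y.2⟩)
    (fun x y z => Subtype.ext (add_mul x.1 y.1 z.1))
    (fun c x y => Subtype.ext (smul_mul_assoc c x.1 y.1))
    (fun x y z => Subtype.ext (mul_add x.1 y.1 z.1))
    (fun c x y => Subtype.ext (mul_smul_comm c x.1 y.1))

/-- The multiplication `F i / F (i - 1) × F j / F (j - 1) → F (i + j) / F (i + j - 1)` induced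
by the multiplication of the algebra. -/
def grMul (i j : ℤ) : GrPiece F i →ₗ[ℂ] GrPiece F j →ₗ[ℂ] GrPiece F (i + j) :=
  Submodule.liftQ ((F (i - 1)).submoduleOf (F i))
    (LinearMap.flip (Submodule.liftQ ((F (j - 1)).submoduleOf (F j)) (LinearMap.flip
      ((filtMul F i j).compr₂ (grMk F (i + j)))) (by
        intro y hy
        rw [LinearMap.mem_ker]
        refine LinearMap.ext fun x => grMk_eq_zero F (i + j) _ ?_
        have h := SetLike.mul_mem_graded (A := F) x.2 (show y.1 ∈ F (j - 1) from hy)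
        rw [← add_sub_assoc] at h
        exact h)))
    (by
      intro x hx
      rw [LinearMap.mem_ker]
      refine LinearMap.ext fun y => ?_
      obtain ⟨y, rfl⟩ := grMk_surjective F j y
      refine grMk_eq_zero F (i + j) _ ?_
      have h := SetLike.mul_mem_graded (A := F) (show x.1 ∈ F (i - 1) from hx) y.2
      rw [sub_add_eq_add_sub] at h
      exact h)

theorem grMul_mk (i j : ℤ) (x : ↥(F i)) (y : ↥(F j)) :
    grMul F i j (grMk F i x) (grMk F j y) =
      grMk F (i + j) ⟨x.1 * y.1, SetLike.mul_mem_graded x.2 y.2⟩ := rfl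

instance grGOne : GradedMonoid.GOne (GrPiece F) where
  one := grMk F 0 ⟨1, SetLike.one_mem_graded F⟩

instance grGMul : GradedMonoid.GMul (GrPiece F) where
  mul {i j} x y := grMul F i j x y

instance grGMonoid : GradedMonoid.GMonoid (GrPiece F) where
  one_mul := by
    rintro ⟨i, x⟩
    obtain ⟨x, rfl⟩ := grMk_surjective F _ x
    exact gr_sigma_eq F (zero_add i) _ _ (one_mul x.1)
  mul_one := by
    rintro ⟨i, x⟩
    obtain ⟨x, rfl⟩ := grMk_surjective F _ x
    exact gr_sigma_eq F (add_zero i) _ _ (mul_one x.1)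
  mul_assoc := by
    rintro ⟨i, x⟩ ⟨j, y⟩ ⟨k, z⟩
    obtain ⟨x, rfl⟩ := grMk_surjective F _ x
    obtain ⟨y, rfl⟩ := grMk_surjective F _ y
    obtain ⟨z, rfl⟩ := grMk_surjective F _ z
    exact gr_sigma_eq F (add_assoc i j k) _ _ (mul_assoc x.1 y.1 z.1)

instance grGRing : DirectSum.GRing (GrPiece F) where
  __ := grGMonoid F
  mul_zero x := map_zero (grMul F _ _ x)
  zero_mul y := LinearMap.map_zero₂ (grMul F _ _) y
  mul_add x y z := map_add (grMul F _ _ x) y z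
  add_mul x y z := LinearMap.map_add₂ (grMul F _ _) x y z
  natCast n := n • grMk F 0 ⟨1, SetLike.one_mem_graded F⟩
  natCast_zero := zero_smul _ _
  natCast_succ n := succ_nsmul _ n
  intCast k := k • grMk F 0 ⟨1, SetLike.one_mem_graded F⟩
  intCast_ofNat n := natCast_zsmul _ n
  intCast_negSucc_ofNat n := negSucc_zsmul _ n

instance grGAlgebra : DirectSum.GAlgebra ℂ (GrPiece F) where
  toFun :=
    { toFun := fun r => r • grMk F 0 ⟨1, SetLike.one_mem_graded F⟩
      map_zero' := zero_smul ℂ _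
      map_add' := fun r s => add_smul r s _ }
  map_one := one_smul ℂ (grMk F 0 ⟨1, SetLike.one_mem_graded F⟩)
  map_mul r s := gr_sigma_eq F (zero_add 0).symm
    ((r * s) • ⟨1, SetLike.one_mem_graded F⟩)
    ⟨(r • (1 : A)) * (s • (1 : A)), SetLike.mul_mem_graded
      (Submodule.smul_mem _ _ (SetLike.one_mem_graded F))
      (Submodule.smul_mem _ _ (SetLike.one_mem_graded F))⟩
    (show (r * s) • (1 : A) = (r • 1) * (s • 1) by rw [smul_mul_smul_comm, one_mul])
  commutes r := by
    rintro ⟨i, x⟩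
    obtain ⟨x, rfl⟩ := grMk_surjective F _ x
    exact gr_sigma_eq F ((zero_add i).trans (add_zero i).symm)
      ⟨(r • (1 : A)) * x.1, SetLike.mul_mem_graded
        (Submodule.smul_mem _ _ (SetLike.one_mem_graded F)) x.2⟩
      ⟨x.1 * (r • (1 : A)), SetLike.mul_mem_graded x.2
        (Submodule.smul_mem _ _ (SetLike.one_mem_graded F))⟩ (by simp)
  smul_def r := by
    rintro ⟨i, x⟩
    obtain ⟨x, rfl⟩ := grMk_surjective F _ x
    exact gr_sigma_eq F (zero_add i).symm (r • x)
      ⟨(r • (1 : A)) * x.1, SetLike.mul_mem_graded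
        (Submodule.smul_mem _ _ (SetLike.one_mem_graded F)) x.2⟩ (by simp)

/-- The associated graded algebra `⨁ d, F d / F (d - 1)` of a filtered algebra. -/
abbrev Gr : Type _ := ⨁ d : ℤ, GrPiece F d

/-- The image of `x ∈ F d` in the degree `d` component of the associated graded algebra. -/
def symbol (d : ℤ) (x : ↥(F d)) : Gr F := DirectSum.of (GrPiece F) d (grMk F d x)

/-- The filtration induced on a subalgebra. -/
def inducedFilt (S : Subalgebra ℂ A) (d : ℤ) : Submodule ℂ ↥S :=
  (F d).comap S.val.toLinearMap

instance inducedFilt_isRingFiltration (S : Subalgebra ℂ A) :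
    IsRingFiltration (inducedFilt F S) (fun d => inducedFilt F S (d - 1)) :=
  letI : SetLike.GradedMonoid (inducedFilt F S) :=
    { one_mem := SetLike.one_mem_graded F
      mul_mem := fun _ _ x y hx hy =>
        SetLike.mul_mem_graded (A := F) (gi := x.1) (gj := y.1) hx hy }
  IsRingFiltration.mk_int _ fun _ _ hab _ hx => hF.mono hab hx

end Graded

section DoubleYangian

variable {m n : ℕ}

/-- The parity of an index: even for the first `m` indices, odd for the last `n`. -/
def parity {m n : ℕ} (i : Fin (m + n)) : ℕ := if i.val < m then 0 else 1

/-- The generators `t_{ij}^{(r)}`, with `r` a nonzero integer. -/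
structure Gen (m n : ℕ) where
  /-- row index -/
  i : Fin (m + n)
  /-- column index -/
  j : Fin (m + n)
  /-- superscript -/
  r : ℤ
  /-- superscripts are nonzero -/
  hr : r ≠ 0

/-- `deg₂ t_{ij}^{(r)} = r - 1` and `deg₂ t_{ij}^{(-r)} = -r` for `r ≥ 1`. -/
def degTwo (r : ℤ) : ℤ := if 0 < r then r - 1 else r

/-- `t_{ij}^{(r)}` in the free algebra, with the convention `t_{ij}^{(0)} = δ_{ij}`. -/
def freeT (i j : Fin (m + n)) (r : ℤ) : FreeAlgebra ℂ (Gen m n) :=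
  if h : r ≠ 0 then FreeAlgebra.ι ℂ ⟨i, j, r, h⟩ else if i = j then 1 else 0

/-- The coefficient of `u ^ p` in `t_{ij}(u) = δ_{ij} + ∑_{r ≥ 1} t_{ij}^{(r)} u^{-r}`. -/
def freeCoeffT (i j : Fin (m + n)) (p : ℤ) : FreeAlgebra ℂ (Gen m n) :=
  if p ≤ 0 then freeT i j (-p) else 0

/-- The coefficient of `u ^ p` in `t⁺_{ij}(u) = δ_{ij} - ∑_{r ≥ 1} t_{ij}^{(-r)} u^{r-1}`. -/
def freeCoeffTPlus (i j : Fin (m + n)) (p : ℤ) : FreeAlgebra ℂ (Gen m n) :=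
  if 0 ≤ p then (if p = 0 then freeT i j 0 else 0) - freeT i j (-(p + 1)) else 0

/-- The supercommutator `[x, y] = x y - (-1)^{(i+j)(k+l)} y x` of elements `x`, `y` of parities
`i + j` and `k + l`. -/
def superComm (i j k l : Fin (m + n)) (x y : FreeAlgebra ℂ (Gen m n)) :
    FreeAlgebra ℂ (Gen m n) :=
  x * y - ((-1 : ℂ) ^ ((parity i + parity j) * (parity k + parity l))) • (y * x)

/-- The coefficient of `u ^ p v ^ q` in `(u - v) [x_{ij}(u), y_{kl}(v)]`. -/
def rttLeft (x y : Fin (m + n) → Fin (m + n) → ℤ → FreeAlgebra ℂ (Gen m n))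
    (i j k l : Fin (m + n)) (p q : ℤ) : FreeAlgebra ℂ (Gen m n) :=
  superComm i j k l (x i j (p - 1)) (y k l q) - superComm i j k l (x i j p) (y k l (q - 1))

/-- The coefficient of `u ^ p v ^ q` in
`(-1)^{ij + ik + jk} (x_{kj}(u) y_{il}(v) - y_{kj}(v) x_{il}(u))`. -/
def rttRight (x y : Fin (m + n) → Fin (m + n) → ℤ → FreeAlgebra ℂ (Gen m n))
    (i j k l : Fin (m + n)) (p q : ℤ) : FreeAlgebra ℂ (Gen m n) :=
  ((-1 : ℂ) ^ (parity i * parity j + parity i * parity k + parity j * parity k)) •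
    (x k j p * y i l q - y k j q * x i l p)

/-- The defining relations of the double Yangian at the level `0`. For `X(u) = ∑ (-1)^{ij+j}
e_{ij} ⊗ x_{ij}(u)` and `Y(v) = ∑ (-1)^{ij+j} e_{ij} ⊗ y_{ij}(v)`, the coefficient at
`e_{ij} ⊗ e_{kl}` of the relation `R(u-v) X_1(u) Y_2(v) = Y_2(v) X_1(u) R(u-v)`, multiplied by
`u - v`, is
`(u - v) [x_{ij}(u), y_{kl}(v)] = (-1)^{ij+ik+jk} (x_{kj}(u) y_{il}(v) - y_{kj}(v) x_{il}(u))`.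
It is imposed for `(X, Y)` equal to `(T, T)`, `(T⁺, T⁺)` and `(T, T⁺)`. -/
inductive Rel (m n : ℕ) : FreeAlgebra ℂ (Gen m n) → FreeAlgebra ℂ (Gen m n) → Prop
  | rtt (i j k l : Fin (m + n)) (p q : ℤ) : Rel m n
      (rttLeft freeCoeffT freeCoeffT i j k l p q) (rttRight freeCoeffT freeCoeffT i j k l p q)
  | rttPlus (i j k l : Fin (m + n)) (p q : ℤ) : Rel m n
      (rttLeft freeCoeffTPlus freeCoeffTPlus i j k l p q)
      (rttRight freeCoeffTPlus freeCoeffTPlus i j k l p q)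
  | rttMixed (i j k l : Fin (m + n)) (p q : ℤ) : Rel m n
      (rttLeft freeCoeffT freeCoeffTPlus i j k l p q)
      (rttRight freeCoeffT freeCoeffTPlus i j k l p q)

/-- The double Yangian of `gl_{m|n}` at the level `0`. -/
def DY0 (m n : ℕ) : Type := RingQuot (Rel m n)

instance : Ring (DY0 m n) := inferInstanceAs (Ring (RingQuot (Rel m n)))
instance : Algebra ℂ (DY0 m n) := inferInstanceAs (Algebra ℂ (RingQuot (Rel m n)))

/-- The quotient map from the free algebra. -/
def DY0.proj (m n : ℕ) : FreeAlgebra ℂ (Gen m n) →ₐ[ℂ] DY0 m n := RingQuot.mkAlgHom ℂ (Rel m n)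

/-- The element `t_{ij}^{(r)}` of the double Yangian, with `t_{ij}^{(0)} = δ_{ij}`. -/
def DY0.t (i j : Fin (m + n)) (r : ℤ) : DY0 m n := DY0.proj m n (freeT i j r)

/-- The subspace of elements of `deg₂` at most `d`: the span of the monomials in the generators
of total degree at most `d`. -/
def DY0.filt (m n : ℕ) (d : ℤ) : Submodule ℂ (DY0 m n) :=
  Submodule.span ℂ {x | ∃ w : List (Gen m n),
    (w.map fun g => degTwo g.r).sum ≤ d ∧ x = (w.map fun g => DY0.t g.i g.j g.r).prod}

theorem DY0.filt_mono : Monotone (DY0.filt m n) := fun _ _ hab =>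
  Submodule.span_mono fun _ ⟨w, hw, hx⟩ => ⟨w, hw.trans hab, hx⟩

theorem DY0.t_mem (i j : Fin (m + n)) {r : ℤ} (hr : r ≠ 0) :
    DY0.t i j r ∈ DY0.filt m n (degTwo r) :=
  Submodule.subset_span ⟨[⟨i, j, r, hr⟩], by simp, by simp⟩

instance : SetLike.GradedMonoid (DY0.filt m n) where
  one_mem := Submodule.subset_span ⟨[], by simp, by simp⟩
  mul_mem a b x y hx hy := by
    have h := Submodule.mul_mem_mul hx hy
    rw [DY0.filt, DY0.filt, Submodule.span_mul_span] at h
    refine Submodule.span_mono ?_ h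
    rintro _ ⟨_, ⟨v, hv, rfl⟩, _, ⟨w, hw, rfl⟩, rfl⟩
    exact ⟨v ++ w, by simpa using add_le_add hv hw, by simp⟩

theorem DY0.exists_mem_filt (x : DY0 m n) : ∃ d : ℕ, x ∈ DY0.filt m n d := by
  obtain ⟨x, rfl⟩ := RingQuot.mkAlgHom_surjective ℂ (Rel m n) x
  induction x using FreeAlgebra.induction with
  | grade0 c =>
    refine ⟨0, ?_⟩
    rw [AlgHom.commutes, Algebra.algebraMap_eq_smul_one]
    exact Submodule.smul_mem _ _ (SetLike.one_mem_graded (DY0.filt m n))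
  | grade1 g =>
    refine ⟨(degTwo g.r).toNat, DY0.filt_mono (Int.self_le_toNat _) ?_⟩
    have h := DY0.t_mem g.i g.j g.hr
    rwa [DY0.t, freeT, dif_pos g.hr] at h
  | mul a b ha hb =>
    obtain ⟨d, hd⟩ := ha
    obtain ⟨e, he⟩ := hb
    refine ⟨d + e, ?_⟩
    rw [map_mul, Nat.cast_add]
    exact SetLike.mul_mem_graded (A := DY0.filt m n) hd he
  | add a b ha hb =>
    obtain ⟨d, hd⟩ := ha
    obtain ⟨e, he⟩ := hb
    refine ⟨d + e, ?_⟩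
    rw [map_add, Nat.cast_add]
    exact add_mem (DY0.filt_mono (by lia) hd) (DY0.filt_mono (by lia) he)

theorem DY0.ringSubgroupsBasis (m n : ℕ) :
    RingSubgroupsBasis fun N : ℕ => (DY0.filt m n (-(N : ℤ))).toAddSubgroup where
  inter i j := ⟨max i j, le_inf (fun _ h => DY0.filt_mono (by lia) h)
    (fun _ h => DY0.filt_mono (by lia) h)⟩
  mul i := ⟨i, by
    rintro _ ⟨x, hx, y, hy, rfl⟩
    exact DY0.filt_mono (by lia) (SetLike.mul_mem_graded (A := DY0.filt m n) hx hy)⟩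
  leftMul x i := by
    obtain ⟨d, hd⟩ := DY0.exists_mem_filt x
    exact ⟨i + d, fun y hy => DY0.filt_mono (by lia)
      (SetLike.mul_mem_graded (A := DY0.filt m n) hd hy)⟩
  rightMul x i := by
    obtain ⟨d, hd⟩ := DY0.exists_mem_filt x
    exact ⟨i + d, fun y hy => DY0.filt_mono (by lia)
      (SetLike.mul_mem_graded (A := DY0.filt m n) hy hd)⟩

/-- The topology on the double Yangian induced by the filtration by `deg₂`: the subspaces of
elements of degree at most `-N` form a basis of neighbourhoods of zero. -/
instance : UniformSpace (DY0 m n) :=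
  letI := (DY0.ringSubgroupsBasis m n).topology
  haveI : IsTopologicalRing (DY0 m n) :=
    (DY0.ringSubgroupsBasis m n).toRingFilterBasis.isTopologicalRing
  IsTopologicalAddGroup.rightUniformSpace (DY0 m n)

instance : IsTopologicalRing (DY0 m n) :=
  (DY0.ringSubgroupsBasis m n).toRingFilterBasis.isTopologicalRing

instance : IsUniformAddGroup (DY0 m n) :=
  letI := (DY0.ringSubgroupsBasis m n).topology
  haveI : IsTopologicalRing (DY0 m n) :=
    (DY0.ringSubgroupsBasis m n).toRingFilterBasis.isTopologicalRing
  isUniformAddGroup_of_addCommGroup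

instance : NonarchimedeanRing (DY0 m n) := (DY0.ringSubgroupsBasis m n).nonarchimedean

instance : UniformContinuousConstSMul ℂ (DY0 m n) where
  uniformContinuous_const_smul c := by
    have h : Continuous fun x : DY0 m n => algebraMap ℂ (DY0 m n) c * x := by fun_prop
    simp only [Algebra.smul_def]
    exact uniformContinuous_addMonoidHom_of_continuous
      (f := AddMonoidHom.mulLeft (algebraMap ℂ (DY0 m n) c)) h

/-- The completion of the double Yangian with respect to the topology induced by `deg₂`. -/
abbrev CDY (m n : ℕ) : Type := UniformSpace.Completion (DY0 m n)

instance : IsTopologicalRing (CDY m n) := inferInstance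
instance : Algebra ℂ (CDY m n) := inferInstance
instance : ContinuousConstSMul ℂ (CDY m n) := inferInstance
instance : NonarchimedeanRing (CDY m n) := inferInstance

/-- The canonical map from the double Yangian to its completion. -/
def toCDY (m n : ℕ) : DY0 m n →ₐ[ℂ] CDY m n where
  __ := (UniformSpace.Completion.coeRingHom : DY0 m n →+* CDY m n)
  commutes' _ := rfl

/-- The element `t_{ij}^{(r)}` of the completion. -/
def tC (i j : Fin (m + n)) (r : ℤ) : CDY m n := toCDY m n (DY0.t i j r)

/-- The extension of `deg₂` to the completion, as a filtration: the elements of degree at most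
`d` are the limits of elements of the double Yangian of degree at most `d`. -/
def cfilt (m n : ℕ) (d : ℤ) : Submodule ℂ (CDY m n) :=
  ((DY0.filt m n d).map (toCDY m n).toLinearMap).topologicalClosure

theorem cfilt_mono : Monotone (cfilt m n) := fun _ _ hab =>
  Submodule.topologicalClosure_mono (Submodule.map_mono (DY0.filt_mono hab))

theorem toCDY_mem {d : ℤ} {x : DY0 m n} (hx : x ∈ DY0.filt m n d) :
    toCDY m n x ∈ cfilt m n d :=
  Submodule.le_topologicalClosure _ ⟨x, hx, rfl⟩

instance : SetLike.GradedMonoid (cfilt m n) where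
  one_mem := by
    rw [← map_one (toCDY m n)]
    exact toCDY_mem (SetLike.one_mem_graded (DY0.filt m n))
  mul_mem a b x y hx hy := by
    refine map_mem_closure₂ continuous_mul hx hy ?_
    rintro _ ⟨x, hx, rfl⟩ _ ⟨y, hy, rfl⟩
    exact ⟨x * y, SetLike.mul_mem_graded hx hy, map_mul (toCDY m n) x y⟩

instance : IsRingFiltration (cfilt m n) (fun d => cfilt m n (d - 1)) :=
  IsRingFiltration.mk_int _ cfilt_mono

theorem tC_mem (i j : Fin (m + n)) {r : ℤ} (hr : r ≠ 0) : tC i j r ∈ cfilt m n (degTwo r) :=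
  toCDY_mem (DY0.t_mem i j hr)


/-- Square matrices of order `m + n` over the completed double Yangian. For even matrices
`X = ∑ (-1)^{ij+j} e_{ij} ⊗ x_{ij}` and `Y = ∑ (-1)^{ij+j} e_{ij} ⊗ y_{ij}` (with `x_{ij}`,
`y_{ij}` of parity `i + j`), the sign convention makes the product in the tensor product of
superalgebras the ordinary one, `XY = ∑ (-1)^{ij+j} e_{ij} ⊗ ∑_k x_{ik} y_{kj}`, so such an `X`
is represented by the matrix `(x_{ij})`. -/
abbrev Mat (m n : ℕ) : Type := Matrix (Fin (m + n)) (Fin (m + n)) (CDY m n)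

/-- The matrix `T(u)`, as a formal power series in `u⁻¹` with matrix coefficients. -/
def TSer (m n : ℕ) : PowerSeries (Mat m n) :=
  PowerSeries.mk fun r => Matrix.of fun i j => tC i j (r : ℤ)

/-- The matrix `T⁺(u)`, as a formal power series in `u` with matrix coefficients. -/
def TPlusSer (m n : ℕ) : PowerSeries (Mat m n) :=
  PowerSeries.mk fun s => Matrix.of fun i j =>
    (if s = 0 then tC i j 0 else 0) - tC i j (-((s : ℤ) + 1))

/-- The substitution `x ↦ -x` in a formal power series in `x`. -/
def negVar {R : Type*} [Ring R] (f : PowerSeries R) : PowerSeries R :=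
  PowerSeries.mk fun r => (-1) ^ r * PowerSeries.coeff r f

/-- The matrix `G = diag(ε_1, …, ε_{m+n})`, with `ε_i = 1` for the first `ℓ` indices and
`ε_i = -1` for the other ones. -/
def GMat (m n ℓ : ℕ) : Mat m n := Matrix.diagonal fun i => if i.val < ℓ then 1 else -1

/-- `B(u) = T(u) G T(-u)⁻¹`, as a formal power series in `u⁻¹`. -/
def BSer (m n ℓ : ℕ) : PowerSeries (Mat m n) :=
  TSer m n * PowerSeries.C (GMat m n ℓ) * Ring.inverse (negVar (TSer m n))

/-- `B⁺(u) = T⁺(u) G T⁺(-u)⁻¹`, as a formal power series in `u`. -/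
def BPlusSer (m n ℓ : ℕ) : PowerSeries (Mat m n) :=
  TPlusSer m n * PowerSeries.C (GMat m n ℓ) * Ring.inverse (negVar (TPlusSer m n))

/-- `b_{ij}^{(r)}` for `r ≥ 1`, where `b_{ij}(u) = g_{ij} + ∑_{r ≥ 1} b_{ij}^{(r)} u^{-r}`. -/
def b (ℓ : ℕ) (i j : Fin (m + n)) (r : ℕ) : CDY m n := PowerSeries.coeff r (BSer m n ℓ) i j

/-- `b_{ij}^{(-r)}` for `r ≥ 1`, where `b⁺_{ij}(u) = g_{ij} - ∑_{r ≥ 1} b_{ij}^{(-r)} u^{r-1}`. -/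
def bPlus (ℓ : ℕ) (i j : Fin (m + n)) (r : ℕ) : CDY m n :=
  (if r = 1 then GMat m n ℓ i j else 0) - PowerSeries.coeff (r - 1) (BPlusSer m n ℓ) i j

section Bounds

theorem hasBasis_nhds_zero_cfilt {U : Set (CDY m n)} (hU : U ∈ nhds (0 : CDY m n)) :
    ∃ N : ℕ, (cfilt m n (-(N : ℤ)) : Set (CDY m n)) ⊆ U := by
  obtain ⟨C, ⟨hC, hCc⟩, hCU⟩ := (closed_nhds_basis (0 : CDY m n)).mem_iff.mp hU
  have hcont : Continuous (toCDY m n) := UniformSpace.Completion.continuous_coe (DY0 m n)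
  have h : toCDY m n ⁻¹' C ∈ nhds (0 : DY0 m n) :=
    hcont.continuousAt.preimage_mem_nhds (by rwa [map_zero])
  obtain ⟨N, -, hN⟩ := (DY0.ringSubgroupsBasis m n).hasBasis_nhds_zero.mem_iff.mp h
  refine ⟨N, (closure_minimal ?_ hCc).trans hCU⟩
  rintro _ ⟨x, hx, rfl⟩
  exact hN hx

theorem matPow_mem {M : Mat m n} (hM : ∀ i j, M i j ∈ cfilt m n (-1)) (k : ℕ) :
    ∀ i j, (M ^ k) i j ∈ cfilt m n (-(k : ℤ)) := by
  induction k with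
  | zero =>
    intro i j
    rw [pow_zero, Matrix.one_apply]
    split_ifs
    · simpa using SetLike.one_mem_graded (cfilt m n)
    · exact zero_mem _
  | succ k ih =>
    intro i j
    rw [pow_succ, Matrix.mul_apply]
    refine sum_mem fun a _ => ?_
    have h := SetLike.mul_mem_graded (A := cfilt m n) (ih i a) (hM a j)
    rwa [show -(k : ℤ) + -1 = -((k + 1 : ℕ) : ℤ) by push_cast; ring] at h

/-- The geometric series: if the entries of `M` have degree at most `-1`, then `1 - M` is
invertible and the entries of its inverse are limits of sums of entries of powers of `M`. -/
theorem exists_unit {M : Mat m n} (hM : ∀ i j, M i j ∈ cfilt m n (-1)) :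
    ∃ u : (Mat m n)ˣ, (u : Mat m n) = 1 - M ∧
      ∀ K : Set (CDY m n), IsClosed K →
        (∀ s : Finset ℕ, ∀ i j, (∑ k ∈ s, M ^ k) i j ∈ K) →
        ∀ i j, (↑u⁻¹ : Mat m n) i j ∈ K := by
  have hsum : Summable fun k : ℕ => M ^ k := by
    refine Pi.summable.2 fun i => Pi.summable.2 fun j => ?_
    refine NonarchimedeanAddGroup.summable_of_tendsto_cofinite_zero ?_
    rw [Nat.cofinite_eq_atTop]
    intro U hU
    obtain ⟨N, hN⟩ := hasBasis_nhds_zero_cfilt hU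
    rw [Filter.mem_map]
    filter_upwards [Filter.eventually_ge_atTop N] with k hk
    exact hN (cfilt_mono (by lia) (matPow_mem hM k i j))
  refine ⟨⟨1 - M, ∑' k, M ^ k, hsum.one_sub_mul_tsum_pow, hsum.tsum_pow_mul_one_sub⟩, rfl, ?_⟩
  intro K hK h i j
  have h1 := Pi.hasSum.1 (Pi.hasSum.1 hsum.hasSum i) j
  refine hK.mem_of_tendsto h1 (Filter.Eventually.of_forall fun s => ?_)
  have h2 := h s i j
  rwa [Matrix.sum_apply] at h2

/-- The series `f = 1 + h` such that the coefficient of `x ^ k` in `h` has degree at most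
`e k - 1`. -/
def Adm (e : ℤ) (f : PowerSeries (Mat m n)) : Prop :=
  ∀ (k : ℕ) (i j : Fin (m + n)), (PowerSeries.coeff k (f - 1) : Mat m n) i j ∈ cfilt m n (e * k - 1)

theorem exists_unit_coeff {e : ℤ} {f : PowerSeries (Mat m n)} (hf : Adm e f) :
    ∃ u : (Mat m n)ˣ, (u : Mat m n) = PowerSeries.constantCoeff f ∧
      ∀ K : Set (CDY m n), IsClosed K →
        (∀ s : Finset ℕ, ∀ i j, (∑ k ∈ s, (1 - PowerSeries.constantCoeff f) ^ k) i j ∈ K) →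
        ∀ i j, (↑u⁻¹ : Mat m n) i j ∈ K := by
  have hM : ∀ i j, (1 - PowerSeries.constantCoeff f) i j ∈ cfilt m n (-1) := by
    intro i j
    have h := neg_mem (hf 0 i j)
    rw [PowerSeries.coeff_zero_eq_constantCoeff_apply, map_sub, map_one] at h
    simpa using h
  obtain ⟨u, hu, h⟩ := exists_unit hM
  exact ⟨u, by rw [hu]; abel, h⟩

theorem isUnit_of_adm {e : ℤ} {f : PowerSeries (Mat m n)} (hf : Adm e f) : IsUnit f := by
  obtain ⟨u, hu, -⟩ := exists_unit_coeff hf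
  exact ⟨⟨f, f.invOfUnit u, f.mul_invOfUnit u hu.symm, f.invOfUnit_mul u hu.symm⟩, rfl⟩

/-- Recursive formula for the coefficients of an inverse. -/
theorem coeff_inverse {f : PowerSeries (Mat m n)} (hf : IsUnit f) (u : (Mat m n)ˣ)
    (hu : (u : Mat m n) = PowerSeries.constantCoeff f) (s : ℕ) :
    PowerSeries.coeff s (Ring.inverse f) = ↑u⁻¹ * ((if s = 0 then 1 else 0) -
      ∑ k ∈ Finset.range s, PowerSeries.coeff (k + 1) f *
        PowerSeries.coeff (s - (k + 1)) (Ring.inverse f)) := by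
  have h := congrArg (PowerSeries.coeff s) (Ring.mul_inverse_cancel f hf)
  rw [PowerSeries.coeff_mul, Finset.Nat.sum_antidiagonal_eq_sum_range_succ
    (fun k l => PowerSeries.coeff k f * PowerSeries.coeff l (Ring.inverse f)),
    Finset.sum_range_succ', PowerSeries.coeff_one] at h
  rw [← h, add_sub_cancel_left, PowerSeries.coeff_zero_eq_constantCoeff_apply, ← hu,
    Units.inv_mul_cancel_left, Nat.sub_zero]

theorem coeff_inverse_mem {e : ℤ} {f : PowerSeries (Mat m n)} (hf : Adm e f) (s : ℕ) :
    ∀ i j, PowerSeries.coeff s (Ring.inverse f) i j ∈ cfilt m n (e * s) := by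
  obtain ⟨u, hu, hcl⟩ := exists_unit_coeff hf
  have hM : ∀ i j, (1 - PowerSeries.constantCoeff f) i j ∈ cfilt m n (-1) := by
    intro i j
    have h := neg_mem (hf 0 i j)
    rw [PowerSeries.coeff_zero_eq_constantCoeff_apply, map_sub, map_one] at h
    simpa using h
  have h0 : ∀ i j, (↑u⁻¹ : Mat m n) i j ∈ cfilt m n 0 :=
    hcl _ (Submodule.isClosed_topologicalClosure _) fun t i j => by
      rw [Matrix.sum_apply]
      exact sum_mem fun k _ => cfilt_mono (by lia) (matPow_mem hM k i j)
  induction s using Nat.strong_induction_on with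
  | _ s ih =>
    intro i j
    rw [coeff_inverse (isUnit_of_adm hf) u hu s, Matrix.mul_apply]
    refine sum_mem fun a _ => ?_
    rw [← zero_add (e * s)]
    refine SetLike.mul_mem_graded (h0 i a) ?_
    rw [Matrix.sub_apply, Matrix.sum_apply]
    refine sub_mem ?_ (sum_mem fun k hk => ?_)
    · split_ifs with hs
      · subst hs
        rw [Matrix.one_apply]
        split_ifs
        · simpa using SetLike.one_mem_graded (cfilt m n)
        · exact zero_mem _
      · exact zero_mem _
    · have hk' : k < s := Finset.mem_range.1 hk
      rw [Matrix.mul_apply]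
      refine sum_mem fun c _ => ?_
      have h1 := hf (k + 1) a c
      rw [map_sub, PowerSeries.coeff_one, if_neg k.succ_ne_zero, sub_zero] at h1
      have h2 := SetLike.mul_mem_graded (A := cfilt m n) h1 (ih (s - (k + 1)) (by lia) c j)
      refine cfilt_mono ?_ h2
      rw [Nat.cast_sub hk']
      push_cast
      linarith

theorem sub_conj_eq {R : Type*} [Ring R] (f g c s : R) (h : g * s = 1) :
    f * c * s - c = ((f - 1) * c) * s - c * ((g - 1) * s) := by
  rw [sub_mul g, h, sub_mul f, sub_mul (f * c), mul_sub, one_mul, one_mul, mul_one]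
  abel

theorem coeff_conj_mem {e : ℤ} {f g : PowerSeries (Mat m n)} (hf : Adm e f) (hg : Adm e g)
    (ℓ k : ℕ) (i j : Fin (m + n)) :
    PowerSeries.coeff k (f * PowerSeries.C (GMat m n ℓ) * Ring.inverse g -
      PowerSeries.C (GMat m n ℓ)) i j ∈ cfilt m n (e * k - 1) := by
  have hG : ∀ (X : Mat m n) (i j : Fin (m + n)), ∃ c : ℂ, (X * GMat m n ℓ) i j = c • X i j := by
    intro X i j
    refine ⟨if j.val < ℓ then 1 else -1, ?_⟩
    rw [GMat, Matrix.mul_diagonal]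
    split_ifs <;> simp
  have hG' : ∀ (X : Mat m n) (i j : Fin (m + n)), ∃ c : ℂ, (GMat m n ℓ * X) i j = c • X i j := by
    intro X i j
    refine ⟨if i.val < ℓ then 1 else -1, ?_⟩
    rw [GMat, Matrix.diagonal_mul]
    split_ifs <;> simp
  have hmul : ∀ (p q : PowerSeries (Mat m n)) (α β : ℤ),
      (∀ (k : ℕ) i j, PowerSeries.coeff k p i j ∈ cfilt m n (e * k + α)) →
      (∀ (k : ℕ) i j, PowerSeries.coeff k q i j ∈ cfilt m n (e * k + β)) →
      ∀ (k : ℕ) i j, PowerSeries.coeff k (p * q) i j ∈ cfilt m n (e * k + (α + β)) := by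
    intro p q α β hp hq k i j
    rw [PowerSeries.coeff_mul, Matrix.sum_apply]
    refine sum_mem fun x hx => ?_
    rw [Matrix.mul_apply]
    refine sum_mem fun a _ => ?_
    have h := SetLike.mul_mem_graded (A := cfilt m n) (hp x.1 i a) (hq x.2 a j)
    rw [← Finset.HasAntidiagonal.mem_antidiagonal.1 hx]
    convert h using 2
    push_cast
    ring
  have hS : ∀ (k : ℕ) i j, PowerSeries.coeff k (Ring.inverse g) i j ∈ cfilt m n (e * k + 0) := by
    simpa using coeff_inverse_mem hg
  have key : f * PowerSeries.C (GMat m n ℓ) * Ring.inverse g - PowerSeries.C (GMat m n ℓ) =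
      ((f - 1) * PowerSeries.C (GMat m n ℓ)) * Ring.inverse g -
        PowerSeries.C (GMat m n ℓ) * ((g - 1) * Ring.inverse g) :=
    sub_conj_eq _ _ _ _ (Ring.mul_inverse_cancel g (isUnit_of_adm hg))
  have hf' : ∀ (k : ℕ) (i j : Fin (m + n)), (PowerSeries.coeff k (f - 1) : Mat m n) i j ∈
      cfilt m n (e * k + -1) := hf
  have hg' : ∀ (k : ℕ) (i j : Fin (m + n)), (PowerSeries.coeff k (g - 1) : Mat m n) i j ∈
      cfilt m n (e * k + -1) := hg
  have hfG : ∀ (k : ℕ) (i j : Fin (m + n)),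
      (PowerSeries.coeff k ((f - 1) * PowerSeries.C (GMat m n ℓ)) : Mat m n) i j ∈
      cfilt m n (e * k + -1) := by
    intro k i j
    rw [PowerSeries.coeff_mul_C]
    obtain ⟨c, hc⟩ := hG (PowerSeries.coeff k (f - 1)) i j
    rw [hc]
    exact Submodule.smul_mem _ _ (hf' k i j)
  have h1 := hmul _ _ (-1) 0 hfG hS k i j
  have h2 := hmul _ _ (-1) 0 hg' hS k i j
  have hd : e * (k : ℤ) - 1 = e * k + (-1 + 0) := by ring
  rw [key, map_sub, Matrix.sub_apply, hd]
  refine sub_mem h1 ?_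
  rw [PowerSeries.coeff_C_mul]
  obtain ⟨c, hc⟩ := hG' (PowerSeries.coeff k ((g - 1) * Ring.inverse g)) i j
  rw [hc]
  exact Submodule.smul_mem _ _ h2

theorem adm_negVar {e : ℤ} {f : PowerSeries (Mat m n)} (hf : Adm e f) : Adm e (negVar f) := by
  intro k i j
  have h1 : PowerSeries.coeff k (negVar f - 1) =
      (-1 : ℂ) ^ k • PowerSeries.coeff k (f - 1) := by
    rw [map_sub, map_sub, negVar, PowerSeries.coeff_mk, PowerSeries.coeff_one]
    rcases Nat.even_or_odd k with h | h
    · simp [h.neg_one_pow]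
    · have : k ≠ 0 := by rintro rfl; simp at h
      simp [h.neg_one_pow, this]
  rw [h1, Matrix.smul_apply]
  exact Submodule.smul_mem _ _ (hf k i j)

theorem tC_zero (i j : Fin (m + n)) : tC i j 0 = (1 : Mat m n) i j := by
  rw [tC, DY0.t, freeT, dif_neg (by simp), Matrix.one_apply]
  split_ifs <;> simp

theorem adm_TSer (m n : ℕ) : Adm 1 (TSer m n) := by
  intro k i j
  rw [map_sub, TSer, PowerSeries.coeff_mk, PowerSeries.coeff_one, Matrix.sub_apply,
    Matrix.of_apply]
  rcases Nat.eq_zero_or_pos k with rfl | hk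
  · rw [if_pos rfl, Nat.cast_zero, tC_zero, sub_self]
    exact zero_mem _
  · rw [if_neg hk.ne', Matrix.zero_apply, sub_zero, one_mul]
    have h := tC_mem i j (r := (k : ℤ)) (by lia)
    rwa [degTwo, if_pos (by lia)] at h

theorem adm_TPlusSer (m n : ℕ) : Adm (-1) (TPlusSer m n) := by
  intro k i j
  rw [map_sub, TPlusSer, PowerSeries.coeff_mk, PowerSeries.coeff_one, Matrix.sub_apply,
    Matrix.of_apply]
  have h := tC_mem i j (r := -((k : ℤ) + 1)) (by lia)
  rw [degTwo, if_neg (by lia), show -((k : ℤ) + 1) = -1 * k - 1 by ring] at h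
  have h' := neg_mem h
  rw [show -1 * (k : ℤ) - 1 = -((k : ℤ) + 1) by ring] at h' ⊢
  rcases Nat.eq_zero_or_pos k with rfl | hk
  · rw [if_pos rfl, if_pos rfl, tC_zero]
    convert h' using 1
    abel
  · rw [if_neg hk.ne', if_neg hk.ne', Matrix.zero_apply, sub_zero, zero_sub]
    exact h'

/-- `T(-u)` is invertible. -/
theorem isUnit_negVar_TSer (m n : ℕ) : IsUnit (negVar (TSer m n)) :=
  isUnit_of_adm (adm_negVar (adm_TSer m n))

/-- `T⁺(-u)` is invertible over the completion. -/
theorem isUnit_negVar_TPlusSer (m n : ℕ) : IsUnit (negVar (TPlusSer m n)) :=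
  isUnit_of_adm (adm_negVar (adm_TPlusSer m n))

/-- `b_{ij}^{(r)}` has degree at most `r - 1`. -/
theorem b_mem (ℓ : ℕ) (i j : Fin (m + n)) {r : ℕ} (hr : 1 ≤ r) :
    b ℓ i j r ∈ cfilt m n ((r : ℤ) - 1) := by
  have h := coeff_conj_mem (adm_TSer m n) (adm_negVar (adm_TSer m n)) ℓ r i j
  rw [map_sub, PowerSeries.coeff_C, if_neg (by lia), sub_zero, one_mul] at h
  exact h

/-- `b_{ij}^{(-r)}` has degree at most `-r`. -/
theorem bPlus_mem (ℓ : ℕ) (i j : Fin (m + n)) {r : ℕ} (hr : 1 ≤ r) :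
    bPlus ℓ i j r ∈ cfilt m n (-(r : ℤ)) := by
  have h := neg_mem (coeff_conj_mem (adm_TPlusSer m n) (adm_negVar (adm_TPlusSer m n))
    ℓ (r - 1) i j)
  rw [map_sub, PowerSeries.coeff_C, Matrix.sub_apply, neg_sub] at h
  rw [show -(r : ℤ) = -1 * ((r - 1 : ℕ) : ℤ) - 1 by push_cast [Nat.cast_sub hr]; ring]
  convert h using 1
  rw [bPlus, BPlusSer]
  congr 1
  rcases eq_or_ne r 1 with rfl | hr1
  · simp
  · rw [if_neg hr1, if_neg (by lia), Matrix.zero_apply]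

end Bounds

/-- The subalgebra generated by all `t_{ij}^{(r)}` with `r ≥ 1`. -/
def yang (m n : ℕ) : Subalgebra ℂ (CDY m n) :=
  Algebra.adjoin ℂ {x | ∃ (i j : Fin (m + n)) (r : ℕ), 1 ≤ r ∧ x = tC i j (r : ℤ)}

/-- The completion of the subalgebra generated by all `t_{ij}^{(-r)}` with `r ≥ 1`. -/
def extYangPlus (m n : ℕ) : Subalgebra ℂ (CDY m n) :=
  (Algebra.adjoin ℂ {x | ∃ (i j : Fin (m + n)) (r : ℕ), 1 ≤ r ∧
    x = tC i j (-(r : ℤ))}).topologicalClosure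

/-- The extended double Yangian at the level `0`: the subalgebra generated by the completion of
the dual Yangian and by the Yangian. By the mixed relations it is the span of the products `x y`
with `x` in the former and `y` in the latter. -/
def extDY (m n : ℕ) : Subalgebra ℂ (CDY m n) := extYangPlus m n ⊔ yang m n

section Containment

theorem coeff_conj_mem_subalgebra {e : ℤ} {f : PowerSeries (Mat m n)} (hf : Adm e f)
    (K : Subalgebra ℂ (CDY m n))
    (hK : ∀ (k : ℕ) (i j : Fin (m + n)), (PowerSeries.coeff k f : Mat m n) i j ∈ K)
    (hu : ∀ u : (Mat m n)ˣ, (u : Mat m n) = PowerSeries.constantCoeff (negVar f) →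
      ∀ i j, (↑u⁻¹ : Mat m n) i j ∈ K) (ℓ k : ℕ) (i j : Fin (m + n)) :
    (PowerSeries.coeff k (f * PowerSeries.C (GMat m n ℓ) * Ring.inverse (negVar f)) : Mat m n)
      i j ∈ K := by
  obtain ⟨u, huf, -⟩ := exists_unit_coeff (adm_negVar hf)
  have hM : ∀ X Y : Mat m n, (∀ i j, X i j ∈ K) → (∀ i j, Y i j ∈ K) →
      ∀ i j, (X * Y) i j ∈ K := by
    intro X Y hX hY i j
    rw [Matrix.mul_apply]
    exact sum_mem fun a _ => mul_mem (hX i a) (hY a j)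
  have hneg : ∀ (k : ℕ) (i j : Fin (m + n)),
      (PowerSeries.coeff k (negVar f) : Mat m n) i j ∈ K := by
    intro k i j
    rw [negVar, PowerSeries.coeff_mk]
    rcases Nat.even_or_odd k with h | h
    · rw [h.neg_one_pow, one_mul]
      exact hK k i j
    · rw [h.neg_one_pow, neg_one_mul, Matrix.neg_apply]
      exact neg_mem (hK k i j)
  have hinv : ∀ (s : ℕ) (i j : Fin (m + n)),
      (PowerSeries.coeff s (Ring.inverse (negVar f)) : Mat m n) i j ∈ K := by
    intro s
    induction s using Nat.strong_induction_on with
    | _ s ih =>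
      rw [coeff_inverse (isUnit_of_adm (adm_negVar hf)) u huf s]
      refine hM _ _ (hu u huf) fun i j => ?_
      rw [Matrix.sub_apply, Matrix.sum_apply]
      refine sub_mem ?_ (sum_mem fun k hk => ?_)
      · split_ifs
        · rw [Matrix.one_apply]
          split_ifs
          · exact one_mem _
          · exact zero_mem _
        · exact zero_mem _
      · have hk' : k < s := Finset.mem_range.1 hk
        exact hM _ _ (hneg (k + 1)) (ih (s - (k + 1)) (by lia)) i j
  have hG : ∀ i j, GMat m n ℓ i j ∈ K := by
    intro i j
    rw [GMat, Matrix.diagonal_apply]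
    split_ifs
    · exact one_mem _
    · exact neg_mem (one_mem _)
    · exact zero_mem _
  rw [PowerSeries.coeff_mul, Matrix.sum_apply]
  refine sum_mem fun x _ => ?_
  rw [PowerSeries.coeff_mul_C]
  exact hM _ _ (hM _ _ (hK x.1) hG) (hinv x.2) i j

theorem b_mem_yang (ℓ : ℕ) (i j : Fin (m + n)) (r : ℕ) : b ℓ i j r ∈ yang m n := by
  refine coeff_conj_mem_subalgebra (adm_TSer m n) (yang m n) ?_ ?_ ℓ r i j
  · intro k i j
    rw [TSer, PowerSeries.coeff_mk, Matrix.of_apply]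
    rcases Nat.eq_zero_or_pos k with rfl | hk
    · rw [Nat.cast_zero, tC_zero, Matrix.one_apply]
      split_ifs
      · exact one_mem _
      · exact zero_mem _
    · exact Algebra.subset_adjoin ⟨i, j, k, hk, rfl⟩
  · intro u hu i j
    have h1 : (u : Mat m n) = 1 := by
      rw [hu, ← PowerSeries.coeff_zero_eq_constantCoeff_apply, negVar, PowerSeries.coeff_mk,
        pow_zero, one_mul, TSer, PowerSeries.coeff_mk]
      ext i j
      rw [Matrix.of_apply, Nat.cast_zero, tC_zero]
    rw [Units.val_eq_one.1 h1, inv_one, Units.val_one, Matrix.one_apply]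
    split_ifs
    · exact one_mem _
    · exact zero_mem _

theorem bPlus_mem_extYangPlus (ℓ : ℕ) (i j : Fin (m + n)) (r : ℕ) :
    bPlus ℓ i j r ∈ extYangPlus m n := by
  have hcoeff : ∀ (k : ℕ) (i j : Fin (m + n)),
      (PowerSeries.coeff k (TPlusSer m n) : Mat m n) i j ∈ extYangPlus m n := by
    intro k i j
    rw [TPlusSer, PowerSeries.coeff_mk, Matrix.of_apply]
    refine sub_mem ?_ (Subalgebra.le_topologicalClosure _ (Algebra.subset_adjoin
      ⟨i, j, k + 1, by lia, by push_cast; rfl⟩))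
    split_ifs
    · rw [tC_zero, Matrix.one_apply]
      split_ifs
      · exact one_mem _
      · exact zero_mem _
    · exact zero_mem _
  have h : (PowerSeries.coeff (r - 1) (BPlusSer m n ℓ) : Mat m n) i j ∈ extYangPlus m n := by
    refine coeff_conj_mem_subalgebra (adm_TPlusSer m n) (extYangPlus m n) hcoeff ?_ ℓ (r - 1) i j
    intro u hu
    obtain ⟨v, hv, hcl⟩ := exists_unit_coeff (adm_negVar (adm_TPlusSer m n))
    rw [Units.ext (hu.trans hv.symm)]
    refine hcl _ (Subalgebra.isClosed_topologicalClosure _) fun s i j => ?_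
    have hpow : ∀ (k : ℕ) i j,
        ((1 - PowerSeries.constantCoeff (negVar (TPlusSer m n))) ^ k : Mat m n) i j ∈
          extYangPlus m n := by
      intro k
      induction k with
      | zero =>
        intro i j
        rw [pow_zero, Matrix.one_apply]
        split_ifs
        · exact one_mem _
        · exact zero_mem _
      | succ k ih =>
        intro i j
        rw [pow_succ, Matrix.mul_apply]
        refine sum_mem fun a _ => mul_mem (ih i a) ?_
        rw [Matrix.sub_apply, ← PowerSeries.coeff_zero_eq_constantCoeff_apply, negVar,
          PowerSeries.coeff_mk, pow_zero, one_mul, Matrix.one_apply]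
        refine sub_mem ?_ (hcoeff 0 a j)
        split_ifs
        · exact one_mem _
        · exact zero_mem _
    rw [Matrix.sum_apply]
    exact sum_mem fun k _ => hpow k i j
  rw [bPlus]
  refine sub_mem ?_ h
  rw [GMat, Matrix.diagonal_apply]
  split_ifs
  · exact one_mem _
  · exact neg_mem (one_mem _)
  · exact zero_mem _
  · exact zero_mem _

end Containment

/-- The reflection algebra `B(gl_{m|n})`: the unital subalgebra generated by all
`b_{ij}^{(r)}` with `r ≥ 1`. -/
def reflB (m n ℓ : ℕ) : Subalgebra ℂ (CDY m n) :=
  Algebra.adjoin ℂ {x | ∃ i j r, 1 ≤ r ∧ x = b ℓ i j r}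

/-- The reflection algebra `B⁺(gl_{m|n})`: the unital subalgebra generated by all
`b_{ij}^{(-r)}` with `r ≥ 1`. -/
def reflBPlus (m n ℓ : ℕ) : Subalgebra ℂ (CDY m n) :=
  Algebra.adjoin ℂ {x | ∃ i j r, 1 ≤ r ∧ x = bPlus ℓ i j r}

/-- The reflection algebra `DB(gl_{m|n})`: the unital subalgebra generated by all
`b_{ij}^{(r)}` and `b_{ij}^{(-r)}` with `r ≥ 1`. -/
def reflDB (m n ℓ : ℕ) : Subalgebra ℂ (CDY m n) :=
  Algebra.adjoin ℂ ({x | ∃ i j r, 1 ≤ r ∧ x = b ℓ i j r} ∪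
    {x | ∃ i j r, 1 ≤ r ∧ x = bPlus ℓ i j r})

theorem reflB_le_reflDB (m n ℓ : ℕ) : reflB m n ℓ ≤ reflDB m n ℓ :=
  Algebra.adjoin_mono Set.subset_union_left

theorem reflBPlus_le_reflDB (m n ℓ : ℕ) : reflBPlus m n ℓ ≤ reflDB m n ℓ :=
  Algebra.adjoin_mono Set.subset_union_right

theorem b_mem_reflB (ℓ : ℕ) (i j : Fin (m + n)) {r : ℕ} (hr : 1 ≤ r) :
    b ℓ i j r ∈ reflB m n ℓ :=
  Algebra.subset_adjoin ⟨i, j, r, hr, rfl⟩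

theorem bPlus_mem_reflBPlus (ℓ : ℕ) (i j : Fin (m + n)) {r : ℕ} (hr : 1 ≤ r) :
    bPlus ℓ i j r ∈ reflBPlus m n ℓ :=
  Algebra.subset_adjoin ⟨i, j, r, hr, rfl⟩

/-- The reflection algebras lie in the extended double Yangian. -/
theorem reflDB_le_extDY (m n ℓ : ℕ) : reflDB m n ℓ ≤ extDY m n := by
  refine Algebra.adjoin_le ?_
  rintro x (⟨i, j, r, -, rfl⟩ | ⟨i, j, r, -, rfl⟩)
  · exact (le_sup_right : yang m n ≤ extDY m n) (b_mem_yang ℓ i j r)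
  · exact (le_sup_left : extYangPlus m n ≤ extDY m n) (bPlus_mem_extYangPlus ℓ i j r)

/-- The associated graded algebra `gr₂ S` of a subalgebra `S`, with respect to `deg₂`. -/
abbrev GrTwo (S : Subalgebra ℂ (CDY m n)) : Type := Gr (inducedFilt (cfilt m n) S)

/-- The set `I₀` of pairs of indices which lie in the same block. -/
def I0 (m n ℓ : ℕ) : Set (Fin (m + n) × Fin (m + n)) :=
  {x | (x.1.val < ℓ ∧ x.2.val < ℓ) ∨ (ℓ ≤ x.1.val ∧ ℓ ≤ x.2.val)}

/-- The set `I₁` of pairs of indices which lie in different blocks. -/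
def I1 (m n ℓ : ℕ) : Set (Fin (m + n) × Fin (m + n)) :=
  {x | (x.1.val < ℓ ∧ ℓ ≤ x.2.val) ∨ (x.2.val < ℓ ∧ ℓ ≤ x.1.val)}

/-- The indices `(i, j, r)` of the elements `b_{ij}^{(r)}` of the family `Γ`: `r ≥ 1` is odd for
`(i, j) ∈ I₀` and even for `(i, j) ∈ I₁`. -/
def GammaIndex (m n ℓ : ℕ) : Set (Fin (m + n) × Fin (m + n) × ℕ) :=
  {x | 1 ≤ x.2.2 ∧ (((x.1, x.2.1) ∈ I0 m n ℓ ∧ Odd x.2.2) ∨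
    ((x.1, x.2.1) ∈ I1 m n ℓ ∧ Even x.2.2))}

/-- The indices `(i, j, r)` of the elements `b_{ij}^{(-r)}` of the family `Γ⁺`: `r ≥ 1` is even
for `(i, j) ∈ I₀` and odd for `(i, j) ∈ I₁`. -/
def GammaPlusIndex (m n ℓ : ℕ) : Set (Fin (m + n) × Fin (m + n) × ℕ) :=
  {x | 1 ≤ x.2.2 ∧ (((x.1, x.2.1) ∈ I0 m n ℓ ∧ Even x.2.2) ∨
    ((x.1, x.2.1) ∈ I1 m n ℓ ∧ Odd x.2.2))}

/-- The family of the images of the elements `b_{ij}^{(r)}` of `Γ` in the components of degree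
`r - 1` of `gr₂ S`, where `S` contains `B(gl_{m|n})`. -/
def gammaBar {m n ℓ : ℕ} (S : Subalgebra ℂ (CDY m n)) (hS : reflB m n ℓ ≤ S) : Set (GrTwo S) :=
  {ξ | ∃ (i j : Fin (m + n)) (r : ℕ) (h : (i, j, r) ∈ GammaIndex m n ℓ),
    ξ = symbol (inducedFilt (cfilt m n) S) ((r : ℤ) - 1)
      ⟨⟨b ℓ i j r, hS (b_mem_reflB ℓ i j h.1)⟩, b_mem ℓ i j h.1⟩}

/-- The family of the images of the elements `b_{ij}^{(-r)}` of `Γ⁺` in the components of degree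
`-r` of `gr₂ S`, where `S` contains `B⁺(gl_{m|n})`. -/
def gammaBarPlus {m n ℓ : ℕ} (S : Subalgebra ℂ (CDY m n)) (hS : reflBPlus m n ℓ ≤ S) :
    Set (GrTwo S) :=
  {ξ | ∃ (i j : Fin (m + n)) (r : ℕ) (h : (i, j, r) ∈ GammaPlusIndex m n ℓ),
    ξ = symbol (inducedFilt (cfilt m n) S) (-(r : ℤ))
      ⟨⟨bPlus ℓ i j r, hS (bPlus_mem_reflBPlus ℓ i j h.1)⟩, bPlus_mem ℓ i j h.1⟩}

end DoubleYangian

end DYang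

end

noncomputable section

namespace DYang

/-! ### Matrix and power series form of the RTT relations -/

section RTT

set_option linter.unusedSectionVars false

variable {m n : ℕ} {D E : Type*} [Ring D] [Algebra ℂ D] [Ring E] [Algebra ℂ E]

/-! Let `S` be one of the three algebras. It carries two filtrations: the one induced from the
completion, and the formal one (`form`), where degree at most `d` means a combination of words in
the `b_{ij}^{(r)}` of total degree at most `d`. Formal degree bounds actual degree. The heart of the
proof is the converse, `form_inf_cfilt`: an element of `S` of degree at most `d` is a combination of
words of total degree at most `d`. The images of words of smaller total degree vanish in the
component of degree `d`, and the image of a word of total degree `d` is the product of the images of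
its letters, so generation follows (`graded_generation`).

The formal filtration is controlled by two relations. Unitarity, `B(u) B(-u) = 1`, expresses each
generator outside the two families as a quadratic expression of formal degree one less
(`genEl_mem_form_of_lead_eq_zero`). The reflection equation, which follows from the RTT relations by
changing the signs of the spectral parameters, shows that the supercommutator of generators of
degrees `d` and `e` is linear in the generators of degree `d + e`, up to formal degree `d + e - 1`
(`sComm_genEl_mem`). It replaces a swap of two letters, or the square of an odd letter, by shorter
words. Hence, modulo lower formal degree, the ordered words in the letters of the families, with odd
letters not repeated, span (`bWord_mem_ordered`).

The leading term of `b_{ij}^{(r)}` is a scalar multiple of `t_{ij}^{(r)}`, and the scalar can be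
nonzero only for letters of the families (`genEl_sub_lead_mem`, `mem_GammaIndex`,
`mem_GammaPlusIndex`). An ordered word in letters with nonzero leading scalar therefore has as
leading term a nonzero multiple of the same ordered monomial in the `t_{ij}^{(r)}`. Such monomials
of one degree are linearly independent modulo smaller degree (`ordered_independent`). So a
combination of ordered words of degree `e` whose actual degree drops is trivial, and the formal
degree can be lowered one step at a time (`mem_form_of_mem_cfilt`).

The independence is the hard half of a Poincaré-Birkhoff-Witt theorem. It is obtained from the
comultiplication followed by evaluation of the second factor in a twisted vector representation at a
point `T` (`evalComul`). Up to lower degree the generators are primitive: `t_{ij}^{(r)}` goes to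
itself plus `T^s E_{ij}` with `s` its degree. The power of `T` and the matrix position recognise the
generator, so each generator has a skew derivation (`skewDer`) which deletes it from monomials.
Iterating these derivations along a word and applying the counit gives a functional (`wordFun`)
which, among monomials of the same degree and at most the same length, sees only permutations of
that word. -/

theorem neg_one_pow_congr' {a b : ℕ} (h : Even a ↔ Even b) : (-1 : ℂ) ^ a = (-1) ^ b := by
  rcases Nat.even_or_odd a with ha | ha
  · rw [ha.neg_one_pow, (h.1 ha).neg_one_pow]
  · rw [ha.neg_one_pow, (Nat.not_even_iff_odd.1 (mt h.2 (Nat.not_even_iff_odd.2 ha))).neg_one_pow]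

/-- Square matrices indexed by pairs of indices, the index of the second tensor factor first. -/
abbrev Mat2 (m n : ℕ) (D : Type*) : Type _ :=
  Matrix (Fin (m + n) × Fin (m + n)) (Fin (m + n) × Fin (m + n)) D

/-- The action of the super permutation on the tensor square of the vector representation. -/
def permMat (m n : ℕ) (D : Type*) [Ring D] [Algebra ℂ D] : Mat2 m n D :=
  Matrix.of fun a b => if a = b.swap then ((-1 : ℂ) ^ (parity a.1 * parity a.2)) • 1 else 0

theorem permMat_mul_apply (X : Mat2 m n D) (a b : Fin (m + n) × Fin (m + n)) :
    (permMat m n D * X) a b = ((-1 : ℂ) ^ (parity a.1 * parity a.2)) • X a.swap b := by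
  rw [Matrix.mul_apply, Finset.sum_eq_single a.swap]
  · simp [permMat]
  · intro c _ hc
    rw [permMat, Matrix.of_apply, if_neg, zero_mul]
    rintro rfl
    simp at hc
  · simp

theorem mul_permMat_apply (X : Mat2 m n D) (a b : Fin (m + n) × Fin (m + n)) :
    (X * permMat m n D) a b = ((-1 : ℂ) ^ (parity b.1 * parity b.2)) • X a b.swap := by
  rw [Matrix.mul_apply, Finset.sum_eq_single b.swap]
  · simp [permMat, mul_comm]
  · intro c _ hc
    rw [permMat, Matrix.of_apply, if_neg hc, mul_zero]
  · simp

/-- The sign `(-1)^{a b}` is symmetric in the two indices, so it occurs squared. -/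
theorem permMat_sq : permMat m n D * permMat m n D = 1 := by
  ext a b
  rw [permMat_mul_apply, permMat, Matrix.of_apply, Matrix.one_apply]
  by_cases h : a = b
  · subst h
    rw [if_pos rfl, if_pos rfl, smul_smul, ← pow_add, Even.neg_one_pow, one_smul]
    simp [mul_comm]
  · rw [if_neg h, if_neg (fun h' => h (Prod.swap_injective h')), smul_zero]

/-- The embedding `X ↦ X₂` of matrices. -/
def emb2 (m n : ℕ) (D : Type*) [Ring D] :
    Matrix (Fin (m + n)) (Fin (m + n)) D →+* Mat2 m n D :=
  (Matrix.blockDiagonalRingHom (Fin (m + n)) (Fin (m + n)) D).comp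
    (Pi.constRingHom (Fin (m + n)) (Matrix (Fin (m + n)) (Fin (m + n)) D))

theorem emb2_apply (X : Matrix (Fin (m + n)) (Fin (m + n)) D) (a b : Fin (m + n) × Fin (m + n)) :
    emb2 m n D X a b = if a.2 = b.2 then X a.1 b.1 else 0 := rfl

/-- The embedding `X ↦ X₁ = P X₂ P` of matrices. -/
def emb1 (m n : ℕ) (D : Type*) [Ring D] [Algebra ℂ D] :
    Matrix (Fin (m + n)) (Fin (m + n)) D →+* Mat2 m n D where
  toFun X := permMat m n D * emb2 m n D X * permMat m n D
  map_one' := by rw [map_one, mul_one, permMat_sq]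
  map_zero' := by rw [map_zero, mul_zero, zero_mul]
  map_add' X Y := by rw [map_add, mul_add, add_mul]
  map_mul' X Y := by
    rw [map_mul]
    have h := permMat_sq (m := m) (n := n) (D := D)
    calc _ = permMat m n D * emb2 m n D X * 1 * emb2 m n D Y * permMat m n D := by noncomm_ring
      _ = _ := by rw [← h]; noncomm_ring

theorem emb1_eq (X : Matrix (Fin (m + n)) (Fin (m + n)) D) :
    emb1 m n D X = permMat m n D * emb2 m n D X * permMat m n D := rfl

theorem permMat_mul_emb1 (X : Matrix (Fin (m + n)) (Fin (m + n)) D) :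
    permMat m n D * emb1 m n D X = emb2 m n D X * permMat m n D := by
  rw [emb1_eq, ← mul_assoc, ← mul_assoc, permMat_sq, one_mul]

theorem permMat_mul_emb2 (X : Matrix (Fin (m + n)) (Fin (m + n)) D) :
    permMat m n D * emb2 m n D X = emb1 m n D X * permMat m n D := by
  rw [emb1_eq, mul_assoc, permMat_sq, mul_one]

theorem emb1_apply (X : Matrix (Fin (m + n)) (Fin (m + n)) D) (a b : Fin (m + n) × Fin (m + n)) :
    emb1 m n D X a b = if a.1 = b.1 then
      ((-1 : ℂ) ^ (parity a.1 * (parity a.2 + parity b.2))) • X a.2 b.2 else 0 := by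
  rw [emb1_eq, mul_permMat_apply, permMat_mul_apply, emb2_apply]
  simp only [Prod.fst_swap, Prod.snd_swap]
  split_ifs with h
  · rw [smul_smul, ← pow_add, h]
    congr 2
    ring
  · simp

theorem emb1_mul_emb2_apply (X Y : Matrix (Fin (m + n)) (Fin (m + n)) D) (i j k l : Fin (m + n)) :
    (emb1 m n D X * emb2 m n D Y) (k, i) (l, j) =
      ((-1 : ℂ) ^ (parity k * (parity i + parity j))) • (X i j * Y k l) := by
  rw [Matrix.mul_apply, Finset.sum_eq_single (k, j)]
  · rw [emb1_apply, emb2_apply, if_pos rfl, if_pos rfl, smul_mul_assoc]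
  · rintro ⟨c, d⟩ _ hc
    rw [emb1_apply, emb2_apply]
    split_ifs with h1 h2
    · exact (hc (Prod.ext h1.symm h2)).elim
    all_goals simp
  · simp

theorem emb2_mul_emb1_apply (X Y : Matrix (Fin (m + n)) (Fin (m + n)) D) (i j k l : Fin (m + n)) :
    (emb2 m n D Y * emb1 m n D X) (k, i) (l, j) =
      ((-1 : ℂ) ^ (parity l * (parity i + parity j))) • (Y k l * X i j) := by
  rw [Matrix.mul_apply, Finset.sum_eq_single (l, i)]
  · rw [emb1_apply, emb2_apply, if_pos rfl, if_pos rfl, mul_smul_comm]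
  · rintro ⟨c, d⟩ _ hc
    rw [emb1_apply, emb2_apply]
    split_ifs with h1 h2
    · exact (hc (Prod.ext h2 h1.symm)).elim
    all_goals simp
  · simp

/-- The supercommutator of elements of parities `i + j` and `k + l`. -/
def sComm (i j k l : Fin (m + n)) (x y : D) : D :=
  x * y - ((-1 : ℂ) ^ ((parity i + parity j) * (parity k + parity l))) • (y * x)

/-- The signs of the entries of `X₁ Y₂` and `Y₂ X₁` differ by exactly `(-1)^{(i+j)(k+l)}`. An
ordinary commutator of matrices thus encodes the supercommutators of their entries, and the
arguments with matrices need no grading. -/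
theorem emb_comm_apply (X Y : Matrix (Fin (m + n)) (Fin (m + n)) D) (i j k l : Fin (m + n)) :
    (emb1 m n D X * emb2 m n D Y - emb2 m n D Y * emb1 m n D X) (k, i) (l, j) =
      ((-1 : ℂ) ^ (parity k * (parity i + parity j))) • sComm i j k l (X i j) (Y k l) := by
  rw [Matrix.sub_apply, emb1_mul_emb2_apply, emb2_mul_emb1_apply, sComm, smul_sub, smul_smul,
    ← pow_add]
  congr 2
  apply neg_one_pow_congr'
  simp only [Nat.even_add, Nat.even_mul]
  tauto

/-- The defining relation of the double Yangian for the coefficients of two families of series. -/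
def CoeffRTT (x y : Fin (m + n) → Fin (m + n) → ℤ → D) : Prop :=
  ∀ (i j k l : Fin (m + n)) (p q : ℤ),
    sComm i j k l (x i j (p - 1)) (y k l q) - sComm i j k l (x i j p) (y k l (q - 1)) =
    ((-1 : ℂ) ^ (parity i * parity j + parity i * parity k + parity j * parity k)) •
      (x k j p * y i l q - y k j q * x i l p)

theorem CoeffRTT.map {x y : Fin (m + n) → Fin (m + n) → ℤ → D} (h : CoeffRTT x y) (f : D →ₐ[ℂ] E) :
    CoeffRTT (fun i j p => f (x i j p)) (fun i j p => f (y i j p)) := by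
  intro i j k l p q
  have h' := congrArg f (h i j k l p q)
  simpa only [sComm, map_sub, map_mul, map_smul] using h'

/-- Here `A`, `B` stand for the coefficients of `X` at `u^{p-1}`, `u^p` and `F`, `C` for those of
`Y` at `v^{q-1}`, `v^q`. Each entry of the matrix relation is a sign times the defect of a scalar
relation, so the two forms of the relation are equivalent. -/
theorem coeff_relation_apply (A B C F : Matrix (Fin (m + n)) (Fin (m + n)) D)
    (i j k l : Fin (m + n)) :
    ((emb1 m n D A * emb2 m n D C - emb2 m n D C * emb1 m n D A) -
      (emb1 m n D B * emb2 m n D F - emb2 m n D F * emb1 m n D B) -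
      (permMat m n D * (emb1 m n D B * emb2 m n D C) -
        (emb2 m n D C * emb1 m n D B) * permMat m n D)) (k, i) (l, j) =
    ((-1 : ℂ) ^ (parity k * (parity i + parity j))) •
      (sComm i j k l (A i j) (C k l) - sComm i j k l (B i j) (F k l) -
        ((-1 : ℂ) ^ (parity i * parity j + parity i * parity k + parity j * parity k)) •
        (B k j * C i l - C k j * B i l)) := by
  have e1 : (-1 : ℂ) ^ (parity k * parity i + parity i * (parity k + parity j)) =
      (-1) ^ (parity k * (parity i + parity j)) * (-1) ^
        (parity i * parity j + parity i * parity k + parity j * parity k) := by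
    rw [← pow_add]
    apply neg_one_pow_congr'
    by_cases hi : Even (parity i) <;> by_cases hj : Even (parity j) <;>
      by_cases hk : Even (parity k) <;> by_cases hl : Even (parity l) <;>
      simp only [Nat.even_add, Nat.even_mul, hi, hj, hk, hl] <;> decide
  have e2 : (-1 : ℂ) ^ (parity l * parity j + parity j * (parity i + parity l)) =
      (-1) ^ (parity k * (parity i + parity j)) * (-1) ^
        (parity i * parity j + parity i * parity k + parity j * parity k) := by
    rw [← pow_add]
    apply neg_one_pow_congr'
    by_cases hi : Even (parity i) <;> by_cases hj : Even (parity j) <;>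
      by_cases hk : Even (parity k) <;> by_cases hl : Even (parity l) <;>
      simp only [Nat.even_add, Nat.even_mul, hi, hj, hk, hl] <;> decide
  have h1 := emb_comm_apply A C i j k l
  have h2 := emb_comm_apply B F i j k l
  have h3 : (permMat m n D * (emb1 m n D B * emb2 m n D C)) (k, i) (l, j) = _ :=
    permMat_mul_apply _ _ _
  have h4 : ((emb2 m n D C * emb1 m n D B) * permMat m n D) (k, i) (l, j) = _ :=
    mul_permMat_apply _ _ _
  rw [Prod.swap_prod_mk, emb1_mul_emb2_apply, smul_smul, ← pow_add, e1, mul_smul] at h3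
  rw [Prod.swap_prod_mk, emb2_mul_emb1_apply, smul_smul, ← pow_add, e2, mul_smul] at h4
  rw [Matrix.sub_apply, Matrix.sub_apply _ _ (k, i) (l, j), h1, h2,
    Matrix.sub_apply _ _ (k, i) (l, j), h3, h4, ← smul_sub, ← smul_sub, ← smul_sub, ← smul_sub]

/-- Power series in two central variables over the matrices indexed by pairs. -/
abbrev Ser2 (m n : ℕ) (D : Type*) [Ring D] : Type _ := PowerSeries (PowerSeries (Mat2 m n D))

/-- The first variable. -/
def varX (m n : ℕ) (D : Type*) [Ring D] : Ser2 m n D := PowerSeries.X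

/-- The second variable. -/
def varY (m n : ℕ) (D : Type*) [Ring D] : Ser2 m n D := PowerSeries.C PowerSeries.X

/-- Constant series. -/
def cst (m n : ℕ) (D : Type*) [Ring D] : Mat2 m n D →+* Ser2 m n D :=
  PowerSeries.C.comp PowerSeries.C

/-- The series `X₁(x)`. -/
def ser1 (m n : ℕ) (D : Type*) [Ring D] [Algebra ℂ D] :
    PowerSeries (Matrix (Fin (m + n)) (Fin (m + n)) D) →+* Ser2 m n D :=
  PowerSeries.map (PowerSeries.C.comp (emb1 m n D))

/-- The series `X₂(y)`. -/
def ser2 (m n : ℕ) (D : Type*) [Ring D] :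
    PowerSeries (Matrix (Fin (m + n)) (Fin (m + n)) D) →+* Ser2 m n D :=
  PowerSeries.C.comp (PowerSeries.map (emb2 m n D))

/-- The coefficient of `x ^ a y ^ b`. -/
def coeff2 {M : Type*} [Ring M] (a b : ℕ) (z : PowerSeries (PowerSeries M)) : M :=
  PowerSeries.coeff b (PowerSeries.coeff a z)

theorem coeff2_ext {M : Type*} [Ring M] {z w : PowerSeries (PowerSeries M)}
    (h : ∀ a b, coeff2 a b z = coeff2 a b w) : z = w :=
  PowerSeries.ext fun a => PowerSeries.ext fun b => h a b

section coeff2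
variable (a b : ℕ) (z w : Ser2 m n D)

theorem coeff2_add : coeff2 a b (z + w) = coeff2 a b z + coeff2 a b w := by simp [coeff2]
theorem coeff2_sub : coeff2 a b (z - w) = coeff2 a b z - coeff2 a b w := by simp [coeff2]
theorem coeff2_neg : coeff2 a b (-z) = -coeff2 a b z := by simp [coeff2]
theorem coeff2_X_succ : coeff2 (a + 1) b (varX m n D * z) = coeff2 a b z := by
  rw [coeff2, varX, PowerSeries.coeff_succ_X_mul, coeff2]
theorem coeff2_X_zero : coeff2 0 b (varX m n D * z) = 0 := by
  rw [coeff2, varX, PowerSeries.coeff_zero_X_mul, map_zero]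
theorem coeff2_Y_succ : coeff2 a (b + 1) (varY m n D * z) = coeff2 a b z := by
  rw [coeff2, varY, PowerSeries.coeff_C_mul, PowerSeries.coeff_succ_X_mul, coeff2]
theorem coeff2_Y_zero : coeff2 a 0 (varY m n D * z) = 0 := by
  rw [coeff2, varY, PowerSeries.coeff_C_mul, PowerSeries.coeff_zero_X_mul]
theorem coeff2_cst_mul (P : Mat2 m n D) : coeff2 a b (cst m n D P * z) = P * coeff2 a b z := by
  rw [coeff2, cst, RingHom.comp_apply, PowerSeries.coeff_C_mul, PowerSeries.coeff_C_mul, coeff2]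
theorem coeff2_mul_cst (P : Mat2 m n D) : coeff2 a b (z * cst m n D P) = coeff2 a b z * P := by
  rw [coeff2, cst, RingHom.comp_apply, PowerSeries.coeff_mul_C, PowerSeries.coeff_mul_C, coeff2]

end coeff2

theorem varX_comm (z : Ser2 m n D) : Commute (varX m n D) z := (PowerSeries.commute_X z).symm
theorem varY_comm (z : Ser2 m n D) : Commute (varY m n D) z := by
  refine PowerSeries.ext fun a => ?_
  rw [varY, PowerSeries.coeff_C_mul, PowerSeries.coeff_mul_C]
  exact (PowerSeries.commute_X _).symm

variable (X Y : PowerSeries (Matrix (Fin (m + n)) (Fin (m + n)) D))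

theorem coeff2_ser12 (a b : ℕ) : coeff2 a b (ser1 m n D X * ser2 m n D Y) =
    emb1 m n D (PowerSeries.coeff a X) * emb2 m n D (PowerSeries.coeff b Y) := by
  rw [coeff2, ser2, RingHom.comp_apply, PowerSeries.coeff_mul_C, ser1, PowerSeries.coeff_map,
    RingHom.comp_apply, PowerSeries.coeff_C_mul, PowerSeries.coeff_map]

theorem coeff2_ser21 (a b : ℕ) : coeff2 a b (ser2 m n D Y * ser1 m n D X) =
    emb2 m n D (PowerSeries.coeff b Y) * emb1 m n D (PowerSeries.coeff a X) := by
  rw [coeff2, ser2, RingHom.comp_apply, PowerSeries.coeff_C_mul, ser1, PowerSeries.coeff_map,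
    RingHom.comp_apply, PowerSeries.coeff_mul_C, PowerSeries.coeff_map]

/-- The relation `(p - q P) X₁(x) Y₂(y) = Y₂(y) X₁(x) (p - q P)`. -/
def RTT (p q : Ser2 m n D) (X Y : PowerSeries (Matrix (Fin (m + n)) (Fin (m + n)) D)) : Prop :=
  (p - q * cst m n D (permMat m n D)) * (ser1 m n D X * ser2 m n D Y) =
    (ser2 m n D Y * ser1 m n D X) * (p - q * cst m n D (permMat m n D))

/-- The coefficient of `u ^ p` of a series in `u⁻¹`. -/
def lowCoeff (X : PowerSeries (Matrix (Fin (m + n)) (Fin (m + n)) D)) (i j : Fin (m + n)) (p : ℤ) : D :=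
  if p ≤ 0 then PowerSeries.coeff (-p).toNat X i j else 0

/-- The coefficient of `u ^ p` of a series in `u`. -/
def highCoeff (X : PowerSeries (Matrix (Fin (m + n)) (Fin (m + n)) D)) (i j : Fin (m + n)) (p : ℤ) : D :=
  if 0 ≤ p then PowerSeries.coeff p.toNat X i j else 0

/-- The coefficient of `u ^ p` of a series in `u⁻¹`, as a matrix. -/
def lowMat (p : ℤ) : Matrix (Fin (m + n)) (Fin (m + n)) D :=
  if p ≤ 0 then PowerSeries.coeff (-p).toNat X else 0

/-- The coefficient of `u ^ p` of a series in `u`, as a matrix. -/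
def highMat (p : ℤ) : Matrix (Fin (m + n)) (Fin (m + n)) D :=
  if 0 ≤ p then PowerSeries.coeff p.toNat X else 0

theorem of_lowCoeff (p : ℤ) : Matrix.of (fun i j => lowCoeff X i j p) = lowMat X p := by
  ext i j
  rw [Matrix.of_apply, lowCoeff, lowMat]
  split_ifs <;> rfl

theorem of_highCoeff (p : ℤ) : Matrix.of (fun i j => highCoeff X i j p) = highMat X p := by
  ext i j
  rw [Matrix.of_apply, highCoeff, highMat]
  split_ifs <;> rfl

theorem lowMat_neg (a : ℕ) : lowMat X (-(a : ℤ)) = PowerSeries.coeff a X := by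
  rw [lowMat, if_pos (by lia), neg_neg, Int.toNat_natCast]

theorem lowMat_of_pos {p : ℤ} (hp : 0 < p) : lowMat X p = 0 := by
  rw [lowMat, if_neg (by lia)]

theorem highMat_natCast (a : ℕ) : highMat X (a : ℤ) = PowerSeries.coeff a X := by
  rw [highMat, if_pos (by lia), Int.toNat_natCast]

theorem highMat_of_neg {p : ℤ} (hp : p < 0) : highMat X p = 0 := by
  rw [highMat, if_neg (by lia)]

/-- A form of the relation which is convenient for taking coefficients. -/
theorem rtt_iff {p q : Ser2 m n D} (hp : ∀ z, Commute p z) (hq : ∀ z, Commute q z) :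
    RTT p q X Y ↔ p * (ser1 m n D X * ser2 m n D Y - ser2 m n D Y * ser1 m n D X) =
      q * (cst m n D (permMat m n D) * (ser1 m n D X * ser2 m n D Y) -
        (ser2 m n D Y * ser1 m n D X) * cst m n D (permMat m n D)) := by
  rw [RTT, sub_mul, mul_sub, mul_sub, mul_sub, sub_eq_sub_iff_sub_eq_sub]
  rw [← (hp _).eq, ← mul_assoc _ q, ← (hq (ser2 m n D Y * _)).eq, mul_assoc q, mul_assoc q]

/-- The difference of the two sides of the relation at `u ^ p v ^ q`. -/
def rttDefect (F G : ℤ → Matrix (Fin (m + n)) (Fin (m + n)) D) (p q : ℤ) : Mat2 m n D :=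
  (emb1 m n D (F (p - 1)) * emb2 m n D (G q) - emb2 m n D (G q) * emb1 m n D (F (p - 1))) -
  (emb1 m n D (F p) * emb2 m n D (G (q - 1)) - emb2 m n D (G (q - 1)) * emb1 m n D (F p)) -
  (permMat m n D * (emb1 m n D (F p) * emb2 m n D (G q)) -
    (emb2 m n D (G q) * emb1 m n D (F p)) * permMat m n D)

theorem coeffRTT_iff_defect {x y : Fin (m + n) → Fin (m + n) → ℤ → D} :
    CoeffRTT x y ↔ ∀ p q : ℤ,
      rttDefect (fun p => .of fun i j => x i j p) (fun q => .of fun i j => y i j q) p q = 0 := by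
  constructor
  · intro h p q
    ext ⟨k, i⟩ ⟨l, j⟩
    rw [rttDefect, coeff_relation_apply]
    simp only [Matrix.of_apply]
    rw [h i j k l p q, sub_self, smul_zero, Matrix.zero_apply]
  · intro h i j k l p q
    have h' := congrFun (congrFun (h p q) (k, i)) (l, j)
    rw [rttDefect, coeff_relation_apply] at h'
    simp only [Matrix.of_apply, Matrix.zero_apply] at h'
    exact sub_eq_zero.1
      ((IsUnit.smul_eq_zero (IsUnit.mk0 _ (pow_ne_zero _ (by norm_num)))).1 h')

theorem rttDefect_eq_zero_left {F G : ℤ → Matrix (Fin (m + n)) (Fin (m + n)) D} {p q : ℤ}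
    (h : F (p - 1) = 0) (h' : F p = 0) : rttDefect F G p q = 0 := by
  simp [rttDefect, h, h']

theorem rttDefect_eq_zero_right {F G : ℤ → Matrix (Fin (m + n)) (Fin (m + n)) D} {p q : ℤ}
    (h : G (q - 1) = 0) (h' : G q = 0) : rttDefect F G p q = 0 := by
  simp [rttDefect, h, h']

/-- The difference of the two sides of the relation as a series. -/
def rttDefectSer (p q : Ser2 m n D) : Ser2 m n D :=
  p * (ser1 m n D X * ser2 m n D Y - ser2 m n D Y * ser1 m n D X) -
      q * (cst m n D (permMat m n D) * (ser1 m n D X * ser2 m n D Y) -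
        (ser2 m n D Y * ser1 m n D X) * cst m n D (permMat m n D))

/-- Put `u = x⁻¹`, `v = y⁻¹` and multiply `(u - v) - P` by `x y`. This factor is why `x^a y^b`
corresponds to `u^{1-a} v^{1-b}`. -/
theorem rtt_low_low : CoeffRTT (lowCoeff X) (lowCoeff Y) ↔
    RTT (varY m n D - varX m n D) (varX m n D * varY m n D) X Y := by
  rw [coeffRTT_iff_defect, rtt_iff _ _ (fun z => (varY_comm z).sub_left (varX_comm z))
    (fun z => (varX_comm z).mul_left (varY_comm z)), ← sub_eq_zero]
  simp only [of_lowCoeff]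
  have key : ∀ a b : ℕ,
      coeff2 a b (rttDefectSer X Y (varY m n D - varX m n D) (varX m n D * varY m n D)) =
      rttDefect (lowMat X) (lowMat Y) (1 - a) (1 - b) := by
    intro a b
    rw [rttDefectSer, sub_mul, mul_assoc, rttDefect]
    rcases a with _ | a <;> rcases b with _ | b <;>
    simp only [coeff2_X_zero, coeff2_X_succ, coeff2_Y_zero, coeff2_Y_succ, coeff2_sub,
      coeff2_cst_mul, coeff2_mul_cst, coeff2_ser12, coeff2_ser21, ← lowMat_neg]
    · simp [lowMat_of_pos]
    · simp [lowMat_of_pos]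
    · simp [lowMat_of_pos]
    · rw [show 1 - ((a + 1 : ℕ) : ℤ) - 1 = -((a + 1 : ℕ) : ℤ) by push_cast; ring,
        show 1 - ((a + 1 : ℕ) : ℤ) = -(a : ℤ) by push_cast; ring,
        show 1 - ((b + 1 : ℕ) : ℤ) - 1 = -((b + 1 : ℕ) : ℤ) by push_cast; ring,
        show 1 - ((b + 1 : ℕ) : ℤ) = -(b : ℤ) by push_cast; ring]
  refine ⟨fun h => coeff2_ext fun a b => (key a b).trans (h _ _), fun h p q => ?_⟩
  -- The relation also has coefficients at `p = 1`, through the shift by `u`. For `p > 1` both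
  -- coefficients of `X` that occur are zero.
  rcases lt_or_ge 1 p with hp | hp
  · exact rttDefect_eq_zero_left (lowMat_of_pos _ (by lia)) (lowMat_of_pos _ (by lia))
  rcases lt_or_ge 1 q with hq | hq
  · exact rttDefect_eq_zero_right (lowMat_of_pos _ (by lia)) (lowMat_of_pos _ (by lia))
  have := key (1 - p).toNat (1 - q).toNat
  rw [rttDefectSer, h, show (1 : ℤ) - ((1 - p).toNat : ℤ) = p by lia,
    show (1 : ℤ) - ((1 - q).toNat : ℤ) = q by lia] at this
  exact this.symm

theorem rtt_high_high : CoeffRTT (highCoeff X) (highCoeff Y) ↔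
    RTT (varX m n D - varY m n D) 1 X Y := by
  rw [coeffRTT_iff_defect, rtt_iff _ _ (fun z => (varX_comm z).sub_left (varY_comm z))
    (fun z => Commute.one_left z), ← sub_eq_zero]
  simp only [of_highCoeff]
  have key : ∀ a b : ℕ,
      coeff2 a b (rttDefectSer X Y (varX m n D - varY m n D) 1) =
      rttDefect (highMat X) (highMat Y) a b := by
    intro a b
    rw [rttDefectSer, sub_mul, one_mul, rttDefect]
    rcases a with _ | a <;> rcases b with _ | b <;>
    simp only [coeff2_X_zero, coeff2_X_succ, coeff2_Y_zero, coeff2_Y_succ, coeff2_sub,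
      coeff2_cst_mul, coeff2_mul_cst, coeff2_ser12, coeff2_ser21, ← highMat_natCast] <;>
    simp [highMat_of_neg]
  refine ⟨fun h => coeff2_ext fun a b => (key a b).trans (h _ _), fun h p q => ?_⟩
  rcases lt_or_ge p 0 with hp | hp
  · exact rttDefect_eq_zero_left (highMat_of_neg _ (by lia)) (highMat_of_neg _ (by lia))
  rcases lt_or_ge q 0 with hq | hq
  · exact rttDefect_eq_zero_right (highMat_of_neg _ (by lia)) (highMat_of_neg _ (by lia))
  have := key p.toNat q.toNat
  rw [rttDefectSer, h, Int.toNat_of_nonneg hp, Int.toNat_of_nonneg hq] at this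
  exact this.symm

/-- Put `u = x⁻¹`, `v = y` and multiply `(u - v) - P` by `x`. -/
theorem rtt_low_high : CoeffRTT (lowCoeff X) (highCoeff Y) ↔
    RTT (1 - varX m n D * varY m n D) (varX m n D) X Y := by
  rw [coeffRTT_iff_defect, rtt_iff _ _
    (fun z => (Commute.one_left z).sub_left ((varX_comm z).mul_left (varY_comm z)))
    (fun z => varX_comm z), ← sub_eq_zero]
  simp only [of_lowCoeff, of_highCoeff]
  have key : ∀ a b : ℕ,
      coeff2 a b (rttDefectSer X Y (1 - varX m n D * varY m n D) (varX m n D)) =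
      rttDefect (lowMat X) (highMat Y) (1 - a) b := by
    intro a b
    rw [rttDefectSer, sub_mul, one_mul, mul_assoc, rttDefect]
    rcases a with _ | a <;> rcases b with _ | b <;>
    simp only [coeff2_X_zero, coeff2_X_succ, coeff2_Y_zero, coeff2_Y_succ, coeff2_sub,
      coeff2_cst_mul, coeff2_mul_cst, coeff2_ser12, coeff2_ser21, ← lowMat_neg X,
      ← highMat_natCast Y]
    · simp [lowMat_of_pos, highMat_of_neg]
    · simp [lowMat_of_pos]
    all_goals
      rw [show 1 - ((a + 1 : ℕ) : ℤ) - 1 = -((a + 1 : ℕ) : ℤ) by push_cast; ring,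
        show 1 - ((a + 1 : ℕ) : ℤ) = -(a : ℤ) by push_cast; ring]
      simp [highMat_of_neg]
  refine ⟨fun h => coeff2_ext fun a b => (key a b).trans (h _ _), fun h p q => ?_⟩
  rcases lt_or_ge 1 p with hp | hp
  · exact rttDefect_eq_zero_left (lowMat_of_pos _ (by lia)) (lowMat_of_pos _ (by lia))
  rcases lt_or_ge q 0 with hq | hq
  · exact rttDefect_eq_zero_right (highMat_of_neg _ (by lia)) (highMat_of_neg _ (by lia))
  have := key (1 - p).toNat q.toNat
  rw [rttDefectSer, h, show (1 : ℤ) - ((1 - p).toNat : ℤ) = p by lia,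
    Int.toNat_of_nonneg hq] at this
  exact this.symm

theorem sComm_swap (i j k l : Fin (m + n)) (x y : D) :
    sComm i j k l x y =
      -((-1 : ℂ) ^ ((parity i + parity j) * (parity k + parity l)) • sComm k l i j y x) := by
  rw [sComm, sComm, smul_sub, smul_smul, ← pow_add, mul_comm (parity k + parity l),
    Even.neg_one_pow ⟨_, rfl⟩, one_smul, neg_sub]

theorem coeff_mul_mem {F : ℤ → Submodule ℂ (D)} [SetLike.GradedMonoid F] {w c c' : ℤ}
    {f g : PowerSeries (Matrix (Fin (m + n)) (Fin (m + n)) D)}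
    (hf : ∀ (a : ℕ) i j, PowerSeries.coeff a f i j ∈ F (w * a + c))
    (hg : ∀ (a : ℕ) i j, PowerSeries.coeff a g i j ∈ F (w * a + c')) (a : ℕ) (i j : Fin (m + n)) :
    PowerSeries.coeff a (f * g) i j ∈ F (w * a + (c + c')) := by
  rw [PowerSeries.coeff_mul, Matrix.sum_apply]
  refine sum_mem fun x hx => ?_
  rw [Matrix.mul_apply]
  refine sum_mem fun k _ => ?_
  have h := SetLike.mul_mem_graded (A := F) (hf x.1 i k) (hg x.2 k j)
  rw [← Finset.HasAntidiagonal.mem_antidiagonal.1 hx]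
  convert h using 2
  push_cast
  ring

end RTT


/-! ### Universal property of the double Yangian -/

section Lift

set_option linter.unusedSectionVars false

variable {m n : ℕ} {D E : Type*} [Ring D] [Algebra ℂ D] [Ring E] [Algebra ℂ E]

/-- The matrix `T(u)` over the double Yangian, as a series in `u⁻¹`. -/
def tSer (m n : ℕ) : PowerSeries (Matrix (Fin (m + n)) (Fin (m + n)) (DY0 m n)) :=
  PowerSeries.mk fun r => Matrix.of fun i j => DY0.t i j (r : ℤ)

/-- The matrix `T⁺(u)` over the double Yangian, as a series in `u`. -/
def tPlusSer (m n : ℕ) : PowerSeries (Matrix (Fin (m + n)) (Fin (m + n)) (DY0 m n)) :=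
  PowerSeries.mk fun s => Matrix.of fun i j =>
    (if s = 0 then DY0.t i j 0 else 0) - DY0.t i j (-((s : ℤ) + 1))

/-- The series obtained by applying a homomorphism to all entries of all coefficients. -/
def mapSer (f : D →ₐ[ℂ] E) : PowerSeries (Matrix (Fin (m + n)) (Fin (m + n)) D) →+*
    PowerSeries (Matrix (Fin (m + n)) (Fin (m + n)) E) :=
  PowerSeries.map f.toRingHom.mapMatrix

theorem coeff_mapSer (f : D →ₐ[ℂ] E) (X : PowerSeries (Matrix (Fin (m + n)) (Fin (m + n)) D))
    (a : ℕ) (i j : Fin (m + n)) :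
    PowerSeries.coeff a (mapSer f X) i j = f (PowerSeries.coeff a X i j) := by
  rw [mapSer, PowerSeries.coeff_map]
  rfl

theorem lowCoeff_mapSer (f : D →ₐ[ℂ] E) (X : PowerSeries (Matrix (Fin (m + n)) (Fin (m + n)) D)) :
    lowCoeff (mapSer f X) = fun i j p => f (lowCoeff X i j p) := by
  funext i j p
  simp only [lowCoeff, coeff_mapSer]
  split_ifs <;> simp

theorem highCoeff_mapSer (f : D →ₐ[ℂ] E) (X : PowerSeries (Matrix (Fin (m + n)) (Fin (m + n)) D)) :
    highCoeff (mapSer f X) = fun i j p => f (highCoeff X i j p) := by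
  funext i j p
  simp only [highCoeff, coeff_mapSer]
  split_ifs <;> simp

/-- The three defining relations for a pair of series `T(u)`, `T⁺(u)` over an algebra. -/
structure IsRTTPair (X Xp : PowerSeries (Matrix (Fin (m + n)) (Fin (m + n)) D)) : Prop where
  low : CoeffRTT (lowCoeff X) (lowCoeff X)
  high : CoeffRTT (highCoeff Xp) (highCoeff Xp)
  mixed : CoeffRTT (lowCoeff X) (highCoeff Xp)

theorem IsRTTPair.map {X Xp : PowerSeries (Matrix (Fin (m + n)) (Fin (m + n)) D)}
    (h : IsRTTPair X Xp) (f : D →ₐ[ℂ] E) : IsRTTPair (mapSer f X) (mapSer f Xp) where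
  low := by rw [lowCoeff_mapSer]; exact h.low.map f
  high := by rw [highCoeff_mapSer]; exact h.high.map f
  mixed := by rw [lowCoeff_mapSer, highCoeff_mapSer]; exact h.mixed.map f

theorem proj_freeCoeffT (i j : Fin (m + n)) (p : ℤ) :
    DY0.proj m n (freeCoeffT i j p) = lowCoeff (tSer m n) i j p := by
  rw [freeCoeffT, lowCoeff]
  split_ifs with h
  · rw [tSer, PowerSeries.coeff_mk, Matrix.of_apply, Int.toNat_of_nonneg (by lia), DY0.t]
  · rw [map_zero]

theorem proj_freeCoeffTPlus (i j : Fin (m + n)) (p : ℤ) :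
    DY0.proj m n (freeCoeffTPlus i j p) = highCoeff (tPlusSer m n) i j p := by
  rw [freeCoeffTPlus, highCoeff]
  split_ifs with h h'
  · subst h'
    simp [tPlusSer, DY0.t]
  · rw [tPlusSer, PowerSeries.coeff_mk, Matrix.of_apply, Int.toNat_of_nonneg h,
      if_neg (by lia), map_sub, map_zero, DY0.t]
  · rw [map_zero]

theorem isRTTPair_tSer (m n : ℕ) : IsRTTPair (tSer m n) (tPlusSer m n) := by
  have hl : lowCoeff (tSer m n) = fun i j p => DY0.proj m n (freeCoeffT i j p) := by
    funext i j p
    rw [proj_freeCoeffT]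
  have hh : highCoeff (tPlusSer m n) = fun i j p => DY0.proj m n (freeCoeffTPlus i j p) := by
    funext i j p
    rw [proj_freeCoeffTPlus]
  refine ⟨?_, ?_, ?_⟩
  · rw [hl]
    intro i j k l p q
    have h : DY0.proj m n _ = DY0.proj m n _ :=
      RingQuot.mkAlgHom_rel ℂ (Rel.rtt (m := m) (n := n) i j k l p q)
    simpa only [sComm, map_sub, map_mul, map_smul, rttLeft, rttRight, superComm] using h
  · rw [hh]
    intro i j k l p q
    have h : DY0.proj m n _ = DY0.proj m n _ :=
      RingQuot.mkAlgHom_rel ℂ (Rel.rttPlus (m := m) (n := n) i j k l p q)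
    simpa only [sComm, map_sub, map_mul, map_smul, rttLeft, rttRight, superComm] using h
  · rw [hl, hh]
    intro i j k l p q
    have h : DY0.proj m n _ = DY0.proj m n _ :=
      RingQuot.mkAlgHom_rel ℂ (Rel.rttMixed (m := m) (n := n) i j k l p q)
    simpa only [sComm, map_sub, map_mul, map_smul, rttLeft, rttRight, superComm] using h

/-- The homomorphism from the free algebra given by a pair of series. -/
def freeLift (X Xp : PowerSeries (Matrix (Fin (m + n)) (Fin (m + n)) D)) :
    FreeAlgebra ℂ (Gen m n) →ₐ[ℂ] D :=
  FreeAlgebra.lift ℂ fun g => if 0 < g.r then PowerSeries.coeff g.r.toNat X g.i g.j else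
    -- The constant term of `t⁺_{ij}(u)` is `δ_{ij} - t_{ij}^{(-1)}`. Hence the constant term of
    -- `Xp` is arbitrary, whereas that of `X` has to be `1`.
    (if g.r = -1 then (1 : Matrix (Fin (m + n)) (Fin (m + n)) D) g.i g.j else 0) -
      PowerSeries.coeff (-g.r - 1).toNat Xp g.i g.j

variable {X Xp : PowerSeries (Matrix (Fin (m + n)) (Fin (m + n)) D)}

theorem freeLift_freeT_zero (i j : Fin (m + n)) :
    freeLift X Xp (freeT i j 0) = (1 : Matrix (Fin (m + n)) (Fin (m + n)) D) i j := by
  rw [freeT, dif_neg (by simp), Matrix.one_apply]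
  split_ifs <;> simp

theorem freeLift_freeT_pos (i j : Fin (m + n)) {r : ℤ} (hr : 0 < r) :
    freeLift X Xp (freeT i j r) = PowerSeries.coeff r.toNat X i j := by
  rw [freeT, dif_pos hr.ne', freeLift, FreeAlgebra.lift_ι_apply, if_pos hr]

theorem freeLift_freeT_neg (i j : Fin (m + n)) {r : ℤ} (hr : r < 0) :
    freeLift X Xp (freeT i j r) =
      (if r = -1 then (1 : Matrix (Fin (m + n)) (Fin (m + n)) D) i j else 0) -
      PowerSeries.coeff (-r - 1).toNat Xp i j := by
  rw [freeT, dif_pos hr.ne, freeLift, FreeAlgebra.lift_ι_apply, if_neg (not_lt.2 hr.le)]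

theorem freeLift_freeCoeffT (h0 : PowerSeries.coeff 0 X = 1) (i j : Fin (m + n)) (p : ℤ) :
    freeLift X Xp (freeCoeffT i j p) = lowCoeff X i j p := by
  rw [freeCoeffT, lowCoeff]
  split_ifs with h
  · rcases h.eq_or_lt with rfl | h
    · rw [neg_zero, freeLift_freeT_zero, Int.toNat_zero, h0]
    · rw [freeLift_freeT_pos _ _ (by lia)]
  · rw [map_zero]

theorem freeLift_freeCoeffTPlus (i j : Fin (m + n)) (p : ℤ) :
    freeLift X Xp (freeCoeffTPlus i j p) = highCoeff Xp i j p := by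
  rw [freeCoeffTPlus, highCoeff]
  split_ifs with h h'
  · subst h'
    rw [map_sub, freeLift_freeT_zero, freeLift_freeT_neg _ _ (by lia), if_pos (by lia)]
    simp
  · rw [map_sub, map_zero, freeLift_freeT_neg _ _ (by lia), if_neg (by lia),
      show -(-(p + 1)) - 1 = p by ring]
    simp
  · rw [map_zero]

/-- The homomorphism from the double Yangian given by a pair of series which satisfies the
defining relations. -/
def DY0.lift (h : IsRTTPair X Xp) (h0 : PowerSeries.coeff 0 X = 1) : DY0 m n →ₐ[ℂ] D :=
  RingQuot.liftAlgHom ℂ ⟨freeLift X Xp, by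
    have e1 : ∀ i j p, freeLift X Xp (freeCoeffT i j p) = lowCoeff X i j p :=
      freeLift_freeCoeffT h0
    have e2 : ∀ i j p, freeLift X Xp (freeCoeffTPlus i j p) = highCoeff Xp i j p :=
      freeLift_freeCoeffTPlus
    rintro _ _ (⟨i, j, k, l, p, q⟩ | ⟨i, j, k, l, p, q⟩ | ⟨i, j, k, l, p, q⟩)
    · simpa only [sComm, map_sub, map_mul, map_smul, rttLeft, rttRight, superComm, e1]
        using h.low i j k l p q
    · simpa only [sComm, map_sub, map_mul, map_smul, rttLeft, rttRight, superComm, e2]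
        using h.high i j k l p q
    · simpa only [sComm, map_sub, map_mul, map_smul, rttLeft, rttRight, superComm, e1, e2]
        using h.mixed i j k l p q⟩

theorem DY0.lift_t (h : IsRTTPair X Xp) (h0 : PowerSeries.coeff 0 X = 1) (i j : Fin (m + n))
    (r : ℤ) : DY0.lift h h0 (DY0.t i j r) = freeLift X Xp (freeT i j r) :=
  RingQuot.liftAlgHom_mkAlgHom_apply _ _ _ _

theorem mapSer_lift_tSer (h : IsRTTPair X Xp) (h0 : PowerSeries.coeff 0 X = 1) :
    mapSer (DY0.lift h h0) (tSer m n) = X := by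
  ext a i j
  rw [coeff_mapSer, tSer, PowerSeries.coeff_mk, Matrix.of_apply, DY0.lift_t]
  rcases Nat.eq_zero_or_pos a with rfl | ha
  · rw [Nat.cast_zero, freeLift_freeT_zero, h0]
  · rw [freeLift_freeT_pos _ _ (by lia), Int.toNat_natCast]

theorem mapSer_lift_tPlusSer (h : IsRTTPair X Xp) (h0 : PowerSeries.coeff 0 X = 1) :
    mapSer (DY0.lift h h0) (tPlusSer m n) = Xp := by
  ext a i j
  rw [coeff_mapSer, tPlusSer, PowerSeries.coeff_mk, Matrix.of_apply, map_sub, DY0.lift_t,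
    freeLift_freeT_neg _ _ (by lia), show (-(-((a : ℤ) + 1)) - 1).toNat = a by lia]
  rcases Nat.eq_zero_or_pos a with rfl | ha
  · rw [if_pos rfl, if_pos (by simp), DY0.lift_t, freeLift_freeT_zero]
    simp
  · rw [if_neg ha.ne', if_neg (by lia)]
    simp

theorem mapSer_toCDY_tSer : mapSer (toCDY m n) (tSer m n) = TSer m n := by
  ext a i j
  rw [coeff_mapSer, tSer, TSer, PowerSeries.coeff_mk, PowerSeries.coeff_mk]
  rfl

theorem mapSer_toCDY_tPlusSer : mapSer (toCDY m n) (tPlusSer m n) = TPlusSer m n := by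
  ext a i j
  rw [coeff_mapSer, tPlusSer, TPlusSer, PowerSeries.coeff_mk, PowerSeries.coeff_mk,
    Matrix.of_apply, Matrix.of_apply, map_sub]
  split_ifs <;> simp [tC]

/-- The relations for `T(u)` and `T⁺(u)` over the completed double Yangian. -/
theorem isRTTPair_TSer (m n : ℕ) : IsRTTPair (TSer m n) (TPlusSer m n) := by
  rw [← mapSer_toCDY_tSer, ← mapSer_toCDY_tPlusSer]
  exact (isRTTPair_tSer m n).map (toCDY m n)

end Lift


/-! ### The reflection equation and its commutator form -/

section Reflection

set_option linter.unusedSectionVars false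

variable {m n : ℕ} {D : Type*} [Ring D] [Algebra ℂ D]

/-- The reflection equation in an abstract form. -/
theorem reflection_of_exchange {R : Type*} [Ring R] {K K' A Ai B Bi G₁ G₂ : R}
    (e1 : K * (A * B) = B * A * K) (e2 : A * K' * Bi = Bi * K' * A)
    (e3 : Ai * K' * B = B * K' * Ai) (e4 : K * (Ai * Bi) = Bi * Ai * K)
    (g1 : G₁ * B = B * G₁) (g2 : Ai * G₂ = G₂ * Ai) (g3 : A * G₂ = G₂ * A)
    (g4 : G₁ * Bi = Bi * G₁) (eG : K * (G₁ * K' * G₂) = G₂ * K' * G₁ * K) :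
    K * (A * G₁ * Ai) * K' * (B * G₂ * Bi) = (B * G₂ * Bi) * K' * (A * G₁ * Ai) * K := by
  calc K * (A * G₁ * Ai) * K' * (B * G₂ * Bi)
      = K * A * G₁ * (Ai * K' * B) * G₂ * Bi := by simp only [mul_assoc]
    _ = K * A * (G₁ * B) * K' * (Ai * G₂) * Bi := by rw [e3]; simp only [mul_assoc]
    _ = (K * (A * B)) * G₁ * K' * G₂ * Ai * Bi := by rw [g1, g2]; simp only [mul_assoc]
    _ = B * A * (K * (G₁ * K' * G₂)) * Ai * Bi := by rw [e1]; simp only [mul_assoc]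
    _ = B * A * G₂ * K' * G₁ * (K * (Ai * Bi)) := by rw [eG]; simp only [mul_assoc]
    _ = B * (A * G₂) * K' * (G₁ * Bi) * Ai * K := by rw [e4]; simp only [mul_assoc]
    _ = B * G₂ * (A * K' * Bi) * G₁ * Ai * K := by rw [g3, g4]; simp only [mul_assoc]
    _ = (B * G₂ * Bi) * K' * (A * G₁ * Ai) * K := by rw [e2]; simp only [mul_assoc]

/-- Up to the central regular factor `K * Kb`, the element `Kb` is the inverse of `K`. Multiply the
relation by `K` on both sides and cancel that factor. -/
theorem exchange_of_mul_central {R : Type*} [Ring R] {K Kb Z W : R}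
    (h : Kb * Z = W * Kb) (hK : K * Kb = Kb * K) (hc : ∀ z, Commute (K * Kb) z)
    (hreg : ∀ z, K * Kb * z = 0 → z = 0) : Z * K = K * W := by
  refine sub_eq_zero.1 (hreg _ ?_)
  rw [mul_sub, sub_eq_zero]
  calc K * Kb * (Z * K) = K * (Kb * Z) * K := by simp only [mul_assoc]
    _ = K * W * (Kb * K) := by rw [h]; simp only [mul_assoc]
    _ = K * Kb * (K * W) := by rw [← hK, (hc (K * W)).eq]

/-- The reflection equation, with the parameters in a commutative ring. -/
theorem reflection_eq {S R : Type*} [CommRing S] [Ring R] [Algebra S R]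
    {p q p' q' : S} {P A A' Ai B B' Bi G₁ G₂ : R} (hP : P * P = 1)
    (h1 : (p • 1 - q • P) * (A * B) = B * A * (p • 1 - q • P))
    (h2 : (p' • 1 - q' • P) * (A * B') = B' * A * (p' • 1 - q' • P))
    (h3 : (p' • 1 + q' • P) * (A' * B) = B * A' * (p' • 1 + q' • P))
    (h4 : (p • 1 + q • P) * (A' * B') = B' * A' * (p • 1 + q • P))
    (hr : ∀ z : R, (p ^ 2 - q ^ 2) • z = 0 → z = 0)
    (hr' : ∀ z : R, (p' ^ 2 - q' ^ 2) • z = 0 → z = 0)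
    (hA : A' * Ai = 1) (hA' : Ai * A' = 1) (hB : B' * Bi = 1) (hB' : Bi * B' = 1)
    (hPG : P * G₁ = G₂ * P) (hPG' : P * G₂ = G₁ * P) (hGG : G₁ * G₂ = G₂ * G₁)
    (hG₁ : G₁ * G₁ = 1) (hG₂ : G₂ * G₂ = 1)
    (g1 : G₁ * B = B * G₁) (g2 : A' * G₂ = G₂ * A') (g3 : A * G₂ = G₂ * A)
    (g4 : G₁ * B' = B' * G₁) :
    (p • 1 - q • P) * (A * G₁ * Ai) * (p' • 1 - q' • P) * (B * G₂ * Bi) =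
      (B * G₂ * Bi) * (p' • 1 - q' • P) * (A * G₁ * Ai) * (p • 1 - q • P) := by
  have hKK : ∀ a c : S, (a • (1 : R) - c • P) * (a • 1 + c • P) = (a ^ 2 - c ^ 2) • (1 : R) := by
    intro a c
    simp only [sub_mul, mul_add, smul_mul_assoc, mul_smul_comm, one_mul, mul_one, hP]
    module
  have hKK' : ∀ a c : S, (a • (1 : R) + c • P) * (a • 1 - c • P) = (a ^ 2 - c ^ 2) • (1 : R) := by
    intro a c
    simp only [add_mul, mul_sub, smul_mul_assoc, mul_smul_comm, one_mul, mul_one, hP]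
    module
  have hcen : ∀ a c : S, ∀ z : R, Commute ((a • (1 : R) - c • P) * (a • 1 + c • P)) z := by
    intro a c z
    rw [hKK, Commute, SemiconjBy, smul_mul_assoc, mul_smul_comm, one_mul, mul_one]
  -- In `h3` and `h4` the sign of `u` is reversed, which turns `p - q P` into `p + q P`. Since the
  -- product of these two is the central element `p² - q²`, the relations can be rewritten with `p -
  -- q P` on the other side.
  have e3 := exchange_of_mul_central h3 ((hKK p' q').trans (hKK' p' q').symm) (hcen p' q')
    (fun z hz => hr' z (by rwa [hKK, smul_mul_assoc, one_mul] at hz))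
  have e4 := exchange_of_mul_central h4 ((hKK p q).trans (hKK' p q).symm) (hcen p q)
    (fun z hz => hr z (by rwa [hKK, smul_mul_assoc, one_mul] at hz))
  generalize hK : p • (1 : R) - q • P = K at *
  generalize hK' : p' • (1 : R) - q' • P = K' at *
  refine reflection_of_exchange h1 ?_ ?_ ?_ g1 ?_ g3 ?_ ?_
  · calc A * K' * Bi = (Bi * B') * (A * K' * Bi) := by rw [hB', one_mul]
      _ = Bi * (B' * A * K') * Bi := by simp only [mul_assoc]
      _ = Bi * K' * A * (B' * Bi) := by rw [← h2]; simp only [mul_assoc]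
      _ = Bi * K' * A := by rw [hB, mul_one]
  · calc Ai * K' * B = Ai * K' * B * (A' * Ai) := by rw [hA, mul_one]
      _ = Ai * (K' * (B * A')) * Ai := by simp only [mul_assoc]
      _ = (Ai * A') * (B * K' * Ai) := by rw [← e3]; simp only [mul_assoc]
      _ = B * K' * Ai := by rw [hA', one_mul]
  · calc K * (Ai * Bi) = (Bi * (Ai * A') * B') * (K * (Ai * Bi)) := by
          rw [hA', mul_one, hB', one_mul]
      _ = Bi * Ai * (A' * B' * K) * Ai * Bi := by simp only [mul_assoc]
      _ = Bi * Ai * K * B' * (A' * Ai) * Bi := by rw [e4]; simp only [mul_assoc]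
      _ = Bi * Ai * K := by rw [hA, mul_one, mul_assoc _ B', hB, mul_one]
  · calc Ai * G₂ = Ai * (G₂ * A') * Ai := by rw [mul_assoc, mul_assoc, hA, mul_one]
      _ = (Ai * A') * G₂ * Ai := by rw [← g2]; simp only [mul_assoc]
      _ = G₂ * Ai := by rw [hA', one_mul]
  · calc G₁ * Bi = (Bi * B') * G₁ * Bi := by rw [hB', one_mul]
      _ = Bi * (G₁ * B') * Bi := by rw [g4]; simp only [mul_assoc]
      _ = Bi * G₁ := by rw [mul_assoc, mul_assoc, hB, mul_one]
  -- `G₁ K' G₂` is a combination of `G₁ G₂` and `G₁ P G₂ = P`, both of which commute with `P`, hence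
  -- with `K`.
  · have hc : P * (G₁ * G₂) = G₁ * G₂ * P := by
      rw [← mul_assoc, hPG, mul_assoc, hPG', ← mul_assoc, hGG]
    have e5 : G₁ * P * G₂ = P := by rw [mul_assoc, hPG', ← mul_assoc, hG₁, one_mul]
    have e6 : G₂ * P * G₁ = P := by rw [mul_assoc, hPG, ← mul_assoc, hG₂, one_mul]
    rw [← hK', ← hK]
    simp only [mul_sub, sub_mul, mul_smul_comm, smul_mul_assoc, mul_one, one_mul, e5, e6, hc, hP,
      ← hGG]
    module

/-- The reflection equation as a formula for the commutator. -/
theorem comm_of_reflection {S R : Type*} [CommRing S] [Ring R] [Algebra S R]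
    {p q p' q' : S} {P β₁ β₂ G₁ G₂ : R} (hP : P * P = 1)
    (hPG : P * G₁ = G₂ * P) (hPG' : P * G₂ = G₁ * P) (hGG : G₁ * G₂ = G₂ * G₁)
    (hG₁ : G₁ * G₁ = 1) (hG₂ : G₂ * G₂ = 1) (hβ₁ : β₁ * G₂ = G₂ * β₁) (hβ₂ : β₂ * G₁ = G₁ * β₂)
    (h : (p • 1 - q • P) * (G₁ + β₁) * (p' • 1 - q' • P) * (G₂ + β₂) =
      (G₂ + β₂) * (p' • 1 - q' • P) * (G₁ + β₁) * (p • 1 - q • P)) :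
    p • p' • (β₁ * β₂ - β₂ * β₁) =
      p • q' • ((β₁ * P * G₂ + G₁ * P * β₂ - β₂ * P * G₁ - G₂ * P * β₁) +
        (β₁ * P * β₂ - β₂ * P * β₁)) +
      q • p' • ((P * β₁ * G₂ + P * G₁ * β₂ - β₂ * G₁ * P - G₂ * β₁ * P) +
        (P * β₁ * β₂ - β₂ * β₁ * P)) -
      q • q' • ((P * β₁ * P * G₂ + P * G₁ * P * β₂ - β₂ * P * G₁ * P - G₂ * P * β₁ * P) +
        (P * β₁ * P * β₂ - β₂ * P * β₁ * P)) := by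
  -- The terms without `β₁` and `β₂` agree on the two sides of the reflection equation, because the
  -- constant matrix `G` satisfies it. What remains is linear or quadratic in them.
  have e5 : G₁ * (P * G₂) = P := by rw [hPG', ← mul_assoc, hG₁, one_mul]
  have e6 : G₂ * (P * G₁) = P := by rw [hPG, ← mul_assoc, hG₂, one_mul]
  have e7 : P * (G₁ * G₂) = G₁ * (G₂ * P) := by
    rw [← mul_assoc, hPG, mul_assoc, hPG', ← mul_assoc, ← mul_assoc, hGG]
  simp only [mul_sub, sub_mul, mul_add, add_mul, mul_smul_comm, smul_mul_assoc, mul_one, one_mul,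
    mul_assoc, e5, e6, e7, hP, hβ₁, ← hGG, hβ₂] at h ⊢
  rw [← sub_eq_zero] at h ⊢
  rw [← h]
  module

/-- The substitution `x ↦ -x` as a ring homomorphism. -/
def negHom (R : Type*) [Ring R] : PowerSeries R →+* PowerSeries R where
  toFun := negVar
  map_one' := by
    ext k
    rw [negVar, PowerSeries.coeff_mk, PowerSeries.coeff_one]
    split_ifs with h <;> simp [h]
  map_zero' := by
    ext k
    simp [negVar]
  map_add' f g := by
    ext k
    simp [negVar, mul_add]
  map_mul' f g := by
    ext k
    rw [negVar, PowerSeries.coeff_mk, PowerSeries.coeff_mul, PowerSeries.coeff_mul,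
      Finset.mul_sum]
    refine Finset.sum_congr rfl fun x hx => ?_
    rw [negVar, negVar, PowerSeries.coeff_mk, PowerSeries.coeff_mk,
      ← Finset.HasAntidiagonal.mem_antidiagonal.1 hx, pow_add]
    have h : Commute ((-1 : R) ^ x.2) (PowerSeries.coeff x.1 f) :=
      (Commute.neg_one_left _).pow_left _
    rw [mul_assoc, mul_assoc, ← mul_assoc _ (PowerSeries.coeff x.1 f), h.eq]
    simp only [mul_assoc]

theorem negHom_apply {R : Type*} [Ring R] (f : PowerSeries R) : negHom R f = negVar f := rfl

theorem negHom_X {R : Type*} [Ring R] : negHom R PowerSeries.X = -PowerSeries.X := by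
  ext k
  rw [negHom_apply, negVar, PowerSeries.coeff_mk, map_neg, PowerSeries.coeff_X]
  split_ifs with h <;> simp [h]

theorem negHom_C {R : Type*} [Ring R] (r : R) : negHom R (PowerSeries.C r) = PowerSeries.C r := by
  ext k
  rw [negHom_apply, negVar, PowerSeries.coeff_mk, PowerSeries.coeff_C]
  split_ifs with h <;> simp [h]

theorem negVar_map {R R' : Type*} [Ring R] [Ring R'] (φ : R →+* R') (f : PowerSeries R) :
    negVar (PowerSeries.map φ f) = PowerSeries.map φ (negVar f) := by
  ext k
  simp [negVar]

/-- The substitution `x ↦ -x` in the first variable. -/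
def negX (m n : ℕ) (D : Type*) [Ring D] : Ser2 m n D →+* Ser2 m n D := negHom _

/-- The substitution `y ↦ -y` in the second variable. -/
def negY (m n : ℕ) (D : Type*) [Ring D] : Ser2 m n D →+* Ser2 m n D := PowerSeries.map (negHom _)

section neg

variable (X : PowerSeries (Matrix (Fin (m + n)) (Fin (m + n)) D))

theorem negX_varX : negX m n D (varX m n D) = -varX m n D := negHom_X
theorem negX_varY : negX m n D (varY m n D) = varY m n D := negHom_C _
theorem negX_cst (P : Mat2 m n D) : negX m n D (cst m n D P) = cst m n D P := negHom_C _
theorem negX_ser2 : negX m n D (ser2 m n D X) = ser2 m n D X := negHom_C _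
theorem negX_ser1 : negX m n D (ser1 m n D X) = ser1 m n D (negVar X) := negVar_map _ _
theorem negY_varX : negY m n D (varX m n D) = varX m n D := PowerSeries.map_X _
theorem negY_varY : negY m n D (varY m n D) = -varY m n D := by
  rw [negY, varY, PowerSeries.map_C, negHom_X, map_neg]
theorem negY_cst (P : Mat2 m n D) : negY m n D (cst m n D P) = cst m n D P := by
  rw [negY, cst, RingHom.comp_apply, PowerSeries.map_C, negHom_C]
theorem negY_ser2 : negY m n D (ser2 m n D X) = ser2 m n D (negVar X) := by
  rw [negY, ser2, RingHom.comp_apply, PowerSeries.map_C, negHom_apply, negVar_map,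
    RingHom.comp_apply]
theorem negY_ser1 : negY m n D (ser1 m n D X) = ser1 m n D X := by
  refine PowerSeries.ext fun a => ?_
  rw [negY, PowerSeries.coeff_map, ser1, PowerSeries.coeff_map, RingHom.comp_apply, negHom_C]

end neg

variable {p q : Ser2 m n D} {X Y : PowerSeries (Matrix (Fin (m + n)) (Fin (m + n)) D)}

theorem RTT.negX (h : RTT p q X Y) : RTT (negX m n D p) (negX m n D q) (negVar X) Y := by
  have h' := congrArg (DYang.negX m n D) h
  rw [RTT]
  simpa only [map_mul, map_sub, negX_cst, negX_ser1, negX_ser2] using h'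

theorem RTT.negY (h : RTT p q X Y) : RTT (negY m n D p) (negY m n D q) X (negVar Y) := by
  have h' := congrArg (DYang.negY m n D) h
  rw [RTT]
  simpa only [map_mul, map_sub, negY_cst, negY_ser1, negY_ser2] using h'

theorem RTT.neg (h : RTT p q X Y) : RTT (-p) (-q) X Y := by
  rw [RTT] at h ⊢
  have e : -p - -q * cst m n D (permMat m n D) = -(p - q * cst m n D (permMat m n D)) := by
    noncomm_ring
  rw [e, neg_mul, h, mul_neg]

/-- The relations which are obtained from an RTT relation by the changes of sign of the
variables, with parameters in the center. -/
structure IsReflectionDatum (p q p' q' : Subring.center (Ser2 m n D))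
    (X Y : PowerSeries (Matrix (Fin (m + n)) (Fin (m + n)) D)) : Prop where
  pos_pos : RTT p.1 q.1 X Y
  pos_neg : RTT p'.1 q'.1 X (negVar Y)
  neg_pos : RTT p'.1 (-q'.1) (negVar X) Y
  neg_neg : RTT p.1 (-q.1) (negVar X) (negVar Y)
  regular : ∀ z : Ser2 m n D, (p.1 ^ 2 - q.1 ^ 2) * z = 0 → z = 0
  regular' : ∀ z : Ser2 m n D, (p'.1 ^ 2 - q'.1 ^ 2) * z = 0 → z = 0

/-- Once the lower coefficients of `z` vanish, the next coefficient of `f z` is the constant term of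
`f` times the next coefficient of `z`. -/
theorem eq_zero_of_mul_eq_zero_of_constantCoeff {R : Type*} [Ring R] {f : PowerSeries R}
    (hf : ∀ z, PowerSeries.constantCoeff f * z = 0 → z = 0) (z : PowerSeries R) (h : f * z = 0) :
    z = 0 := by
  ext a
  induction a using Nat.strong_induction_on with
  | _ a ih =>
    have h' := congrArg (PowerSeries.coeff a) h
    rw [PowerSeries.coeff_mul, Finset.sum_eq_single (0, a)] at h'
    · exact hf _ (by simpa using h')
    · intro x hx hne
      have hx' := Finset.HasAntidiagonal.mem_antidiagonal.1 hx
      rw [ih x.2 (lt_of_le_of_ne (by lia) fun h2 => hne (Prod.ext (by simp; lia) h2)), map_zero,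
        mul_zero]
    · intro h2
      simp at h2

/-- The first variable as a central element. -/
def cX (m n : ℕ) (D : Type*) [Ring D] : Subring.center (Ser2 m n D) :=
  ⟨varX m n D, Subring.mem_center_iff.2 fun z => (PowerSeries.commute_X z).eq⟩

/-- The second variable as a central element. -/
def cY (m n : ℕ) (D : Type*) [Ring D] [Algebra ℂ D] : Subring.center (Ser2 m n D) :=
  ⟨varY m n D, Subring.mem_center_iff.2 fun z => (varY_comm z).eq.symm⟩

/-- All four relations come from one by `x ↦ -x` and `y ↦ -y`, after an overall sign where needed.
The parameters `p² - q²` are regular since their constant term in `x` is `y²`. -/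
theorem isReflectionDatum_low_low (h : CoeffRTT (lowCoeff X) (lowCoeff Y)) :
    IsReflectionDatum (cY m n D - cX m n D) (cX m n D * cY m n D)
      (cY m n D + cX m n D) (cX m n D * cY m n D) X Y := by
  have h1 := (rtt_low_low X Y).1 h
  have h2 : RTT (varY m n D + varX m n D) (varX m n D * varY m n D) X (negVar Y) := by
    have := h1.negY.neg
    simp only [map_sub, map_mul, negY_varX, negY_varY, neg_sub, sub_neg_eq_add, mul_neg,
      neg_neg] at this
    rwa [add_comm]
  have h3 := h1.negX
  have h4 := h2.negX
  simp only [map_sub, map_add, map_mul, negX_varX, negX_varY, sub_neg_eq_add, neg_mul] at h3 h4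
  have hreg : ∀ f : Ser2 m n D, PowerSeries.constantCoeff f = PowerSeries.X ^ 2 →
      ∀ z, f * z = 0 → z = 0 := by
    intro f hf
    refine eq_zero_of_mul_eq_zero_of_constantCoeff fun z hz => ?_
    rw [hf] at hz
    exact PowerSeries.X_pow_mul_cancel (hz.trans (mul_zero _).symm)
  refine ⟨h1, h2, h3, by rwa [← sub_eq_add_neg] at h4,
    hreg ((varY m n D - varX m n D) ^ 2 - (varX m n D * varY m n D) ^ 2) ?_,
    hreg ((varY m n D + varX m n D) ^ 2 - (varX m n D * varY m n D) ^ 2) ?_⟩ <;>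
  simp [varX, varY]

theorem isReflectionDatum_high_high (h : CoeffRTT (highCoeff X) (highCoeff Y)) :
    IsReflectionDatum (cX m n D - cY m n D) 1 (cX m n D + cY m n D) 1 X Y := by
  have h1 := (rtt_high_high X Y).1 h
  have h2 : RTT (varX m n D + varY m n D) 1 X (negVar Y) := by
    have := h1.negY
    rwa [map_sub, map_one, negY_varX, negY_varY, sub_neg_eq_add] at this
  have h3 := h1.negX.neg
  have h4 := h2.negX.neg
  simp only [map_sub, map_add, map_one, negX_varX, negX_varY, neg_sub, sub_neg_eq_add, neg_add,
    neg_neg] at h3 h4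
  refine ⟨h1, h2, by rwa [add_comm] at h3, by rwa [← sub_eq_add_neg] at h4, ?_, ?_⟩
  all_goals
    refine eq_zero_of_mul_eq_zero_of_constantCoeff fun z hz => ?_
    refine eq_zero_of_mul_eq_zero_of_constantCoeff (fun w hw => ?_) z hz
    simpa [cX, cY, varX, varY] using hw

/-- The same sign changes; now `p² - q²` has constant term `1` in `x`. -/
theorem isReflectionDatum_low_high (h : CoeffRTT (lowCoeff X) (highCoeff Y)) :
    IsReflectionDatum (1 - cX m n D * cY m n D) (cX m n D)
      (1 + cX m n D * cY m n D) (cX m n D) X Y := by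
  have h1 := (rtt_low_high X Y).1 h
  have h2 : RTT (1 + varX m n D * varY m n D) (varX m n D) X (negVar Y) := by
    have := h1.negY
    rwa [map_sub, map_one, map_mul, negY_varX, negY_varY, mul_neg, sub_neg_eq_add] at this
  have h3 := h1.negX
  have h4 := h2.negX
  simp only [map_sub, map_add, map_one, map_mul, negX_varX, negX_varY, neg_mul,
    sub_neg_eq_add] at h3 h4
  refine ⟨h1, h2, h3, by rwa [← sub_eq_add_neg] at h4, ?_, ?_⟩
  all_goals
    refine eq_zero_of_mul_eq_zero_of_constantCoeff fun z hz => ?_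
    simpa [cX, cY, varX, varY] using hz

end Reflection


/-! ### The reflection equation for the series that define the reflection algebras -/

section ReflectionSeries

set_option linter.unusedSectionVars false

variable {m n : ℕ}

/-- The inhomogeneous part of `X(u) G X(-u)⁻¹`. -/
def conjPart (ℓ : ℕ) (X : PowerSeries (Mat m n)) : PowerSeries (Mat m n) :=
  X * PowerSeries.C (GMat m n ℓ) * Ring.inverse (negVar X) - PowerSeries.C (GMat m n ℓ)

theorem GMat_sq (ℓ : ℕ) : GMat m n ℓ * GMat m n ℓ = 1 := by
  rw [GMat, Matrix.diagonal_mul_diagonal, ← Matrix.diagonal_one]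
  congr 1
  funext i
  split_ifs <;> simp

/-- `G` is diagonal, hence even, so the exponents `k (i + i)` and `l (i + i)` of the signs are even;
its entries are scalars. -/
theorem emb1_GMat_comm (ℓ : ℕ) (X : Mat m n) :
    emb1 m n _ (GMat m n ℓ) * emb2 m n _ X = emb2 m n _ X * emb1 m n _ (GMat m n ℓ) := by
  have h : ∀ (G X : Mat m n), (∃ g : Fin (m + n) → ℂ, G = Matrix.diagonal fun i => g i • 1) →
      emb1 m n _ G * emb2 m n _ X = emb2 m n _ X * emb1 m n _ G := by
    rintro _ X ⟨g, rfl⟩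
    ext ⟨k, i⟩ ⟨l, j⟩
    rw [emb1_mul_emb2_apply, emb2_mul_emb1_apply]
    rcases eq_or_ne i j with rfl | hij
    · rw [Matrix.diagonal_apply_eq, smul_mul_assoc, mul_smul_comm, one_mul, mul_one,
        Even.neg_one_pow (by simp),
        Even.neg_one_pow (by simp)]
    · rw [Matrix.diagonal_apply_ne _ hij, zero_mul, mul_zero, smul_zero, smul_zero]
  refine h _ X ⟨fun i => if i.val < ℓ then 1 else -1, ?_⟩
  rw [GMat]
  congr 1
  funext i
  by_cases hi : i.val < ℓ <;> simp [hi]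

/-- This is the previous commutation conjugated by `P`, which interchanges the two embeddings. -/
theorem emb2_GMat_comm (ℓ : ℕ) (X : Mat m n) :
    emb1 m n _ X * emb2 m n _ (GMat m n ℓ) = emb2 m n _ (GMat m n ℓ) * emb1 m n _ X := by
  have hP := permMat_sq (m := m) (n := n) (D := CDY m n)
  have h : emb2 m n _ (GMat m n ℓ) = permMat m n _ * emb1 m n _ (GMat m n ℓ) * permMat m n _ := by
    rw [permMat_mul_emb1, mul_assoc, hP, mul_one]
  have h2 := emb1_GMat_comm ℓ X
  rw [emb1_eq X, h]
  calc permMat m n _ * emb2 m n _ X * permMat m n _ *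
        (permMat m n _ * emb1 m n _ (GMat m n ℓ) * permMat m n _)
      = permMat m n _ * emb2 m n _ X * (permMat m n _ * permMat m n _) *
        emb1 m n _ (GMat m n ℓ) * permMat m n _ := by simp only [mul_assoc]
    _ = permMat m n _ * (emb2 m n _ X * emb1 m n _ (GMat m n ℓ)) * permMat m n _ := by
        rw [hP, mul_one]; simp only [mul_assoc]
    _ = permMat m n _ * emb1 m n _ (GMat m n ℓ) * (permMat m n _ * permMat m n _) *
          emb2 m n _ X * permMat m n _ := by
        rw [← h2, hP, mul_one]; simp only [mul_assoc]
    _ = _ := by simp only [mul_assoc]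

theorem ser1_C (G : Mat m n) :
    ser1 m n _ (PowerSeries.C G) = cst m n _ (emb1 m n _ G) := by
  rw [ser1, PowerSeries.map_C]; rfl

theorem ser2_C (G : Mat m n) :
    ser2 m n _ (PowerSeries.C G) = cst m n _ (emb2 m n _ G) := by
  rw [ser2, RingHom.comp_apply, PowerSeries.map_C]; rfl

theorem cst_emb1_comm_ser2 (ℓ : ℕ) (X : PowerSeries (Mat m n)) :
    cst m n _ (emb1 m n _ (GMat m n ℓ)) * ser2 m n _ X =
      ser2 m n _ X * cst m n _ (emb1 m n _ (GMat m n ℓ)) := by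
  rw [← ser1_C]
  refine coeff2_ext fun a b => ?_
  rw [coeff2_ser12, coeff2_ser21, PowerSeries.coeff_C]
  split_ifs
  · exact emb1_GMat_comm ℓ _
  · simp

theorem ser1_comm_cst_emb2 (ℓ : ℕ) (X : PowerSeries (Mat m n)) :
    ser1 m n _ X * cst m n _ (emb2 m n _ (GMat m n ℓ)) =
      cst m n _ (emb2 m n _ (GMat m n ℓ)) * ser1 m n _ X := by
  rw [← ser2_C]
  refine coeff2_ext fun a b => ?_
  rw [coeff2_ser12, coeff2_ser21, PowerSeries.coeff_C]
  split_ifs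
  · exact emb2_GMat_comm ℓ _
  · simp

/-- The reflection equation for the series `X(u) G X(-u)⁻¹` and `Y(v) G Y(-v)⁻¹`. -/
theorem comm_conjPart (ℓ : ℕ) {p q p' q' : Subring.center (Ser2 m n (CDY m n))}
    {X Y : PowerSeries (Mat m n)} (h : IsReflectionDatum p q p' q' X Y)
    (hX : IsUnit (negVar X)) (hY : IsUnit (negVar Y)) {P β₁ β₂ G₁ G₂ : Ser2 m n (CDY m n)}
    (eP : P = cst m n _ (permMat m n _))
    (eβ₁ : β₁ = ser1 m n _ (conjPart ℓ X)) (eβ₂ : β₂ = ser2 m n _ (conjPart ℓ Y))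
    (eG₁ : G₁ = cst m n _ (emb1 m n _ (GMat m n ℓ)))
    (eG₂ : G₂ = cst m n _ (emb2 m n _ (GMat m n ℓ))) :
    p • p' • (β₁ * β₂ - β₂ * β₁) =
      p • q' • ((β₁ * P * G₂ + G₁ * P * β₂ - β₂ * P * G₁ - G₂ * P * β₁) +
        (β₁ * P * β₂ - β₂ * P * β₁)) +
      q • p' • ((P * β₁ * G₂ + P * G₁ * β₂ - β₂ * G₁ * P - G₂ * β₁ * P) +
        (P * β₁ * β₂ - β₂ * β₁ * P)) -
      q • q' • ((P * β₁ * P * G₂ + P * G₁ * P * β₂ - β₂ * P * G₁ * P - G₂ * P * β₁ * P) +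
        (P * β₁ * P * β₂ - β₂ * P * β₁ * P)) := by
  have hP : P * P = 1 := by rw [eP, ← map_mul, permMat_sq, map_one]
  have hPG : P * G₁ = G₂ * P := by rw [eP, eG₁, eG₂, ← map_mul, permMat_mul_emb1, map_mul]
  have hPG' : P * G₂ = G₁ * P := by rw [eP, eG₁, eG₂, ← map_mul, permMat_mul_emb2, map_mul]
  have hGG : G₁ * G₂ = G₂ * G₁ := by rw [eG₁, eG₂, ← map_mul, emb1_GMat_comm, map_mul]
  have hG₁ : G₁ * G₁ = 1 := by rw [eG₁, ← map_mul, ← map_mul, GMat_sq, map_one, map_one]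
  have hG₂ : G₂ * G₂ = 1 := by rw [eG₂, ← map_mul, ← map_mul, GMat_sq, map_one, map_one]
  refine comm_of_reflection hP hPG hPG' hGG hG₁ hG₂
    (by rw [eβ₁, eG₂, ser1_comm_cst_emb2]) (by rw [eβ₂, eG₁, cst_emb1_comm_ser2]) ?_
  have e1 : G₁ + β₁ = ser1 m n _ X * G₁ * ser1 m n _ (Ring.inverse (negVar X)) := by
    rw [eG₁, eβ₁, ← ser1_C, conjPart, map_sub, map_mul, map_mul, add_sub_cancel]
  have e2 : G₂ + β₂ = ser2 m n _ Y * G₂ * ser2 m n _ (Ring.inverse (negVar Y)) := by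
    rw [eG₂, eβ₂, ← ser2_C, conjPart, map_sub, map_mul, map_mul, add_sub_cancel]
  rw [e1, e2]
  have hs : ∀ (c : Subring.center (Ser2 m n (CDY m n))) (z : Ser2 m n (CDY m n)),
    c • z = c.1 * z := fun c z => rfl
  have h1 := h.pos_pos
  have h2 := h.pos_neg
  have h3 := h.neg_pos
  have h4 := h.neg_neg
  rw [RTT, ← eP] at h1 h2 h3 h4
  rw [neg_mul, sub_neg_eq_add] at h3 h4
  refine reflection_eq (A' := ser1 m n _ (negVar X)) (B' := ser2 m n _ (negVar Y)) hP
    ?_ ?_ ?_ ?_ ?_ ?_ ?_ ?_ ?_ ?_ hPG hPG' hGG hG₁ hG₂ ?_ ?_ ?_ ?_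
  · simpa only [hs, mul_one] using h1
  · simpa only [hs, mul_one] using h2
  · simpa only [hs, mul_one] using h3
  · simpa only [hs, mul_one] using h4
  · exact fun z hz => h.regular z hz
  · exact fun z hz => h.regular' z hz
  · rw [← map_mul, Ring.mul_inverse_cancel _ hX, map_one]
  · rw [← map_mul, Ring.inverse_mul_cancel _ hX, map_one]
  · rw [← map_mul, Ring.mul_inverse_cancel _ hY, map_one]
  · rw [← map_mul, Ring.inverse_mul_cancel _ hY, map_one]
  · rw [eG₁, cst_emb1_comm_ser2]
  · rw [eG₂, ser1_comm_cst_emb2]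
  · rw [eG₂, ser1_comm_cst_emb2]
  · rw [eG₁, cst_emb1_comm_ser2]

end ReflectionSeries

/-! ### Degree bounds for series in two variables -/

section Bounds

set_option linter.unusedSectionVars false

variable {m n : ℕ}

/-- The coefficients of `x ^ a y ^ b` of `z` have entries in `F (w a + w' b + c)`. -/
def Bnd (F : ℤ → Submodule ℂ (CDY m n)) (w w' c : ℤ) (z : Ser2 m n (CDY m n)) : Prop :=
  ∀ (a b : ℕ) s t, coeff2 a b z s t ∈ F (w * a + w' * b + c)

/-- Matrices with entries in the ground field. -/
def IsScalarMat (Q : Mat2 m n (CDY m n)) : Prop := ∀ s t, ∃ c : ℂ, Q s t = c • 1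

variable {F F' : ℤ → Submodule ℂ (CDY m n)} {w w' c c' : ℤ} {z z' : Ser2 m n (CDY m n)}

theorem Bnd.add (h : Bnd F w w' c z) (h' : Bnd F w w' c z') : Bnd F w w' c (z + z') := by
  intro a b s t
  rw [coeff2_add]
  exact add_mem (h a b s t) (h' a b s t)

theorem Bnd.sub (h : Bnd F w w' c z) (h' : Bnd F w w' c z') : Bnd F w w' c (z - z') := by
  intro a b s t
  rw [coeff2_sub]
  exact sub_mem (h a b s t) (h' a b s t)

theorem Bnd.cst_mul (h : Bnd F w w' c z) {Q : Mat2 m n (CDY m n)} (hQ : IsScalarMat Q) :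
    Bnd F w w' c (cst m n _ Q * z) := by
  intro a b s t
  rw [coeff2_cst_mul, Matrix.mul_apply]
  refine sum_mem fun e _ => ?_
  obtain ⟨k, hk⟩ := hQ s e
  rw [hk, smul_mul_assoc, one_mul]
  exact Submodule.smul_mem _ _ (h a b e t)

theorem Bnd.mul_cst (h : Bnd F w w' c z) {Q : Mat2 m n (CDY m n)} (hQ : IsScalarMat Q) :
    Bnd F w w' c (z * cst m n _ Q) := by
  intro a b s t
  rw [coeff2_mul_cst, Matrix.mul_apply]
  refine sum_mem fun e _ => ?_
  obtain ⟨k, hk⟩ := hQ e t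
  rw [hk, mul_smul_comm, mul_one]
  exact Submodule.smul_mem _ _ (h a b s e)

theorem Bnd.X_mul (h : Bnd F w w' c z) : Bnd F w w' (c - w) (varX m n _ * z) := by
  intro a b s t
  rcases a with _ | a
  · rw [coeff2_X_zero]
    exact zero_mem _
  · rw [coeff2_X_succ]
    convert h a b s t using 2
    push_cast
    ring

theorem Bnd.Y_mul (h : Bnd F w w' c z) : Bnd F w w' (c - w') (varY m n _ * z) := by
  intro a b s t
  rcases b with _ | b
  · rw [coeff2_Y_zero]
    exact zero_mem _
  · rw [coeff2_Y_succ]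
    convert h a b s t using 2
    push_cast
    ring

theorem Bnd.mono (h : Bnd F w w' c z) (hF : ∀ d, F d ≤ F' (d + c')) :
    Bnd F' w w' (c + c') z := by
  intro a b s t
  have := hF _ (h a b s t)
  rwa [add_assoc] at this

theorem Bnd.mul [SetLike.GradedMonoid F] (h : Bnd F w w' c z) (h' : Bnd F w w' c' z') :
    Bnd F w w' (c + c') (z * z') := by
  intro a b s t
  rw [coeff2, PowerSeries.coeff_mul, map_sum, Matrix.sum_apply]
  refine sum_mem fun x hx => ?_
  rw [PowerSeries.coeff_mul, Matrix.sum_apply]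
  refine sum_mem fun y hy => ?_
  rw [Matrix.mul_apply]
  refine sum_mem fun e _ => ?_
  have := SetLike.mul_mem_graded (A := F) (h x.1 y.1 s e) (h' x.2 y.2 e t)
  rw [← Finset.HasAntidiagonal.mem_antidiagonal.1 hx,
    ← Finset.HasAntidiagonal.mem_antidiagonal.1 hy]
  convert this using 2
  · push_cast
    ring
  · rfl
  · rfl

theorem isScalarMat_permMat : IsScalarMat (permMat m n (CDY m n)) := by
  intro s t
  rw [permMat, Matrix.of_apply]
  split_ifs
  · exact ⟨_, rfl⟩
  · exact ⟨0, (zero_smul _ _).symm⟩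

theorem isScalarMat_emb2_GMat (ℓ : ℕ) : IsScalarMat (emb2 m n _ (GMat m n ℓ)) := by
  intro s t
  rw [emb2_apply, GMat, Matrix.diagonal_apply]
  split_ifs
  · exact ⟨1, by simp⟩
  · exact ⟨-1, by simp⟩
  · exact ⟨0, by simp⟩
  · exact ⟨0, by simp⟩

theorem isScalarMat_emb1_GMat (ℓ : ℕ) : IsScalarMat (emb1 m n _ (GMat m n ℓ)) := by
  intro s t
  rw [emb1_apply, GMat, Matrix.diagonal_apply]
  split_ifs
  · exact ⟨_, rfl⟩
  · exact ⟨-((-1) ^ (parity s.1 * (parity s.2 + parity t.2))), by simp⟩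
  · exact ⟨0, by simp⟩
  · exact ⟨0, by simp⟩

/-- Multiplication by `p` shifts all degree bounds by `s`. -/
def Shifts (w w' s : ℤ) (p : Subring.center (Ser2 m n (CDY m n))) : Prop :=
  ∀ (F : ℤ → Submodule ℂ (CDY m n)) (c : ℤ) z, Bnd F w w' c z → Bnd F w w' (c + s) (p • z)

/-- The bound for the commutator which follows from the reflection equation. `L` is the
filtration modulo which the elements of the family are considered, `F` the one of
decomposable elements. -/
theorem bnd_comm_conjPart (ℓ : ℕ) {p q p' q' : Subring.center (Ser2 m n (CDY m n))}
    {X Y : PowerSeries (Mat m n)} (h : IsReflectionDatum p q p' q' X Y)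
    (hX : IsUnit (negVar X)) (hY : IsUnit (negVar Y)) {s : ℤ}
    (hp : Shifts w w' s p) (hq : Shifts w w' (s - 1) q)
    (hp' : Shifts w w' s p') (hq' : Shifts w w' (s - 1) q')
    {L : ℤ → Submodule ℂ (CDY m n)} [SetLike.GradedMonoid F] (hLF : ∀ d, L d ≤ F d)
    (hFL : ∀ d, F d ≤ L (d + 1))
    (h1 : Bnd L w w' (-1) (ser1 m n _ (conjPart ℓ X)))
    (h2 : Bnd L w w' (-1) (ser2 m n _ (conjPart ℓ Y))) :
    Bnd L w w' (2 * s - 2) (p • p' • (ser1 m n _ (conjPart ℓ X) * ser2 m n _ (conjPart ℓ Y) -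
      ser2 m n _ (conjPart ℓ Y) * ser1 m n _ (conjPart ℓ X))) := by
  generalize eβ₁ : ser1 m n _ (conjPart ℓ X) = β₁ at *
  generalize eβ₂ : ser2 m n _ (conjPart ℓ Y) = β₂ at *
  rw [comm_conjPart ℓ h hX hY rfl eβ₁.symm eβ₂.symm rfl rfl]
  have hP := isScalarMat_permMat (m := m) (n := n)
  have hG1 := isScalarMat_emb1_GMat (m := m) (n := n) ℓ
  have hG2 := isScalarMat_emb2_GMat (m := m) (n := n) ℓ
  have f1 : Bnd F w w' (-1) β₁ := by simpa using h1.mono (c' := 0) (by simpa using hLF)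
  have f2 : Bnd F w w' (-1) β₂ := by simpa using h2.mono (c' := 0) (by simpa using hLF)
  -- Products of two coefficients gain an extra `-1`. They are thus of smaller formal degree than
  -- the linear terms, and elements of smaller formal degree count as linear in `L`.
  have hL : ∀ z : Ser2 m n (CDY m n), Bnd F w w' (-2) z → Bnd L w w' (-1) z := fun z hz =>
    hz.mono hFL
  have hL' : ∀ z : Ser2 m n (CDY m n), Bnd L w w' (2 * s - 3) z →
      Bnd L w w' (2 * s - 2) z := fun z hz => by
    have := hz.mono (F' := L) (c' := 1) fun d => (hLF d).trans (hFL d)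
    rwa [show 2 * s - 3 + 1 = 2 * s - 2 by ring] at this
  -- The commutator is multiplied by `p p'`, which shifts degrees by `2 s`, while each term on the
  -- right has at least one factor `q` or `q'`, which shifts by `s - 1` only. After division the
  -- bound becomes `-2`, the sum of the bounds `-1` of the two factors.
  have e : ∀ z, Bnd L w w' (-1) z → Bnd L w w' (2 * s - 2) (p • q' • z) := fun z hz => by
    have := hp _ _ _ (hq' _ _ _ hz)
    rwa [show -1 + (s - 1) + s = 2 * s - 2 by ring] at this
  have e' : ∀ z, Bnd L w w' (-1) z → Bnd L w w' (2 * s - 2) (q • p' • z) := fun z hz => by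
    have := hq _ _ _ (hp' _ _ _ hz)
    rwa [show -1 + s + (s - 1) = 2 * s - 2 by ring] at this
  have e'' : ∀ z, Bnd L w w' (-1) z → Bnd L w w' (2 * s - 2) (q • q' • z) := fun z hz => by
    have := hq _ _ _ (hq' _ _ _ hz)
    exact hL' _ (by rwa [show -1 + (s - 1) + (s - 1) = 2 * s - 3 by ring] at this)
  refine ((e _ (.add (.sub (.sub (.add ?_ ?_) ?_) ?_) (hL _ (.sub ?_ ?_)))).add
    (e' _ (.add (.sub (.sub (.add ?_ ?_) ?_) ?_) (hL _ (.sub ?_ ?_))))).sub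
    (e'' _ (.add (.sub (.sub (.add ?_ ?_) ?_) ?_) (hL _ (.sub ?_ ?_))))
  · exact (h1.mul_cst hP).mul_cst hG2
  · rw [mul_assoc]; exact (h2.cst_mul hP).cst_mul hG1
  · exact (h2.mul_cst hP).mul_cst hG1
  · rw [mul_assoc]; exact (h1.cst_mul hP).cst_mul hG2
  · exact (f1.mul_cst hP).mul f2
  · exact (f2.mul_cst hP).mul f1
  · exact (h1.cst_mul hP).mul_cst hG2
  · rw [mul_assoc]; exact (h2.cst_mul hG1).cst_mul hP
  · exact (h2.mul_cst hG1).mul_cst hP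
  · exact (h1.cst_mul hG2).mul_cst hP
  · exact (f1.cst_mul hP).mul f2
  · exact (f2.mul f1).mul_cst hP
  · exact ((h1.cst_mul hP).mul_cst hP).mul_cst hG2
  · rw [mul_assoc, mul_assoc]; exact ((h2.cst_mul hP).cst_mul hG1).cst_mul hP
  · exact ((h2.mul_cst hP).mul_cst hG1).mul_cst hP
  · rw [mul_assoc (cst m n _ (emb2 m n _ (GMat m n ℓ)))]
    exact ((h1.cst_mul hP).cst_mul hG2).mul_cst hP
  · exact ((f1.cst_mul hP).mul_cst hP).mul f2
  · exact ((f2.mul_cst hP).mul f1).mul_cst hP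

theorem shifts_cX (w w' : ℤ) : Shifts w w' (-w) (cX m n (CDY m n)) := fun _ _ _ hz => hz.X_mul

theorem shifts_cY (w w' : ℤ) : Shifts w w' (-w') (cY m n (CDY m n)) := fun _ _ _ hz => hz.Y_mul

variable {s s' : ℤ} {p q : Subring.center (Ser2 m n (CDY m n))}

theorem Shifts.add (hp : Shifts w w' s p) (hq : Shifts w w' s q) : Shifts w w' s (p + q) :=
  fun F c z hz => by
    rw [add_smul]
    exact (hp F c z hz).add (hq F c z hz)

theorem Shifts.sub (hp : Shifts w w' s p) (hq : Shifts w w' s q) : Shifts w w' s (p - q) :=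
  fun F c z hz => by
    rw [sub_smul]
    exact (hp F c z hz).sub (hq F c z hz)

theorem Shifts.mul (hp : Shifts w w' s p) (hq : Shifts w w' s' q) :
    Shifts w w' (s + s') (p * q) :=
  fun F c z hz => by
    rw [mul_smul, show c + (s + s') = c + s' + s by ring]
    exact hp _ _ _ (hq F c z hz)

theorem shifts_one : Shifts w w' 0 (1 : Subring.center (Ser2 m n (CDY m n))) :=
  fun F c z hz => by rwa [one_smul, add_zero]

/-- Division by `y² - x²`. -/
theorem Bnd.of_sq_sub_sq {s : ℤ}
    (h : Bnd F w w (c + s) (varY m n _ * (varY m n _ * z) - varX m n _ * (varX m n _ * z)))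
    (hs : s = -2 * w) : Bnd F w w c z := by
  subst hs
  intro a
  induction a using Nat.strong_induction_on with
  | _ a ih =>
    intro b s t
    -- The coefficient at `x^a y^{b+2}` of `(y² - x²) z` is `z_{a,b} - z_{a-2,b+2}`. Both variables
    -- have weight `w`, so the term known by induction has the same degree bound.
    have h' := h a (b + 2) s t
    rw [coeff2_sub, coeff2_Y_succ, coeff2_Y_succ, Matrix.sub_apply] at h'
    rw [show w * (a : ℤ) + w * ((b + 2 : ℕ) : ℤ) + (c + -2 * w) = w * a + w * b + c by
      push_cast; ring] at h'
    rcases a with _ | _ | a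
    · simpa only [coeff2_X_zero, Matrix.zero_apply, sub_zero] using h'
    · simpa only [coeff2_X_succ, coeff2_X_zero, Matrix.zero_apply, sub_zero] using h'
    · rw [coeff2_X_succ, coeff2_X_succ] at h'
      have := ih a (by lia) (b + 2) s t
      rw [show w * (a : ℤ) + w * ((b + 2 : ℕ) : ℤ) + c = w * ((a + 1 + 1 : ℕ) : ℤ) + w * b + c by
        push_cast; ring] at this
      simpa using add_mem h' this

/-- Division by `1 - x² y²`. -/
theorem Bnd.of_one_sub {w : ℤ}
    (h : Bnd F w (-w) c (z - varX m n _ * (varX m n _ * (varY m n _ * (varY m n _ * z))))) :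
    Bnd F w (-w) c z := by
  intro a
  induction a using Nat.strong_induction_on with
  | _ a ih =>
    intro b s t
    -- The coefficient at `x^a y^b` is `z_{a,b} - z_{a-2,b-2}`, and `x² y²` has weight zero since
    -- the weights of the variables are opposite.
    have h' := h a b s t
    rw [coeff2_sub, Matrix.sub_apply] at h'
    rcases a with _ | _ | a
    · simpa only [coeff2_X_zero, Matrix.zero_apply, sub_zero] using h'
    · simpa only [coeff2_X_succ, coeff2_X_zero, Matrix.zero_apply, sub_zero] using h'
    · rw [coeff2_X_succ, coeff2_X_succ] at h'
      rcases b with _ | _ | b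
      · simpa only [coeff2_Y_zero, Matrix.zero_apply, sub_zero] using h'
      · simpa only [coeff2_Y_succ, coeff2_Y_zero, Matrix.zero_apply, sub_zero] using h'
      · rw [coeff2_Y_succ, coeff2_Y_succ] at h'
        have := ih a (by lia) b s t
        rw [show w * (a : ℤ) + -w * (b : ℤ) + c =
          w * ((a + 1 + 1 : ℕ) : ℤ) + -w * ((b + 1 + 1 : ℕ) : ℤ) + c by push_cast; ring] at this
        simpa using add_mem h' this

end Bounds


/-! ### Formal degree: unitarity, leading terms and supercommutators of the generators -/

section Form

set_option linter.unusedSectionVars false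

variable {m n : ℕ}

/-- The elements `b_{ij}^{(r)}`, with `r` a nonzero integer. -/
def genEl (ℓ : ℕ) (g : Gen m n) : CDY m n :=
  if 0 < g.r then b ℓ g.i g.j g.r.toNat else bPlus ℓ g.i g.j (-g.r).toNat

/-- The total degree of a word in the generators. -/
def wordDeg (w : List (Gen m n)) : ℤ := (w.map fun g => degTwo g.r).sum

@[simp] theorem wordDeg_nil : wordDeg ([] : List (Gen m n)) = 0 := rfl

@[simp] theorem wordDeg_cons (g : Gen m n) (w : List (Gen m n)) :
    wordDeg (g :: w) = degTwo g.r + wordDeg w := by simp [wordDeg]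

@[simp] theorem wordDeg_append (v w : List (Gen m n)) :
    wordDeg (v ++ w) = wordDeg v + wordDeg w := by simp [wordDeg]

/-- The filtration by the formal degree of the algebra generated by the `b_{ij}^{(r)}`, `r ∈ H`. -/
def form (ℓ : ℕ) (H : Set ℤ) (d : ℤ) : Submodule ℂ (CDY m n) :=
  Submodule.span ℂ {x | ∃ w : List (Gen m n), (∀ g ∈ w, g.r ∈ H) ∧ wordDeg w ≤ d ∧
    x = (w.map (genEl ℓ)).prod}

/-- The elements of formal degree at most `d` which are linear in degree `d`. -/
def topForm (ℓ : ℕ) (H : Set ℤ) (d : ℤ) : Submodule ℂ (CDY m n) :=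
  Submodule.span ℂ {x | ∃ g : Gen m n, g.r ∈ H ∧ degTwo g.r = d ∧ x = genEl ℓ g} ⊔
    form ℓ H (d - 1)

variable {ℓ : ℕ} {H : Set ℤ} {d e : ℤ}

theorem form_mono (h : d ≤ e) : form (m := m) (n := n) ℓ H d ≤ form ℓ H e :=
  Submodule.span_mono fun _ ⟨w, hw, hd, hx⟩ => ⟨w, hw, hd.trans h, hx⟩

theorem word_mem_form {w : List (Gen m n)} (hw : ∀ g ∈ w, g.r ∈ H) :
    (w.map (genEl ℓ)).prod ∈ form ℓ H (wordDeg w) :=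
  Submodule.subset_span ⟨w, hw, le_rfl, rfl⟩

theorem genEl_mem_form {g : Gen m n} (hg : g.r ∈ H) : genEl ℓ g ∈ form ℓ H (degTwo g.r) :=
  Submodule.subset_span ⟨[g], by simpa using hg, by simp, by simp⟩

theorem genEl_mem_topForm {g : Gen m n} (hg : g.r ∈ H) (hd : degTwo g.r = d) :
    genEl ℓ g ∈ topForm ℓ H d :=
  Submodule.mem_sup_left (Submodule.subset_span ⟨g, hg, hd, rfl⟩)

theorem topForm_le_form : topForm (m := m) (n := n) ℓ H d ≤ form ℓ H d := by
  refine sup_le (Submodule.span_le.2 ?_) (form_mono (by lia))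
  rintro _ ⟨g, hg, rfl, rfl⟩
  exact genEl_mem_form hg

theorem form_le_topForm : form (m := m) (n := n) ℓ H d ≤ topForm ℓ H (d + 1) := by
  rw [topForm, add_sub_cancel_right]
  exact le_sup_right

instance (ℓ : ℕ) (H : Set ℤ) : SetLike.GradedMonoid (form (m := m) (n := n) ℓ H) where
  one_mem := Submodule.subset_span ⟨[], by simp, by simp, by simp⟩
  mul_mem a b x y hx hy := by
    have h := Submodule.mul_mem_mul hx hy
    rw [form, form, Submodule.span_mul_span] at h
    refine Submodule.span_mono ?_ h
    rintro _ ⟨_, ⟨v, hv, hv', rfl⟩, _, ⟨w, hw, hw', rfl⟩, rfl⟩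
    refine ⟨v ++ w, fun g hg => (List.mem_append.1 hg).elim (hv g) (hw g), ?_, by simp⟩
    rw [wordDeg_append]
    exact add_le_add hv' hw'

theorem form_mul {x y : CDY m n} (hx : x ∈ form ℓ H d) (hy : y ∈ form ℓ H e) :
    x * y ∈ form ℓ H (d + e) := SetLike.mul_mem_graded hx hy

/-- The sign in the matrix `G`. -/
def eps {m n : ℕ} (ℓ : ℕ) (i : Fin (m + n)) : ℂ := if i.val < ℓ then 1 else -1

theorem GMat_eq (ℓ : ℕ) : GMat m n ℓ = Matrix.diagonal fun i => eps ℓ i • 1 := by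
  rw [GMat]
  congr 1
  funext i
  by_cases hi : i.val < ℓ <;> simp [hi, eps]

theorem mul_GMat_apply (X : Mat m n) (i j : Fin (m + n)) :
    (X * GMat m n ℓ) i j = eps ℓ j • X i j := by
  rw [GMat_eq, Matrix.mul_diagonal, mul_smul_comm, mul_one]

theorem GMat_mul_apply (X : Mat m n) (i j : Fin (m + n)) :
    (GMat m n ℓ * X) i j = eps ℓ i • X i j := by
  rw [GMat_eq, Matrix.diagonal_mul, smul_mul_assoc, one_mul]

theorem coeff_negVar_apply (f : PowerSeries (Mat m n)) (a : ℕ) (i j : Fin (m + n)) :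
    PowerSeries.coeff a (negVar f) i j = (-1 : ℂ) ^ a • PowerSeries.coeff a f i j := by
  rw [negVar, PowerSeries.coeff_mk]
  rcases Nat.even_or_odd a with h | h <;> simp [h.neg_one_pow]

theorem negVar_negVar {R : Type*} [Ring R] (f : PowerSeries R) : negVar (negVar f) = f := by
  ext a
  rw [negVar, PowerSeries.coeff_mk, negVar, PowerSeries.coeff_mk, ← mul_assoc, ← pow_add,
    Even.neg_one_pow ⟨a, rfl⟩, one_mul]

/-- The unitarity relation. -/
theorem conjPart_unitarity (ℓ : ℕ) {X : PowerSeries (Mat m n)} (hX : IsUnit (negVar X)) :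
    conjPart ℓ X * PowerSeries.C (GMat m n ℓ) +
      PowerSeries.C (GMat m n ℓ) * negVar (conjPart ℓ X) =
      -(conjPart ℓ X * negVar (conjPart ℓ X)) := by
  have hG : (PowerSeries.C (GMat m n ℓ) * PowerSeries.C (GMat m n ℓ) : PowerSeries (Mat m n)) = 1 := by
    rw [← map_mul, GMat_sq, map_one]
  have hi : X * negVar (Ring.inverse (negVar X)) = 1 := by
    have h := congrArg (negHom (Mat m n)) (Ring.mul_inverse_cancel _ hX)
    rwa [map_mul, map_one, negHom_apply, negHom_apply, negVar_negVar] at h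
  have h1 : (PowerSeries.C (GMat m n ℓ) + conjPart ℓ X) *
      (PowerSeries.C (GMat m n ℓ) + negVar (conjPart ℓ X)) = 1 := by
    have e1 : PowerSeries.C (GMat m n ℓ) + conjPart ℓ X =
        X * PowerSeries.C (GMat m n ℓ) * Ring.inverse (negVar X) := by
      rw [conjPart, add_sub_cancel]
    have e2 : PowerSeries.C (GMat m n ℓ) + negVar (conjPart ℓ X) =
        negVar X * PowerSeries.C (GMat m n ℓ) * negVar (Ring.inverse (negVar X)) := by
      rw [← negHom_apply, conjPart, map_sub, negHom_C, add_sub_cancel, map_mul, map_mul, negHom_C,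
        negHom_apply, negHom_apply]
    rw [e1, e2]
    calc _ = X * PowerSeries.C (GMat m n ℓ) * (Ring.inverse (negVar X) * negVar X) *
          PowerSeries.C (GMat m n ℓ) * negVar (Ring.inverse (negVar X)) := by
          simp only [mul_assoc]
      _ = X * (PowerSeries.C (GMat m n ℓ) * PowerSeries.C (GMat m n ℓ)) *
          negVar (Ring.inverse (negVar X)) := by
          rw [Ring.inverse_mul_cancel _ hX, mul_one]; simp only [mul_assoc]
      _ = 1 := by rw [hG, mul_one, hi]
  rw [add_mul, mul_add, mul_add, hG] at h1
  rw [← sub_eq_zero] at h1 ⊢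
  rw [← h1]
  abel

/-- Decomposability of the coefficients for which the linear terms in the unitarity relation
do not cancel. -/
theorem coeff_conjPart_mem {F : ℤ → Submodule ℂ (CDY m n)} [SetLike.GradedMonoid F] {w : ℤ}
    {X : PowerSeries (Mat m n)} (hX : IsUnit (negVar X))
    (h : ∀ (a : ℕ) i j, PowerSeries.coeff a (conjPart ℓ X) i j ∈ F (w * a + -1)) (a : ℕ)
    (i j : Fin (m + n)) (hij : eps ℓ j - (-1) ^ a * eps ℓ i = 0) :
    PowerSeries.coeff a (conjPart ℓ X) i j ∈ F (w * a - 2) := by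
  have h' : ∀ (a : ℕ) i j, PowerSeries.coeff a (negVar (conjPart ℓ X)) i j ∈ F (w * a + -1) := by
    intro a i j
    rw [coeff_negVar_apply]
    exact Submodule.smul_mem _ _ (h a i j)
  have h2 := neg_mem (coeff_mul_mem h h' a i j)
  have h3 : PowerSeries.coeff a (conjPart ℓ X * PowerSeries.C (GMat m n ℓ) +
      PowerSeries.C (GMat m n ℓ) * negVar (conjPart ℓ X)) i j =
      PowerSeries.coeff a (-(conjPart ℓ X * negVar (conjPart ℓ X))) i j := by
    rw [conjPart_unitarity ℓ hX]
  rw [map_add, Matrix.add_apply, PowerSeries.coeff_mul_C, PowerSeries.coeff_C_mul,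
    mul_GMat_apply, GMat_mul_apply, coeff_negVar_apply, smul_smul, ← add_smul, map_neg,
    Matrix.neg_apply] at h3
  rw [← h3, show w * (a : ℤ) + (-1 + -1) = w * a - 2 by ring] at h2
  -- The scalar in front of the coefficient in the unitarity relation. The hypothesis says `ε_j =
  -- (-1)^a ε_i`, so it equals `2 ε_j`.
  have h4 : eps ℓ j + eps ℓ i * (-1) ^ a ≠ 0 := by
    rw [show eps ℓ j + eps ℓ i * (-1) ^ a = 2 * eps ℓ j by linear_combination -hij]
    rw [eps]
    split_ifs <;> norm_num
  exact (Submodule.smul_mem_iff _ h4).1 h2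

/-- The leading terms of the coefficients. -/
theorem coeff_conjPart_lead {w : ℤ} {X : PowerSeries (Mat m n)} (hA : Adm w X)
    (hX : IsUnit (negVar X)) (a : ℕ) (i j : Fin (m + n)) :
    PowerSeries.coeff a (conjPart ℓ X) i j -
      (eps ℓ j - (-1) ^ a * eps ℓ i) • (PowerSeries.coeff a (X - 1) : Mat m n) i j ∈ cfilt m n (w * a - 2) := by
  have h1 : ∀ (a : ℕ) i j, PowerSeries.coeff a (conjPart ℓ X) i j ∈ cfilt m n (w * a + -1) :=
    coeff_conj_mem hA (adm_negVar hA) ℓ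
  have h2 : ∀ (a : ℕ) i j, (PowerSeries.coeff a (negVar X - 1) : Mat m n) i j ∈ cfilt m n (w * a + -1) :=
    adm_negVar hA
  have h3 := neg_mem (coeff_mul_mem h1 h2 a i j)
  -- Let `β = X(u) G X(-u)⁻¹ - G`. Multiplication by `X(-u)` removes the inverse, `β X(-u) = X(u) G
  -- - G X(-u)`. Writing `X = 1 + h` gives `β = h(u) G - G h(-u) - β h(-u)`, and the last term is
  -- quadratic, hence of smaller degree.
  have h4 : (conjPart ℓ X) - ((X - 1) * PowerSeries.C (GMat m n ℓ) -
      PowerSeries.C (GMat m n ℓ) * negVar (X - 1)) = -(conjPart ℓ X * (negVar X - 1)) := by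
    have e : negVar (X - 1) = negVar X - 1 := by
      rw [← negHom_apply, map_sub, map_one, negHom_apply]
    have e2 : conjPart ℓ X * negVar X = X * PowerSeries.C (GMat m n ℓ) -
        PowerSeries.C (GMat m n ℓ) * negVar X := by
      rw [conjPart, sub_mul, mul_assoc _ (Ring.inverse _), Ring.inverse_mul_cancel _ hX, mul_one]
    have e3 : conjPart ℓ X * (negVar X - 1) = conjPart ℓ X * negVar X - conjPart ℓ X := by
      rw [mul_sub, mul_one]
    rw [e, e3, e2]
    noncomm_ring
  have h5 : (PowerSeries.coeff a ((conjPart ℓ X) - ((X - 1) * PowerSeries.C (GMat m n ℓ) -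
      PowerSeries.C (GMat m n ℓ) * negVar (X - 1))) : Mat m n) i j =
      (PowerSeries.coeff a (-(conjPart ℓ X * (negVar X - 1))) : Mat m n) i j := by
    rw [h4]
  rw [map_sub, map_sub, Matrix.sub_apply, Matrix.sub_apply, PowerSeries.coeff_mul_C,
    PowerSeries.coeff_C_mul, mul_GMat_apply, GMat_mul_apply, coeff_negVar_apply, smul_smul,
    ← sub_smul, mul_comm, map_neg, Matrix.neg_apply] at h5
  rw [h5]
  rwa [show w * (a : ℤ) + (-1 + -1) = w * a - 2 by ring] at h3

theorem coeff_conjPart_TSer (a : ℕ) (i j : Fin (m + n)) :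
    PowerSeries.coeff a (conjPart ℓ (TSer m n)) i j = if a = 0 then 0 else b ℓ i j a := by
  rw [conjPart, map_sub, Matrix.sub_apply, PowerSeries.coeff_C]
  split_ifs with h
  · subst h
    have hT : PowerSeries.constantCoeff (TSer m n) = 1 := by
      ext i j
      rw [← PowerSeries.coeff_zero_eq_constantCoeff_apply, TSer, PowerSeries.coeff_mk,
        Matrix.of_apply, Nat.cast_zero, tC_zero]
    have hT' : PowerSeries.constantCoeff (negVar (TSer m n)) = 1 := by
      rw [← PowerSeries.coeff_zero_eq_constantCoeff_apply, negVar, PowerSeries.coeff_mk, pow_zero,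
        one_mul, PowerSeries.coeff_zero_eq_constantCoeff_apply, hT]
    have hi := congrArg PowerSeries.constantCoeff
      (Ring.mul_inverse_cancel _ (isUnit_negVar_TSer m n))
    rw [map_mul, hT', one_mul, map_one] at hi
    rw [PowerSeries.coeff_zero_eq_constantCoeff_apply, map_mul, map_mul, hT, hi,
      PowerSeries.constantCoeff_C, one_mul, mul_one, sub_self]
  · rw [Matrix.zero_apply, sub_zero]
    rfl

theorem coeff_conjPart_TPlusSer (a : ℕ) (i j : Fin (m + n)) :
    PowerSeries.coeff a (conjPart ℓ (TPlusSer m n)) i j = -bPlus ℓ i j (a + 1) := by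
  rw [conjPart, map_sub, Matrix.sub_apply, PowerSeries.coeff_C, bPlus, neg_sub,
    Nat.add_sub_cancel, BPlusSer]
  congr 1
  rcases Nat.eq_zero_or_pos a with rfl | ha
  · simp
  · rw [if_neg ha.ne', if_neg (by lia), Matrix.zero_apply]

/-- The coefficient of `t_{ij}^{(r)}` in the leading term of `b_{ij}^{(r)}`. -/
def lead (ℓ : ℕ) (g : Gen m n) : ℂ :=
  eps ℓ g.j - (-1) ^ (if 0 < g.r then g.r.toNat else (-g.r - 1).toNat) * eps ℓ g.i

/-- A set of superscripts which contains all superscripts of the same sign with each of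
its elements. -/
def SignClosed (H : Set ℤ) : Prop := ∀ r ∈ H, ∀ s : ℤ, s ≠ 0 → (0 < r ↔ 0 < s) → s ∈ H

theorem coeff_TSer_mem_topForm (hH : ∀ r : ℤ, 0 < r → r ∈ H) (a : ℕ) (i j : Fin (m + n)) :
    PowerSeries.coeff a (conjPart ℓ (TSer m n)) i j ∈ topForm ℓ H (1 * a + -1) := by
  rw [coeff_conjPart_TSer]
  split_ifs with h
  · exact zero_mem _
  · have := genEl_mem_topForm (ℓ := ℓ) (g := ⟨i, j, a, by lia⟩) (hH a (by lia))
      (d := 1 * a + -1) (by simp only [degTwo]; rw [if_pos (by lia)]; ring)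
    rwa [genEl, if_pos (by simp <;> lia), Int.toNat_natCast] at this

theorem coeff_TPlusSer_mem_topForm (hH : ∀ r : ℤ, r < 0 → r ∈ H) (a : ℕ) (i j : Fin (m + n)) :
    PowerSeries.coeff a (conjPart ℓ (TPlusSer m n)) i j ∈ topForm ℓ H (-1 * a + -1) := by
  rw [coeff_conjPart_TPlusSer]
  have := genEl_mem_topForm (ℓ := ℓ) (g := ⟨i, j, -(a + 1 : ℤ), by lia⟩) (hH _ (by lia))
      (d := -1 * a + -1) (by simp only [degTwo]; rw [if_neg (by lia)]; ring)
  rw [genEl, if_neg (by simp <;> lia), neg_neg, show ((a : ℤ) + 1).toNat = a + 1 by lia] at this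
  exact neg_mem this

theorem genEl_pos (i j : Fin (m + n)) {r : ℤ} (hr : r ≠ 0) (h : 0 < r) :
    genEl ℓ ⟨i, j, r, hr⟩ = PowerSeries.coeff r.toNat (conjPart ℓ (TSer m n)) i j := by
  rw [coeff_conjPart_TSer, if_neg (by lia), genEl, if_pos h]

theorem genEl_neg (i j : Fin (m + n)) {r : ℤ} (hr : r ≠ 0) (h : r < 0) :
    genEl ℓ ⟨i, j, r, hr⟩ = -PowerSeries.coeff (-r - 1).toNat (conjPart ℓ (TPlusSer m n)) i j := by
  rw [coeff_conjPart_TPlusSer, genEl, if_neg (by simp <;> lia), neg_neg]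
  congr 1
  simp only
  lia

theorem SignClosed.pos (hH : SignClosed H) {r : ℤ} (hr : r ∈ H) (h : 0 < r) (s : ℤ) (hs : 0 < s) :
    s ∈ H := hH r hr s hs.ne' (by simp [h, hs])

theorem SignClosed.neg (hH : SignClosed H) {r : ℤ} (hr : r ∈ H) (h : r < 0) (s : ℤ) (hs : s < 0) :
    s ∈ H := hH r hr s hs.ne (by lia)

/-- The linear part of unitarity has the coefficient `ε_j + (-1)^a ε_i`, and the leading scalar of
the generator is `ε_j - (-1)^a ε_i`. When the latter vanishes the former does not, and unitarity
solves for the generator in terms of products of two generators with superscripts of the same sign.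
These stay in the algebra because `H` is closed under such superscripts. -/
theorem genEl_mem_form_of_lead_eq_zero (hH : SignClosed H) {g : Gen m n} (hg : g.r ∈ H)
    (hl : lead ℓ g = 0) : genEl ℓ g ∈ form ℓ H (degTwo g.r - 1) := by
  obtain ⟨i, j, r, hr⟩ := g
  rcases lt_or_gt_of_ne hr with h | h
  · rw [lead, if_neg (by simp <;> lia)] at hl
    rw [genEl_neg i j hr h]
    have h1 := coeff_conjPart_mem (F := form ℓ H) (w := -1) (ℓ := ℓ)
      (isUnit_negVar_TPlusSer m n)
      (fun a i j => topForm_le_form (coeff_TPlusSer_mem_topForm (hH.neg hg h) a i j)) _ i j hl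
    have h2 := neg_mem h1
    convert h2 using 2
    simp only [degTwo]
    rw [if_neg (by lia)]
    lia
  · rw [lead, if_pos (by simpa using h)] at hl
    rw [genEl_pos i j hr h]
    have h1 := coeff_conjPart_mem (F := form ℓ H) (w := 1) (ℓ := ℓ)
      (isUnit_negVar_TSer m n)
      (fun a i j => topForm_le_form (coeff_TSer_mem_topForm (hH.pos hg h) a i j)) _ i j hl
    convert h1 using 2
    simp only [degTwo]
    rw [if_pos (by lia)]
    lia

/-- This is the link with the double Yangian: the leading term of a generator is a multiple of the
`t_{ij}^{(r)}` with the same indices. For negative `r` two signs cancel, as both expansions at `u =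
0` have a minus sign. -/
theorem genEl_sub_lead_mem (g : Gen m n) :
    genEl ℓ g - lead ℓ g • tC g.i g.j g.r ∈ cfilt m n (degTwo g.r - 1) := by
  obtain ⟨i, j, r, hr⟩ := g
  rcases lt_or_gt_of_ne hr with h | h
  · rw [genEl_neg i j hr h, lead, if_neg (by simp <;> lia)]
    have h1 := neg_mem (coeff_conjPart_lead (ℓ := ℓ) (adm_TPlusSer m n)
      (isUnit_negVar_TPlusSer m n) (-r - 1).toNat i j)
    have h2 : (PowerSeries.coeff (-r - 1).toNat (TPlusSer m n - 1) : Mat m n) i j = -tC i j r := by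
      rw [map_sub, TPlusSer, PowerSeries.coeff_mk, PowerSeries.coeff_one, Matrix.sub_apply,
        Matrix.of_apply, show -(((-r - 1).toNat : ℤ) + 1) = r by lia]
      split_ifs
      · rw [tC_zero]; abel
      · simp
    rw [h2] at h1
    convert h1 using 1
    · simp only [degTwo]
      rw [if_neg (by lia)]
      congr 1
      lia
    · simp only [smul_neg]
      abel
  · rw [genEl_pos i j hr h, lead, if_pos (by simpa using h)]
    have h1 := coeff_conjPart_lead (ℓ := ℓ) (adm_TSer m n)
      (isUnit_negVar_TSer m n) r.toNat i j
    have h2 : (PowerSeries.coeff r.toNat (TSer m n - 1) : Mat m n) i j = tC i j r := by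
      rw [map_sub, TSer, PowerSeries.coeff_mk, PowerSeries.coeff_one, Matrix.sub_apply,
        Matrix.of_apply, show (r.toNat : ℤ) = r by lia, if_neg (by lia)]
      simp
    rw [h2] at h1
    convert h1 using 2
    simp only [degTwo]
    rw [if_pos (by lia)]
    lia

theorem bnd_ser1 {F : ℤ → Submodule ℂ (CDY m n)} {w c : ℤ} (w' : ℤ) {β : PowerSeries (Mat m n)}
    (h : ∀ (a : ℕ) i j, PowerSeries.coeff a β i j ∈ F (w * a + c)) :
    Bnd F w w' c (ser1 m n _ β) := by
  intro a b s t
  rw [coeff2, ser1, PowerSeries.coeff_map, RingHom.comp_apply, PowerSeries.coeff_C]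
  split_ifs with hb
  · rw [emb1_apply]
    split_ifs
    · subst hb
      refine Submodule.smul_mem _ _ ?_
      simpa using h a s.2 t.2
    · exact zero_mem _
  · exact zero_mem _

theorem bnd_ser2 {F : ℤ → Submodule ℂ (CDY m n)} {w' c : ℤ} (w : ℤ) {β : PowerSeries (Mat m n)}
    (h : ∀ (a : ℕ) i j, PowerSeries.coeff a β i j ∈ F (w' * a + c)) :
    Bnd F w w' c (ser2 m n _ β) := by
  intro a b s t
  rw [coeff2, ser2, RingHom.comp_apply, PowerSeries.coeff_C]
  split_ifs with ha
  · rw [PowerSeries.coeff_map, emb2_apply]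
    split_ifs
    · subst ha
      simpa using h b s.1 t.1
    · exact zero_mem _
  · simp

theorem sComm_mem_of_bnd {F : ℤ → Submodule ℂ (CDY m n)} {w w' c : ℤ}
    {β β' : PowerSeries (Mat m n)}
    (h : Bnd F w w' c (ser1 m n _ β * ser2 m n _ β' - ser2 m n _ β' * ser1 m n _ β)) (a b : ℕ)
    (i j k l : Fin (m + n)) :
    sComm i j k l (PowerSeries.coeff a β i j) (PowerSeries.coeff b β' k l) ∈
      F (w * a + w' * b + c) := by
  have h' := h a b (k, i) (l, j)
  rw [coeff2_sub, coeff2_ser12, coeff2_ser21, emb_comm_apply] at h'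
  exact (Submodule.smul_mem_iff _ (pow_ne_zero _ (by norm_num))).1 h'

/-- The reflection equation bounds the commutator times `(y - x)(y + x)`; this factor is removed by
`Bnd.of_sq_sub_sq`. -/
theorem sComm_low_low (hH : ∀ r : ℤ, 0 < r → r ∈ H) (a b : ℕ) (i j k l : Fin (m + n)) :
    sComm i j k l (PowerSeries.coeff a (conjPart ℓ (TSer m n)) i j)
      (PowerSeries.coeff b (conjPart ℓ (TSer m n)) k l) ∈
      topForm ℓ H (1 * a + 1 * b + -2) := by
  refine sComm_mem_of_bnd (Bnd.of_sq_sub_sq (s := -2 * 1) ?_ rfl) a b i j k l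
  have h := bnd_comm_conjPart (F := form ℓ H) (L := topForm ℓ H) (w := 1) (w' := 1) (s := -1) ℓ
    (isReflectionDatum_low_low (isRTTPair_TSer m n).low)
    (isUnit_negVar_TSer m n) (isUnit_negVar_TSer m n)
    ((shifts_cY _ _).sub (shifts_cX _ _)) ((shifts_cX _ _).mul (shifts_cY _ _))
    ((shifts_cY _ _).add (shifts_cX _ _)) ((shifts_cX _ _).mul (shifts_cY _ _))
    (fun _ => topForm_le_form) (fun _ => form_le_topForm)
    (bnd_ser1 _ (coeff_TSer_mem_topForm hH)) (bnd_ser2 _ (coeff_TSer_mem_topForm hH))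
  rw [smul_smul, show (cY m n (CDY m n) - cX m n _) * (cY m n _ + cX m n _) =
    cY m n _ * cY m n _ - cX m n _ * cX m n _ by ring, sub_smul, mul_smul, mul_smul] at h
  exact h

theorem sComm_high_high (hH : ∀ r : ℤ, r < 0 → r ∈ H) (a b : ℕ) (i j k l : Fin (m + n)) :
    sComm i j k l (PowerSeries.coeff a (conjPart ℓ (TPlusSer m n)) i j)
      (PowerSeries.coeff b (conjPart ℓ (TPlusSer m n)) k l) ∈
      topForm ℓ H (-1 * a + -1 * b + -2) := by
  refine sComm_mem_of_bnd (Bnd.of_sq_sub_sq (s := -2 * -1) ?_ rfl) a b i j k l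
  have h := bnd_comm_conjPart (F := form ℓ H) (L := topForm ℓ H) (w := -1) (w' := -1) (s := 1) ℓ
    (isReflectionDatum_high_high (isRTTPair_TSer m n).high)
    (isUnit_negVar_TPlusSer m n) (isUnit_negVar_TPlusSer m n)
    ((shifts_cX _ _).sub (shifts_cY _ _)) shifts_one
    ((shifts_cX _ _).add (shifts_cY _ _)) shifts_one
    (fun _ => topForm_le_form) (fun _ => form_le_topForm)
    (bnd_ser1 _ (coeff_TPlusSer_mem_topForm hH)) (bnd_ser2 _ (coeff_TPlusSer_mem_topForm hH))
  rw [smul_smul, show (cX m n (CDY m n) - cY m n _) * (cX m n _ + cY m n _) =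
    -(cY m n _ * cY m n _ - cX m n _ * cX m n _) by ring, neg_smul, sub_smul, mul_smul,
    mul_smul] at h
  intro a b s t
  have h' := neg_mem (h a b s t)
  rw [coeff2_neg, Matrix.neg_apply, neg_neg] at h'
  exact h'

/-- Here `p p' = (1 - x y)(1 + x y)` is invertible as a series, and its inverse has weight zero
since `x` and `y` have opposite weights. -/
theorem sComm_low_high (hH : ∀ r : ℤ, 0 < r → r ∈ H) (hH' : ∀ r : ℤ, r < 0 → r ∈ H) (a b : ℕ)
    (i j k l : Fin (m + n)) :
    sComm i j k l (PowerSeries.coeff a (conjPart ℓ (TSer m n)) i j)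
      (PowerSeries.coeff b (conjPart ℓ (TPlusSer m n)) k l) ∈
      topForm ℓ H (1 * a + -1 * b + -2) := by
  refine sComm_mem_of_bnd (Bnd.of_one_sub ?_) a b i j k l
  have h := bnd_comm_conjPart (F := form ℓ H) (L := topForm ℓ H) (w := 1) (w' := -1) (s := 0) ℓ
    (isReflectionDatum_low_high (isRTTPair_TSer m n).mixed)
    (isUnit_negVar_TSer m n) (isUnit_negVar_TPlusSer m n)
    (shifts_one.sub ((shifts_cX _ _).mul (shifts_cY _ _))) (shifts_cX _ _)
    (shifts_one.add ((shifts_cX _ _).mul (shifts_cY _ _))) (shifts_cX _ _)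
    (fun _ => topForm_le_form) (fun _ => form_le_topForm)
    (bnd_ser1 _ (coeff_TSer_mem_topForm hH)) (bnd_ser2 _ (coeff_TPlusSer_mem_topForm hH'))
  rw [smul_smul, show (1 - cX m n (CDY m n) * cY m n _) * (1 + cX m n _ * cY m n _) =
    1 - cX m n _ * (cX m n _ * (cY m n _ * cY m n _)) by ring, sub_smul, mul_smul, mul_smul,
    mul_smul, one_smul] at h
  exact h

theorem sComm_neg_left (i j k l : Fin (m + n)) (x y : CDY m n) :
    sComm i j k l (-x) y = -sComm i j k l x y := by simp [sComm]; abel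

theorem sComm_neg_right (i j k l : Fin (m + n)) (x y : CDY m n) :
    sComm i j k l x (-y) = -sComm i j k l x y := by simp [sComm]; abel

/-- The supercommutator of two generators is linear in the generators, up to terms of lower
degree. -/
theorem sComm_genEl_mem (hH : SignClosed H) {g g' : Gen m n} (hg : g.r ∈ H) (hg' : g'.r ∈ H) :
    sComm g.i g.j g'.i g'.j (genEl ℓ g) (genEl ℓ g') ∈
      topForm ℓ H (degTwo g.r + degTwo g'.r) := by
  have key : ∀ g g' : Gen m n, g.r ∈ H → g'.r ∈ H → 0 < g.r → g'.r < 0 →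
      sComm g.i g.j g'.i g'.j (genEl ℓ g) (genEl ℓ g') ∈
        topForm ℓ H (degTwo g.r + degTwo g'.r) := by
    rintro ⟨i, j, r, hr⟩ ⟨k, l, s, hs⟩ hg hg' h h'
    simp only at hg hg' h h' ⊢
    rw [genEl_pos i j hr h, genEl_neg k l hs h', sComm_neg_right]
    have := neg_mem (sComm_low_high (ℓ := ℓ) (hH.pos hg h) (hH.neg hg' h') r.toNat (-s - 1).toNat
      i j k l)
    convert this using 2
    simp only [degTwo]
    rw [if_pos h, if_neg (by lia)]
    lia
  rcases lt_or_gt_of_ne g.hr with h | h <;> rcases lt_or_gt_of_ne g'.hr with h' | h'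
  · obtain ⟨i, j, r, hr⟩ := g
    obtain ⟨k, l, s, hs⟩ := g'
    simp only at hg hg' h h' ⊢
    rw [genEl_neg i j hr h, genEl_neg k l hs h', sComm_neg_right, sComm_neg_left, neg_neg]
    have := sComm_high_high (ℓ := ℓ) (hH.neg hg h) (-r - 1).toNat (-s - 1).toNat i j k l
    convert this using 2
    simp only [degTwo]
    rw [if_neg (by lia), if_neg (by lia)]
    lia
  -- A mixed pair in the opposite order is reduced to the case `key` by the super antisymmetry of
  -- the bracket.
  · rw [sComm_swap, add_comm]
    exact neg_mem (Submodule.smul_mem _ _ (key g' g hg' hg h' h))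
  · exact key g g' hg hg' h h'
  · obtain ⟨i, j, r, hr⟩ := g
    obtain ⟨k, l, s, hs⟩ := g'
    simp only at hg hg' h h' ⊢
    rw [genEl_pos i j hr h, genEl_pos k l hs h']
    have := sComm_low_low (ℓ := ℓ) (hH.pos hg h) r.toNat s.toNat i j k l
    convert this using 2
    simp only [degTwo]
    rw [if_pos h, if_pos h']
    lia

end Form


/-! ### Products, parity twists and evaluation solutions of the RTT relations -/

section Coproduct

set_option linter.unusedSectionVars false

variable {m n : ℕ} {D : Type*} [Ring D] [Algebra ℂ D]

section Product

variable {X X' Y Y' : PowerSeries (Matrix (Fin (m + n)) (Fin (m + n)) D)}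

/-- The entries of all coefficients of `X` supercommute with those of `Y`. -/
def SuperCommutes (X Y : PowerSeries (Matrix (Fin (m + n)) (Fin (m + n)) D)) : Prop :=
  ∀ (a b : ℕ) (i j k l : Fin (m + n)),
    sComm i j k l (PowerSeries.coeff a X i j) (PowerSeries.coeff b Y k l) = 0

theorem SuperCommutes.symm (h : SuperCommutes X Y) : SuperCommutes Y X := by
  intro a b i j k l
  rw [sComm_swap, h, smul_zero, neg_zero]

theorem SuperCommutes.ser_comm (h : SuperCommutes X Y) :
    ser1 m n D X * ser2 m n D Y = ser2 m n D Y * ser1 m n D X := by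
  refine coeff2_ext fun a b => ?_
  rw [coeff2_ser12, coeff2_ser21, ← sub_eq_zero]
  ext ⟨k, i⟩ ⟨l, j⟩
  rw [emb_comm_apply, h, smul_zero, Matrix.zero_apply]

/-- This is the compatibility of the comultiplication `T ↦ T ⊗ T` with the relations. The middle
factors can be interchanged, so `p - q P` passes first through `X`, `X'` and then through `Y`, `Y'`.
-/
theorem RTT.mul {p q : Ser2 m n D} (h : RTT p q X X') (h' : RTT p q Y Y')
    (hc : SuperCommutes X Y') (hc' : SuperCommutes X' Y) : RTT p q (X * Y) (X' * Y') := by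
  rw [RTT] at h h' ⊢
  generalize p - q * cst m n D (permMat m n D) = K at *
  have e1 := hc.ser_comm
  have e2 := hc'.symm.ser_comm
  simp only [map_mul]
  calc K * (ser1 m n D X * ser1 m n D Y * (ser2 m n D X' * ser2 m n D Y'))
      = K * (ser1 m n D X * (ser1 m n D Y * ser2 m n D X') * ser2 m n D Y') := by
        simp only [mul_assoc]
    _ = K * (ser1 m n D X * ser2 m n D X') * ser1 m n D Y * ser2 m n D Y' := by
        rw [e2]; simp only [mul_assoc]
    _ = ser2 m n D X' * ser1 m n D X * (K * (ser1 m n D Y * ser2 m n D Y')) := by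
        rw [h]; simp only [mul_assoc]
    _ = ser2 m n D X' * (ser1 m n D X * ser2 m n D Y') * ser1 m n D Y * K := by
        rw [h']; simp only [mul_assoc]
    _ = _ := by rw [e1]; simp only [mul_assoc]

theorem IsRTTPair.mul (h : IsRTTPair X X') (h' : IsRTTPair Y Y') (h1 : SuperCommutes X Y)
    (h2 : SuperCommutes X Y') (h3 : SuperCommutes X' Y) (h4 : SuperCommutes X' Y') :
    IsRTTPair (X * Y) (X' * Y') where
  low := (rtt_low_low _ _).2 (((rtt_low_low _ _).1 h.low).mul ((rtt_low_low _ _).1 h'.low) h1 h1)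
  high := (rtt_high_high _ _).2
    (((rtt_high_high _ _).1 h.high).mul ((rtt_high_high _ _).1 h'.high) h4 h4)
  mixed := (rtt_low_high _ _).2
    (((rtt_low_high _ _).1 h.mixed).mul ((rtt_low_high _ _).1 h'.mixed) h2 h3)

end Product

section Twist

variable {x y : Fin (m + n) → Fin (m + n) → ℤ → D}

/-- The diagonal matrix with entries `±x`, with the sign of the action of an element of parity
`i + j` on the vector representation. -/
def signDiag (m n : ℕ) (D : Type*) [Ring D] [Algebra ℂ D] (i j : Fin (m + n)) :
    D →ₗ[ℂ] Matrix (Fin (m + n)) (Fin (m + n)) D where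
  toFun x := Matrix.diagonal fun k => ((-1 : ℂ) ^ ((parity i + parity j) * parity k)) • x
  map_add' x y := by rw [Matrix.diagonal_add]; simp only [smul_add]
  map_smul' c x := by
    rw [RingHom.id_apply, ← Matrix.diagonal_smul]
    congr 1
    funext k
    rw [Pi.smul_apply, smul_comm]

theorem signDiag_apply (i j : Fin (m + n)) (x : D) : signDiag m n D i j x =
    Matrix.diagonal fun k => ((-1 : ℂ) ^ ((parity i + parity j) * parity k)) • x := rfl

/-- In a fixed diagonal position the map is the identity or the parity automorphism, and the
relation is homogeneous: all its products have parity `i + j + k + l`. The twist lets ordinary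
matrices over the algebra replace the super tensor product with a matrix superalgebra. -/
theorem coeffRTT_signDiag (h : CoeffRTT x y) :
    CoeffRTT (fun i j p => signDiag m n D i j (x i j p)) (fun i j p => signDiag m n D i j (y i j p)) := by
  intro i j k l p q
  have hmul : ∀ (i j k l i' j' k' l' : Fin (m + n)) (x y : D),
      (∀ z, Even ((parity i + parity j) * z + (parity k + parity l) * z) ↔
        Even ((parity i' + parity j') * z + (parity k' + parity l') * z)) →
      signDiag m n D i j x * signDiag m n D k l y = Matrix.diagonal fun z =>
        ((-1 : ℂ) ^ ((parity i' + parity j') * parity z + (parity k' + parity l') * parity z)) •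
          (x * y) := by
    intro i j k l i' j' k' l' x y hz
    rw [signDiag_apply, signDiag_apply, Matrix.diagonal_mul_diagonal]
    congr 1
    funext z
    rw [smul_mul_smul_comm, ← pow_add, neg_one_pow_congr' (hz _)]
  simp only [sComm]
  rw [hmul i j k l i j k l _ _ fun _ => Iff.rfl, hmul i j k l i j k l _ _ fun _ => Iff.rfl,
    hmul k l i j i j k l _ _ fun _ => by rw [add_comm],
    hmul k l i j i j k l _ _ fun _ => by rw [add_comm],
    hmul k j i l i j k l _ _ fun z => by ring_nf, hmul k j i l i j k l _ _ fun z => by ring_nf]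
  ext a b
  rcases eq_or_ne a b with rfl | hab
  · simp only [Matrix.sub_apply, Matrix.smul_apply, Matrix.diagonal_apply_eq]
    have h' := h i j k l p q
    simp only [sComm] at h'
    rw [← smul_sub, smul_comm _ ((-1 : ℂ) ^ (_ + _ * parity a)),
      smul_comm _ ((-1 : ℂ) ^ (_ + _ * parity a)),
      smul_comm _ ((-1 : ℂ) ^ (_ + _ * parity a)), ← smul_sub, ← smul_sub, ← smul_sub, h']
  · simp [Matrix.diagonal_apply_ne _ hab]

/-- Entrywise application of `signDiag`. -/
def twistSer (X : PowerSeries (Matrix (Fin (m + n)) (Fin (m + n)) D)) :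
    PowerSeries (Matrix (Fin (m + n)) (Fin (m + n)) (Matrix (Fin (m + n)) (Fin (m + n)) D)) :=
  PowerSeries.mk fun a => Matrix.of fun i j => signDiag m n D i j (PowerSeries.coeff a X i j)

theorem coeff_twistSer (X : PowerSeries (Matrix (Fin (m + n)) (Fin (m + n)) D)) (a : ℕ)
    (i j : Fin (m + n)) : PowerSeries.coeff a (twistSer X) i j =
      signDiag m n D i j (PowerSeries.coeff a X i j) := by
  rw [twistSer, PowerSeries.coeff_mk, Matrix.of_apply]

theorem IsRTTPair.twist {X Y : PowerSeries (Matrix (Fin (m + n)) (Fin (m + n)) D)}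
    (h : IsRTTPair X Y) : IsRTTPair (twistSer X) (twistSer Y) := by
  have e1 : lowCoeff (twistSer X) = fun i j p => signDiag m n D i j (lowCoeff X i j p) := by
    funext i j p
    simp only [lowCoeff, coeff_twistSer]
    split_ifs <;> simp
  have e2 : highCoeff (twistSer Y) = fun i j p => signDiag m n D i j (highCoeff Y i j p) := by
    funext i j p
    simp only [highCoeff, coeff_twistSer]
    split_ifs <;> simp
  exact ⟨by rw [e1]; exact coeffRTT_signDiag h.low, by rw [e2]; exact coeffRTT_signDiag h.high,
    by rw [e1, e2]; exact coeffRTT_signDiag h.mixed⟩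

theorem twistSer_coeff_zero {X : PowerSeries (Matrix (Fin (m + n)) (Fin (m + n)) D)}
    (h : PowerSeries.coeff 0 X = 1) : PowerSeries.coeff 0 (twistSer X) = 1 := by
  ext i j : 1
  ext k l
  rw [coeff_twistSer, h, signDiag_apply, Matrix.one_apply, Matrix.one_apply]
  rcases eq_or_ne i j with rfl | hij
  · rw [if_pos rfl, if_pos rfl, Matrix.one_apply, Matrix.diagonal_apply]
    rw [← two_mul, mul_assoc, Even.neg_one_pow (even_two_mul _), one_smul]
  · simp [hij]

theorem coeff_zero_tSer : PowerSeries.coeff 0 (tSer m n) = 1 := by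
  ext i j
  rw [tSer, PowerSeries.coeff_mk, Matrix.of_apply, Nat.cast_zero, DY0.t, freeT,
    dif_neg (by simp), Matrix.one_apply]
  split_ifs <;> simp

/-- The homomorphism which sends an element `x` to the diagonal matrix with the entries `±x`. -/
def iotaHom (m n : ℕ) : DY0 m n →ₐ[ℂ] Matrix (Fin (m + n)) (Fin (m + n)) (DY0 m n) :=
  DY0.lift (isRTTPair_tSer m n).twist (twistSer_coeff_zero coeff_zero_tSer)

theorem mapSer_iotaHom_tSer : mapSer (iotaHom m n) (tSer m n) = twistSer (tSer m n) :=
  mapSer_lift_tSer _ _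

theorem mapSer_iotaHom_tPlusSer : mapSer (iotaHom m n) (tPlusSer m n) = twistSer (tPlusSer m n) :=
  mapSer_lift_tPlusSer _ _

theorem iotaHom_t (i j : Fin (m + n)) (r : ℤ) (hr : r ≠ 0) :
    iotaHom m n (DY0.t i j r) = signDiag m n _ i j (DY0.t i j r) := by
  rcases lt_or_gt_of_ne hr with h | h
  · have h1 := coeff_mapSer (iotaHom m n) (tPlusSer m n) (-r - 1).toNat i j
    rw [mapSer_iotaHom_tPlusSer, coeff_twistSer, tPlusSer, PowerSeries.coeff_mk, Matrix.of_apply,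
      show -(((-r - 1).toNat : ℤ) + 1) = r by lia, map_sub, map_sub] at h1
    split_ifs at h1
    · have h2 := coeff_mapSer (iotaHom m n) (tSer m n) 0 i j
      rw [mapSer_iotaHom_tSer, coeff_twistSer, tSer, PowerSeries.coeff_mk, Matrix.of_apply,
        Nat.cast_zero] at h2
      rw [h2] at h1
      exact (sub_right_injective h1).symm
    · simpa using h1.symm
  · have h1 := coeff_mapSer (iotaHom m n) (tSer m n) r.toNat i j
    rw [mapSer_iotaHom_tSer, coeff_twistSer, tSer, PowerSeries.coeff_mk, Matrix.of_apply,
      show (r.toNat : ℤ) = r by lia] at h1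
    exact h1.symm

end Twist

section Evaluation

/-- The image of the generator `E_{ij}` in the (twisted) vector representation. -/
def evalMat (m n : ℕ) (D : Type*) [Ring D] [Algebra ℂ D] (i j : Fin (m + n)) :
    Matrix (Fin (m + n)) (Fin (m + n)) D :=
  Matrix.single j i ((-(-1 : ℂ) ^ (parity i * parity j)) • 1)

theorem evalMat_mul (i j k l : Fin (m + n)) : evalMat m n D i j * evalMat m n D k l =
    if i = l then ((-1 : ℂ) ^ (parity i * parity j + parity k * parity l)) •
      (Matrix.single j k 1 : Matrix (Fin (m + n)) (Fin (m + n)) D) else 0 := by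
  rw [evalMat, evalMat]
  split_ifs with h
  · subst h
    rw [Matrix.single_mul_single_same, smul_mul_smul_comm, one_mul, Matrix.smul_single, pow_add]
    congr 2
    ring
  · rw [Matrix.single_mul_single_of_ne _ _ _ _ h]

/-- These are the relations of `gl_{m|n}` with the signs of the RTT presentation. The transposition
and the sign in `evalMat` are chosen to match them. -/
theorem sComm_evalMat (i j k l : Fin (m + n)) :
    sComm i j k l (evalMat m n D i j) (evalMat m n D k l) =
      ((-1 : ℂ) ^ (parity i * parity j + parity i * parity k + parity j * parity k)) •
        ((if k = j then evalMat m n D i l else 0) - if i = l then evalMat m n D k j else 0) := by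
  have e : ∀ i j : Fin (m + n), evalMat m n D i j = (-(-1 : ℂ) ^ (parity i * parity j)) •
      (Matrix.single j i 1 : Matrix (Fin (m + n)) (Fin (m + n)) D) := fun i j => by
    rw [evalMat, Matrix.smul_single]
  rw [sComm, evalMat_mul, evalMat_mul, smul_sub, sub_eq_add_neg, sub_eq_add_neg]
  refine (add_comm _ _).trans ?_
  congr 1
  · split_ifs with h
    · subst h
      rw [e, smul_smul, smul_smul, ← neg_smul, mul_neg, ← pow_add, ← pow_add]
      congr 2
      apply neg_one_pow_congr'
      by_cases hi : Even (parity i) <;> by_cases hl : Even (parity l) <;>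
        by_cases hk : Even (parity k) <;>
        simp only [Nat.even_add, Nat.even_mul, hi, hl, hk] <;> decide
    · simp
  · split_ifs with h
    · subst h
      rw [e, smul_smul, ← neg_smul, mul_neg, neg_neg, ← pow_add]
      congr 1
      apply neg_one_pow_congr'
      by_cases hi : Even (parity i) <;> by_cases hj : Even (parity j) <;>
        by_cases hk : Even (parity k) <;>
        simp only [Nat.even_add, Nat.even_mul, hi, hj, hk] <;> decide
    · simp

/-- Moving `e_{lk}` past the diagonal matrix compares its entries in the positions `l` and `k`.
Their ratio `(-1)^{(i+j)(k+l)}` is the sign in the supercommutator, so the two tensor factors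
supercommute. -/
theorem sComm_signDiag_evalMat (i j k l : Fin (m + n)) (x : D) :
    sComm i j k l (signDiag m n D i j x) (evalMat m n D k l) = 0 := by
  have e : evalMat m n D k l = (-(-1 : ℂ) ^ (parity k * parity l)) •
      (Matrix.single l k 1 : Matrix (Fin (m + n)) (Fin (m + n)) D) := by
    rw [evalMat, Matrix.smul_single]
  rw [sComm, e, mul_smul_comm, smul_mul_assoc, smul_comm _ (-(-1 : ℂ) ^ (parity k * parity l)),
    ← smul_sub, sub_eq_zero.2, smul_zero]
  ext a b
  rw [Matrix.smul_apply, signDiag_apply, Matrix.diagonal_mul, Matrix.mul_diagonal]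
  by_cases h : l = a ∧ k = b
  · obtain ⟨rfl, rfl⟩ := h
    rw [Matrix.single_apply_same, mul_one, one_mul, smul_smul, ← pow_add]
    congr 1
    apply neg_one_pow_congr'
    by_cases hi : Even (parity i) <;> by_cases hj : Even (parity j) <;>
      by_cases hk : Even (parity k) <;> by_cases hl : Even (parity l) <;>
      simp only [Nat.even_add, Nat.even_mul, hi, hj, hk, hl] <;> decide
  · rw [Matrix.single_apply_of_ne _ _ _ _ _ h, mul_zero, zero_mul, smul_zero]

theorem sComm_scalar_left (i j k l : Fin (m + n)) (p : ℤ) (y : D) :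
    sComm i j k l (if p = 0 then if i = j then 1 else 0 else 0) y = 0 := by
  rw [sComm]
  split_ifs with h h'
  · subst h'
    rw [one_mul, mul_one, Even.neg_one_pow (Even.mul_right ⟨_, rfl⟩ _), one_smul, sub_self]
  all_goals simp

theorem sComm_scalar_right (i j k l : Fin (m + n)) (p : ℤ) (y : D) :
    sComm i j k l y (if p = 0 then if k = l then 1 else 0 else 0) = 0 := by
  rw [sComm_swap, sComm_scalar_left, smul_zero, neg_zero]

theorem sComm_add_left (i j k l : Fin (m + n)) (x x' y : D) :
    sComm i j k l (x + x') y = sComm i j k l x y + sComm i j k l x' y := by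
  simp only [sComm, add_mul, mul_add, smul_add]
  abel

theorem sComm_add_right (i j k l : Fin (m + n)) (x y y' : D) :
    sComm i j k l x (y + y') = sComm i j k l x y + sComm i j k l x y' := by
  simp only [sComm, add_mul, mul_add, smul_add]
  abel

theorem sComm_central_mul (i j k l : Fin (m + n)) {f g : D} (hf : ∀ z, Commute f z)
    (hg : ∀ z, Commute g z) (x y : D) :
    sComm i j k l (f * x) (g * y) = f * g * sComm i j k l x y := by
  rw [sComm, sComm, mul_sub, mul_smul_comm]
  congr 1
  · rw [mul_assoc, ← mul_assoc x, ← (hg x).eq]; simp only [mul_assoc]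
  · congr 1
    rw [mul_assoc, ← mul_assoc y, ← (hf y).eq, ← mul_assoc, ← mul_assoc, (hf g).eq]
    simp only [mul_assoc]

/-- Evaluation solutions `δ_{ij} + f(u) E_{ij}`. The condition `hfg` is `(u - v) f(u) g(v) = g(v) -
f(u)` read off at `u^p v^q`. It holds when `f` and `g` are expansions of `1/(u - T)` and `1/(v -
T)`; the quadratic terms on the right then match the commutator. -/
theorem coeffRTT_of_eval {e : Fin (m + n) → Fin (m + n) → D} {f g : ℤ → D}
    (he : ∀ i j k l, sComm i j k l (e i j) (e k l) =
      ((-1 : ℂ) ^ (parity i * parity j + parity i * parity k + parity j * parity k)) •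
        ((if k = j then e i l else 0) - if i = l then e k j else 0))
    (hf : ∀ p z, Commute (f p) z) (hg : ∀ p z, Commute (g p) z)
    (hfg : ∀ p q, f (p - 1) * g q - f p * g (q - 1) =
      (if p = 0 then g q else 0) - if q = 0 then f p else 0) :
    CoeffRTT (fun i j p => (if p = 0 then if i = j then 1 else 0 else 0) + f p * e i j)
      (fun i j p => (if p = 0 then if i = j then 1 else 0 else 0) + g p * e i j) := by
  intro i j k l p q
  simp only [sComm_add_left, sComm_add_right, sComm_scalar_left, sComm_scalar_right, zero_add]
  rw [sComm_central_mul _ _ _ _ (hf _) (hg _), sComm_central_mul _ _ _ _ (hf _) (hg _), ← sub_mul,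
    hfg, he, mul_smul_comm]
  congr 1
  have h1 : f p * e k j * (g q * e i l) = f p * g q * (e k j * e i l) := by
    rw [mul_assoc, ← mul_assoc (e k j), ← (hg q (e k j)).eq]; simp only [mul_assoc]
  have h2 : g q * e k j * (f p * e i l) = f p * g q * (e k j * e i l) := by
    rw [mul_assoc, ← mul_assoc (e k j), ← (hf p (e k j)).eq, ← mul_assoc, ← mul_assoc,
      ← (hf p (g q)).eq]
    simp only [mul_assoc]
  simp only [mul_add, add_mul, sub_mul, mul_sub, h1, h2]
  by_cases hp : p = 0 <;> by_cases hq : q = 0 <;> by_cases hk : k = j <;> by_cases hi : i = l <;>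
    simp only [hp, hq, hk, hi, if_true, if_false, one_mul, mul_one, zero_mul, mul_zero] <;> abel

end Evaluation

end Coproduct


/-! ### Comultiplication followed by evaluation at the point T -/

section Comultiplication

set_option linter.unusedSectionVars false

variable {m n : ℕ} {d e k k' : ℤ}

/-- Laurent polynomials with coefficients in the matrices over the double Yangian. -/
abbrev LauMat (m n : ℕ) : Type :=
  LaurentPolynomial (Matrix (Fin (m + n)) (Fin (m + n)) (DY0 m n))

/-- Power series over the matrices over the double Yangian. -/
abbrev DYSer (m n : ℕ) : Type := PowerSeries (Matrix (Fin (m + n)) (Fin (m + n)) (DY0 m n))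

/-- Power series over the matrices over `LauMat m n`. -/
abbrev LauSer (m n : ℕ) : Type := PowerSeries (Matrix (Fin (m + n)) (Fin (m + n)) (LauMat m n))

/-- The embedding of the constant Laurent polynomials. -/
def constHom (m n : ℕ) : Matrix (Fin (m + n)) (Fin (m + n)) (DY0 m n) →ₐ[ℂ] LauMat m n :=
  AddMonoidAlgebra.singleZeroAlgHom

theorem constHom_apply (M : Matrix (Fin (m + n)) (Fin (m + n)) (DY0 m n)) :
    constHom m n M = AddMonoidAlgebra.single 0 M := rfl

theorem constHom_sComm (i j k l : Fin (m + n))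
    (x y : Matrix (Fin (m + n)) (Fin (m + n)) (DY0 m n)) :
    sComm i j k l (constHom m n x) (constHom m n y) = constHom m n (sComm i j k l x y) := by
  simp only [sComm, map_sub, map_mul, map_smul]

/-- The series with the coefficients `f a E_{ij}` in the vector representation. -/
def evalSer (f : ℕ → LauMat m n) :
    LauSer m n :=
  PowerSeries.mk fun a => Matrix.of fun i j => f a * constHom m n (evalMat m n _ i j)

theorem coeff_evalSer (f : ℕ → LauMat m n) (a : ℕ) (i j : Fin (m + n)) :
    PowerSeries.coeff a (evalSer f) i j = f a * constHom m n (evalMat m n _ i j) := by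
  rw [evalSer, PowerSeries.coeff_mk, Matrix.of_apply]

theorem coeff_one_add_evalSer (f : ℕ → LauMat m n) (a : ℕ) (i j : Fin (m + n)) :
    PowerSeries.coeff a (1 + evalSer f : LauSer m n) i j =
      (if (a : ℤ) = 0 then if i = j then 1 else 0 else 0) +
        f a * constHom m n (evalMat m n _ i j) := by
  rw [map_add, Matrix.add_apply, coeff_evalSer, PowerSeries.coeff_one]
  congr 1
  by_cases h : a = 0 <;> simp [h, Matrix.one_apply]

theorem superCommutes_evalSer (X : DYSer m n)
    {f : ℕ → LauMat m n} (hf : ∀ a z, Commute (f a) z) :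
    SuperCommutes (mapSer (constHom m n) (twistSer X)) (1 + evalSer f) := by
  intro a b i j k l
  rw [coeff_one_add_evalSer, sComm_add_right, sComm_scalar_right, zero_add, coeff_mapSer,
    coeff_twistSer, ← one_mul (constHom m n (signDiag m n _ i j _)),
    sComm_central_mul _ _ _ _ (fun z => Commute.one_left z) (hf b), constHom_sComm,
    sComm_signDiag_evalMat, map_zero, mul_zero]

/-- The coefficients of `1 / (u - T)` expanded in `u⁻¹`. -/
def lowGeom (m n : ℕ) (a : ℕ) : LauMat m n :=
  if a = 0 then 0 else LaurentPolynomial.T ((a : ℤ) - 1)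

/-- The coefficients of `1 / (u - T)` expanded in `u`. -/
def highGeom (m n : ℕ) (a : ℕ) : LauMat m n := -LaurentPolynomial.T (-(a : ℤ) - 1)

theorem lowGeom_commute (a : ℕ) (z : LauMat m n) : Commute (lowGeom m n a) z := by
  rw [lowGeom]
  split_ifs
  · exact Commute.zero_left z
  · exact LaurentPolynomial.commute_T _ z

theorem highGeom_commute (a : ℕ) (z : LauMat m n) : Commute (highGeom m n a) z :=
  (LaurentPolynomial.commute_T _ z).neg_left

/-- The identity `(u - v)/((u - T)(v - T)) = 1/(v - T) - 1/(u - T)`, coefficientwise, with both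
fractions expanded at infinity. The next two lemmas treat the other choices of expansions. -/
theorem geom_low_low {R : Type*} [Ring R] {T : ℤ → R} (hT : ∀ a b, T (a + b) = T a * T b)
    (p q : ℤ) :
    (if p - 1 ≤ -1 then T (-(p - 1) - 1) else 0) * (if q ≤ -1 then T (-q - 1) else 0) -
      (if p ≤ -1 then T (-p - 1) else 0) * (if q - 1 ≤ -1 then T (-(q - 1) - 1) else 0) =
    (if p = 0 then (if q ≤ -1 then T (-q - 1) else 0) else 0) -
      if q = 0 then (if p ≤ -1 then T (-p - 1) else 0) else 0 := by
  simp only [mul_ite, ite_mul, zero_mul, mul_zero, ← hT]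
  split_ifs <;> first
    | (exfalso; lia)
    | (subst_vars; ring_nf; done)
    | (subst_vars; abel)

theorem geom_high_high {R : Type*} [Ring R] {T : ℤ → R} (hT : ∀ a b, T (a + b) = T a * T b)
    (p q : ℤ) :
    (if 0 ≤ p - 1 then -T (-(p - 1) - 1) else 0) * (if 0 ≤ q then -T (-q - 1) else 0) -
      (if 0 ≤ p then -T (-p - 1) else 0) * (if 0 ≤ q - 1 then -T (-(q - 1) - 1) else 0) =
    (if p = 0 then (if 0 ≤ q then -T (-q - 1) else 0) else 0) -
      if q = 0 then (if 0 ≤ p then -T (-p - 1) else 0) else 0 := by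
  simp only [mul_ite, ite_mul, zero_mul, mul_zero, mul_neg, neg_mul, ← hT]
  split_ifs <;> first
    | (exfalso; lia)
    | (subst_vars; ring_nf; done)
    | (subst_vars; abel)

theorem geom_low_high {R : Type*} [Ring R] {T : ℤ → R} (hT : ∀ a b, T (a + b) = T a * T b)
    (p q : ℤ) :
    (if p - 1 ≤ -1 then T (-(p - 1) - 1) else 0) * (if 0 ≤ q then -T (-q - 1) else 0) -
      (if p ≤ -1 then T (-p - 1) else 0) * (if 0 ≤ q - 1 then -T (-(q - 1) - 1) else 0) =
    (if p = 0 then (if 0 ≤ q then -T (-q - 1) else 0) else 0) -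
      if q = 0 then (if p ≤ -1 then T (-p - 1) else 0) else 0 := by
  simp only [mul_ite, ite_mul, zero_mul, mul_zero, mul_neg, ← hT]
  split_ifs <;> first
    | (exfalso; lia)
    | (subst_vars; ring_nf; done)
    | (subst_vars; abel)

theorem isRTTPair_geom (m n : ℕ) :
    IsRTTPair (1 + evalSer (lowGeom m n)) (1 + evalSer (highGeom m n)) := by
  set f : ℤ → LauMat m n := fun p => if p ≤ -1 then LaurentPolynomial.T (-p - 1) else 0 with hf
  set g : ℤ → LauMat m n := fun p => if 0 ≤ p then -LaurentPolynomial.T (-p - 1) else 0 with hg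
  have e1 : lowCoeff (1 + evalSer (lowGeom m n)) = fun i j p =>
      (if p = 0 then if i = j then 1 else 0 else 0) + f p * constHom m n (evalMat m n _ i j) := by
    funext i j p
    rw [lowCoeff]
    by_cases h : p ≤ 0
    · rw [if_pos h, coeff_one_add_evalSer]
      congr 1
      · exact if_congr (by lia) rfl rfl
      · rw [lowGeom, hf]
        by_cases hp : p = 0
        · simp [hp]
        · simp only
          rw [if_neg (by lia), if_pos (by lia), Int.toNat_of_nonneg (by lia)]
    · rw [if_neg h, if_neg (by lia), hf]
      simp only
      rw [if_neg (by lia), zero_mul, add_zero]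
  have e2 : highCoeff (1 + evalSer (highGeom m n)) = fun i j p =>
      (if p = 0 then if i = j then 1 else 0 else 0) + g p * constHom m n (evalMat m n _ i j) := by
    funext i j p
    rw [highCoeff]
    by_cases h : 0 ≤ p
    · rw [if_pos h, coeff_one_add_evalSer]
      congr 1
      · exact if_congr (by lia) rfl rfl
      · simp only [highGeom, hg]
        rw [if_pos h, Int.toNat_of_nonneg h]
    · rw [if_neg h, if_neg (by lia), hg]
      simp only
      rw [if_neg h, zero_mul, add_zero]
  have hfc : ∀ p z, Commute (f p) z := fun p z => by
    simp only [hf]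
    split_ifs
    · exact LaurentPolynomial.commute_T _ z
    · exact Commute.zero_left z
  have hgc : ∀ p z, Commute (g p) z := fun p z => by
    simp only [hg]
    split_ifs
    · exact (LaurentPolynomial.commute_T _ z).neg_left
    · exact Commute.zero_left z
  have he : ∀ i j k l, sComm i j k l (constHom m n (evalMat m n _ i j))
      (constHom m n (evalMat m n _ k l)) =
      ((-1 : ℂ) ^ (parity i * parity j + parity i * parity k + parity j * parity k)) •
        ((if k = j then constHom m n (evalMat m n _ i l) else 0) -
          if i = l then constHom m n (evalMat m n _ k j) else 0) := by
    intro i j k l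
    rw [constHom_sComm, sComm_evalMat, map_smul, map_sub]
    split_ifs <;> simp
  exact ⟨by rw [e1]; exact coeffRTT_of_eval he hfc hfc (geom_low_low LaurentPolynomial.T_add),
    by rw [e2]; exact coeffRTT_of_eval he hgc hgc (geom_high_high LaurentPolynomial.T_add),
    by rw [e1, e2]; exact coeffRTT_of_eval he hfc hgc (geom_low_high LaurentPolynomial.T_add)⟩

/-- The composition of the comultiplication with the evaluation of the second factor at the point
`T` in the vector representation. -/
def evalComul (m n : ℕ) : DY0 m n →ₐ[ℂ] LauMat m n :=
  DY0.lift (((isRTTPair_tSer m n).twist.map (constHom m n)).mul (isRTTPair_geom m n)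
    (superCommutes_evalSer _ lowGeom_commute) (superCommutes_evalSer _ highGeom_commute)
    (superCommutes_evalSer _ lowGeom_commute) (superCommutes_evalSer _ highGeom_commute)) (by
      have h1 : PowerSeries.coeff 0 (mapSer (constHom m n) (twistSer (tSer m n))) = 1 := by
        ext i j : 1
        rw [coeff_mapSer, twistSer_coeff_zero coeff_zero_tSer, Matrix.one_apply, Matrix.one_apply]
        split_ifs <;> simp
      have h2 : PowerSeries.coeff 0 (1 + evalSer (lowGeom m n) : LauSer m n) = 1 := by
        ext i j : 1
        rw [coeff_one_add_evalSer, lowGeom, if_pos rfl, zero_mul, add_zero, Matrix.one_apply]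
        simp
      rw [PowerSeries.coeff_zero_eq_constantCoeff_apply] at h1 h2 ⊢
      rw [map_mul, h1, h2, one_mul])

theorem mapSer_evalComul_tSer : mapSer (evalComul m n) (tSer m n) =
    mapSer (constHom m n) (twistSer (tSer m n)) * (1 + evalSer (lowGeom m n)) :=
  mapSer_lift_tSer _ _

theorem mapSer_evalComul_tPlusSer : mapSer (evalComul m n) (tPlusSer m n) =
    mapSer (constHom m n) (twistSer (tPlusSer m n)) * (1 + evalSer (highGeom m n)) :=
  mapSer_lift_tPlusSer _ _

theorem t_zero_eq (i j : Fin (m + n)) :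
    DY0.t i j 0 = (1 : Matrix (Fin (m + n)) (Fin (m + n)) (DY0 m n)) i j := by
  rw [DY0.t, freeT, dif_neg (by simp), Matrix.one_apply]
  split_ifs <;> simp

theorem coeff_tSer_sub_one (a : ℕ) (i j : Fin (m + n)) :
    PowerSeries.coeff a (tSer m n - 1 : DYSer m n) i j = if a = 0 then 0 else DY0.t i j (a : ℤ) := by
  rw [map_sub, tSer, PowerSeries.coeff_mk, Matrix.sub_apply, Matrix.of_apply,
    PowerSeries.coeff_one]
  split_ifs with h
  · rw [h, Nat.cast_zero, t_zero_eq, sub_self]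
  · rw [Matrix.zero_apply, sub_zero]

theorem coeff_tPlusSer_sub_one (a : ℕ) (i j : Fin (m + n)) :
    PowerSeries.coeff a (tPlusSer m n - 1 : DYSer m n) i j = -DY0.t i j (-((a : ℤ) + 1)) := by
  rw [map_sub, tPlusSer, PowerSeries.coeff_mk, Matrix.sub_apply, Matrix.of_apply,
    PowerSeries.coeff_one]
  split_ifs with h
  · rw [t_zero_eq]
    abel
  · rw [Matrix.zero_apply, sub_zero, zero_sub]

end Comultiplication

/-! ### Skew derivations that delete one generator -/

section Derivations

set_option linter.unusedSectionVars false

variable {m n : ℕ} {d e k k' : ℤ}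

/-- The monomial in the generators given by a word. -/
def tWord (w : List (Gen m n)) : DY0 m n := (w.map fun g => DY0.t g.i g.j g.r).prod

@[simp] theorem tWord_nil : tWord ([] : List (Gen m n)) = 1 := rfl

@[simp] theorem tWord_cons (g : Gen m n) (w : List (Gen m n)) :
    tWord (g :: w) = DY0.t g.i g.j g.r * tWord w := by simp [tWord]

@[simp] theorem tWord_append (v w : List (Gen m n)) : tWord (v ++ w) = tWord v * tWord w := by
  simp [tWord]

theorem tWord_mem (w : List (Gen m n)) (h : wordDeg w ≤ d) : tWord w ∈ DY0.filt m n d :=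
  Submodule.subset_span ⟨w, h, rfl⟩

/-- The span of the monomials of degree `d` and length at most `k` and the elements of smaller
degree. -/
def shortFilt (m n : ℕ) (k d : ℤ) : Submodule ℂ (DY0 m n) :=
  Submodule.span ℂ {x | ∃ w : List (Gen m n), (w.length : ℤ) ≤ k ∧ wordDeg w = d ∧ x = tWord w} ⊔
    DY0.filt m n (d - 1)

theorem shortFilt_mono (h : k ≤ k') : shortFilt m n k d ≤ shortFilt m n k' d :=
  sup_le_sup_right (Submodule.span_mono (by
    rintro _ ⟨w, hw, hd, rfl⟩
    exact ⟨w, hw.trans h, hd, rfl⟩)) _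

theorem shortFilt_le_filt : shortFilt m n k d ≤ DY0.filt m n d :=
  sup_le (Submodule.span_le.2 (by rintro _ ⟨w, -, hd, rfl⟩; exact tWord_mem w hd.le))
    (DY0.filt_mono (by lia))

theorem filt_le_shortFilt (h : d < e) : DY0.filt m n d ≤ shortFilt m n k e :=
  (DY0.filt_mono (by lia)).trans le_sup_right

theorem tWord_mem_shortFilt {w : List (Gen m n)} (h : (w.length : ℤ) ≤ k) (hd : wordDeg w = d) :
    tWord w ∈ shortFilt m n k d :=
  Submodule.mem_sup_left (Submodule.subset_span ⟨w, h, hd, rfl⟩)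

theorem one_mem_shortFilt : (1 : DY0 m n) ∈ shortFilt m n 0 0 :=
  tWord_mem_shortFilt (w := []) le_rfl rfl

theorem mul_mem_shortFilt {x y : DY0 m n} (hx : x ∈ shortFilt m n k d)
    (hy : y ∈ shortFilt m n k' e) : x * y ∈ shortFilt m n (k + k') (d + e) := by
  have hx' := shortFilt_le_filt hx
  have hy' := shortFilt_le_filt hy
  obtain ⟨x, h1, x', h2, rfl⟩ := Submodule.mem_sup.1 hx
  obtain ⟨y, h3, y', h4, rfl⟩ := Submodule.mem_sup.1 hy
  rw [add_mul, mul_add, add_assoc]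
  refine add_mem (Submodule.mem_sup_left ?_) (add_mem ?_ ?_)
  · have h := Submodule.mul_mem_mul h1 h3
    rw [Submodule.span_mul_span] at h
    refine Submodule.span_mono ?_ h
    rintro _ ⟨_, ⟨v, hv, rfl, rfl⟩, _, ⟨w, hw, rfl, rfl⟩, rfl⟩
    exact ⟨v ++ w, by rw [List.length_append]; push_cast; lia, by simp, by simp⟩
  · have hx1 : x ∈ DY0.filt m n d := by
      simpa using sub_mem hx' (DY0.filt_mono (by lia) h2)
    refine filt_le_shortFilt (d := d + e - 1) (by lia) ?_
    rw [add_sub_assoc]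
    exact SetLike.mul_mem_graded (A := DY0.filt m n) hx1 h4
  · refine filt_le_shortFilt (d := d - 1 + e) (by lia) ?_
    exact SetLike.mul_mem_graded (A := DY0.filt m n) h2 hy'

/-- The span of the monomials `M T ^ s` such that the entries of `M` belong to
`shortFilt m n k (d - s)`. -/
def lauFilt (m n : ℕ) (k d : ℤ) : Submodule ℂ (LauMat m n) :=
  Submodule.span ℂ {y | ∃ (s : ℤ) (M : Matrix (Fin (m + n)) (Fin (m + n)) (DY0 m n)),
    (∀ i j, M i j ∈ shortFilt m n k (d - s)) ∧ y = AddMonoidAlgebra.single s M}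

theorem single_mem_lauFilt {s : ℤ} {M : Matrix (Fin (m + n)) (Fin (m + n)) (DY0 m n)}
    (h : ∀ i j, M i j ∈ shortFilt m n k (d - s)) :
    AddMonoidAlgebra.single s M ∈ lauFilt m n k d :=
  Submodule.subset_span ⟨s, M, h, rfl⟩

theorem lauFilt_mono (h : k ≤ k') : lauFilt m n k d ≤ lauFilt m n k' d :=
  Submodule.span_mono fun _ ⟨s, M, hM, hy⟩ => ⟨s, M, fun i j => shortFilt_mono h (hM i j), hy⟩

/-- A drop in degree makes the bound on the length irrelevant: elements of lower degree lie in
`shortFilt` for every length, including negative ones, where nothing else is left. -/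
theorem lauFilt_le (h : d < e) : lauFilt m n k d ≤ lauFilt m n k' e :=
  Submodule.span_mono fun _ ⟨s, M, hM, hy⟩ =>
    ⟨s, M, fun i j => filt_le_shortFilt (d := d - s) (by lia) (shortFilt_le_filt (hM i j)), hy⟩

theorem mul_mem_lauFilt {x y : LauMat m n} (hx : x ∈ lauFilt m n k d)
    (hy : y ∈ lauFilt m n k' e) : x * y ∈ lauFilt m n (k + k') (d + e) := by
  have h := Submodule.mul_mem_mul hx hy
  rw [lauFilt, lauFilt, Submodule.span_mul_span] at h
  refine Submodule.span_mono ?_ h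
  rintro _ ⟨_, ⟨s, M, hM, rfl⟩, _, ⟨s', M', hM', rfl⟩, rfl⟩
  refine ⟨s + s', M * M', fun i j => ?_, AddMonoidAlgebra.single_mul_single ..⟩
  rw [Matrix.mul_apply]
  refine sum_mem fun a _ => ?_
  rw [show d + e - (s + s') = (d - s) + (e - s') by ring]
  exact mul_mem_shortFilt (hM i a) (hM' a j)

/-- An entry of a coefficient of a Laurent polynomial. -/
def lauEntry (s : ℤ) (i j : Fin (m + n)) : LauMat m n →ₗ[ℂ] DY0 m n where
  toFun y := y.coeff s i j
  map_add' x y := by rw [AddMonoidAlgebra.coeff_add, Finsupp.add_apply, Matrix.add_apply]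
  map_smul' c x := by
    rw [AddMonoidAlgebra.coeff_smul_apply, Matrix.smul_apply, RingHom.id_apply]

theorem lauEntry_single (s s' : ℤ) (i j : Fin (m + n))
    (M : Matrix (Fin (m + n)) (Fin (m + n)) (DY0 m n)) :
    lauEntry s i j (AddMonoidAlgebra.single s' M) = if s' = s then M i j else 0 := by
  change ((AddMonoidAlgebra.single s' M : LauMat m n).coeff s) i j = _
  rw [AddMonoidAlgebra.coeff_single_apply]
  split_ifs <;> rfl

theorem lauEntry_mem {y : LauMat m n} (hy : y ∈ lauFilt m n k d) (s : ℤ) (i j : Fin (m + n)) :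
    lauEntry s i j y ∈ shortFilt m n k (d - s) := by
  have h : lauFilt m n k d ≤ (shortFilt m n k (d - s)).comap (lauEntry s i j) := by
    refine Submodule.span_le.2 ?_
    rintro _ ⟨s', M, hM, rfl⟩
    rw [SetLike.mem_coe, Submodule.mem_comap, lauEntry_single]
    split_ifs with h
    · exact h ▸ hM i j
    · exact zero_mem _
  exact h hy

theorem lauEntry_diagonal_mul (s : ℤ) (i j : Fin (m + n)) (c : Fin (m + n) → DY0 m n)
    (y : LauMat m n) :
    lauEntry s i j (constHom m n (Matrix.diagonal c) * y) = c i * lauEntry s i j y := by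
  change ((AddMonoidAlgebra.single 0 (Matrix.diagonal c) * y : LauMat m n).coeff s) i j = _
  rw [AddMonoidAlgebra.coeff_single_zero_mul, Matrix.diagonal_mul]
  rfl

/-- The sign of the action of a generator on a basis vector. -/
def genSign (g : Gen m n) (i : Fin (m + n)) : ℂ :=
  (-1) ^ ((parity g.i + parity g.j) * parity i)

/-- The sign of the action of a monomial on a basis vector. -/
def wordSign (w : List (Gen m n)) (i : Fin (m + n)) : ℂ := (w.map fun g => genSign g i).prod

theorem iotaHom_gen (g : Gen m n) : iotaHom m n (DY0.t g.i g.j g.r) =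
    Matrix.diagonal fun i => genSign g i • DY0.t g.i g.j g.r := by
  rw [iotaHom_t _ _ _ g.hr, signDiag_apply]
  rfl

theorem iotaHom_tWord (w : List (Gen m n)) :
    iotaHom m n (tWord w) = Matrix.diagonal fun i => wordSign w i • tWord w := by
  induction w with
  | nil => simp [wordSign, Matrix.diagonal_one]
  | cons g w ih =>
    rw [tWord_cons, map_mul, ih, iotaHom_gen, Matrix.diagonal_mul_diagonal]
    congr 1
    funext i
    rw [smul_mul_smul_comm]
    congr 1

theorem constHom_iotaHom_tWord_mem (w : List (Gen m n)) :
    constHom m n (iotaHom m n (tWord w)) ∈ lauFilt m n w.length (wordDeg w) := by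
  refine single_mem_lauFilt fun i j => ?_
  rw [iotaHom_tWord, Matrix.diagonal_apply, sub_zero]
  split_ifs
  · exact Submodule.smul_mem _ _ (tWord_mem_shortFilt le_rfl rfl)
  · exact zero_mem _

theorem evalMat_entry_mem (i j k l : Fin (m + n)) :
    evalMat m n (DY0 m n) i j k l ∈ shortFilt m n 0 0 := by
  rw [evalMat, Matrix.single_apply]
  split_ifs
  · exact Submodule.smul_mem _ _ one_mem_shortFilt
  · exact zero_mem _

theorem single_evalMat_mem (s : ℤ) (i j : Fin (m + n)) :
    AddMonoidAlgebra.single s (evalMat m n (DY0 m n) i j) ∈ lauFilt m n 0 s := by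
  refine single_mem_lauFilt fun k l => ?_
  rw [sub_self]
  exact evalMat_entry_mem i j k l

/-- The part of the image of a generator under the comultiplication which is linear. -/
def genLin (g : Gen m n) : LauMat m n :=
  AddMonoidAlgebra.single (degTwo g.r) (evalMat m n (DY0 m n) g.i g.j)

theorem constHom_iotaHom_gen_mem (g : Gen m n) :
    constHom m n (iotaHom m n (DY0.t g.i g.j g.r)) ∈ lauFilt m n 1 (degTwo g.r) := by
  have h := constHom_iotaHom_tWord_mem [g]
  simpa using h

theorem coeff_mapSer_twistSer (X : DYSer m n)
    (a : ℕ) (i j : Fin (m + n)) :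
    PowerSeries.coeff a (mapSer (constHom m n) (twistSer X)) i j =
      constHom m n (signDiag m n _ i j (PowerSeries.coeff a X i j)) := by
  rw [coeff_mapSer, coeff_twistSer]

theorem twistSer_add (X Y : DYSer m n) :
    twistSer (X + Y) = twistSer X + twistSer Y := by
  ext a i j : 3
  rw [coeff_twistSer, map_add, map_add, Matrix.add_apply, Matrix.add_apply, map_add,
    coeff_twistSer, coeff_twistSer]

theorem twistSer_one :
    twistSer (1 : DYSer m n) = 1 := by
  have h := twistSer_coeff_zero (m := m) (n := n) (D := DY0 m n) (X := 1) (by simp)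
  ext a i j : 3
  rcases Nat.eq_zero_or_pos a with rfl | ha
  · rw [h, PowerSeries.coeff_one, if_pos rfl]
  · rw [coeff_twistSer, PowerSeries.coeff_one, PowerSeries.coeff_one, if_neg ha.ne',
      if_neg ha.ne', Matrix.zero_apply, map_zero]
    rfl

/-- Expand `(1 + X')(1 + E) - 1 = X' + E + X' E`. The coefficients of `X'` and of `E` have the bound
`w a - 1`, so those of `X' E` have the bound `w a - 2` and are of lower degree. -/
theorem evalComul_sub_mem_of_ser {f : ℕ → LauMat m n} {w : ℤ}
    {X : DYSer m n}
    (hX : mapSer (evalComul m n) X = mapSer (constHom m n) (twistSer X) * (1 + evalSer f))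
    (h1 : ∀ (a : ℕ) i j, constHom m n (signDiag m n _ i j (PowerSeries.coeff a (X - 1 : DYSer m n) i j)) ∈
      lauFilt m n 1 (w * a - 1))
    (h2 : ∀ (a : ℕ) i j, PowerSeries.coeff a (evalSer f) i j ∈ lauFilt m n 0 (w * a - 1))
    (a : ℕ) (i j : Fin (m + n)) :
    evalComul m n (PowerSeries.coeff a (X - 1 : DYSer m n) i j) -
      (constHom m n (signDiag m n _ i j (PowerSeries.coeff a (X - 1 : DYSer m n) i j)) +
        PowerSeries.coeff a (evalSer f) i j) ∈ lauFilt m n k (w * a - 1) := by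
  have e : mapSer (evalComul m n) (X - 1) = mapSer (constHom m n) (twistSer (X - 1)) +
      evalSer f + mapSer (constHom m n) (twistSer (X - 1)) * evalSer f := by
    have h := twistSer_add (X - 1) 1
    rw [sub_add_cancel, twistSer_one] at h
    rw [map_sub, hX, h, map_add, map_one, map_one]
    noncomm_ring
  rw [← coeff_mapSer, e, ← coeff_mapSer_twistSer, map_add, map_add, Matrix.add_apply,
    Matrix.add_apply, add_sub_cancel_left, PowerSeries.coeff_mul, Matrix.sum_apply]
  refine sum_mem fun x hx => ?_
  rw [Matrix.mul_apply]
  refine sum_mem fun b _ => ?_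
  have h := mul_mem_lauFilt (h1 x.1 i b) (h2 x.2 b j)
  rw [coeff_mapSer_twistSer]
  refine lauFilt_le ?_ h
  rw [← Finset.HasAntidiagonal.mem_antidiagonal.1 hx]
  push_cast
  rw [mul_add]
  lia

theorem signDiag_t_mem (i j : Fin (m + n)) {r : ℤ} (hr : r ≠ 0) :
    constHom m n (signDiag m n _ i j (DY0.t i j r)) ∈ lauFilt m n 1 (degTwo r) := by
  rw [← iotaHom_t _ _ _ hr]
  exact constHom_iotaHom_gen_mem ⟨i, j, r, hr⟩

theorem T_mul_constHom (s : ℤ) (M : Matrix (Fin (m + n)) (Fin (m + n)) (DY0 m n)) :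
    (LaurentPolynomial.T s : LauMat m n) * constHom m n M = AddMonoidAlgebra.single s M := by
  rw [constHom_apply, LaurentPolynomial.T, AddMonoidAlgebra.single_mul_single, add_zero, one_mul]

theorem highGeom_mul_constHom (a : ℕ) (M : Matrix (Fin (m + n)) (Fin (m + n)) (DY0 m n)) :
    highGeom m n a * constHom m n M = -AddMonoidAlgebra.single (-(a : ℤ) - 1) M := by
  rw [highGeom, ← T_mul_constHom]
  exact neg_mul (LaurentPolynomial.T (-(a : ℤ) - 1) : LauMat m n) (constHom m n M)

theorem evalComul_neg_mem (i j : Fin (m + n)) (a : ℕ) :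
    evalComul m n (DY0.t i j (-((a : ℤ) + 1))) -
      (constHom m n (signDiag m n _ i j (DY0.t i j (-((a : ℤ) + 1)))) +
        AddMonoidAlgebra.single (-((a : ℤ) + 1)) (evalMat m n (DY0 m n) i j)) ∈
        lauFilt m n k (-((a : ℤ) + 1)) := by
  have e : ∀ a : ℕ, -1 * (a : ℤ) - 1 = -((a : ℤ) + 1) := fun a => by ring
  have e' : ∀ a : ℕ, -(a : ℤ) - 1 = -((a : ℤ) + 1) := fun a => by ring
  have h0 := evalComul_sub_mem_of_ser (k := k) (w := -1) mapSer_evalComul_tPlusSer (fun a i j => by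
    rw [coeff_tPlusSer_sub_one, e]
    have h := signDiag_t_mem i j (r := -((a : ℤ) + 1)) (by lia)
    rw [degTwo, if_neg (by lia), ← Submodule.neg_mem_iff, ← map_neg, ← map_neg] at h
    exact h) (fun a i j => by
    rw [coeff_evalSer, highGeom_mul_constHom, e, e']
    exact (Submodule.neg_mem_iff _).2 (single_evalMat_mem _ i j)) a i j
  rw [coeff_tPlusSer_sub_one, coeff_evalSer, highGeom_mul_constHom, e, e', map_neg, map_neg,
    map_neg, ← neg_add, neg_sub_neg] at h0
  rw [← neg_sub]
  exact neg_mem h0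

theorem evalComul_pos_mem (i j : Fin (m + n)) {a : ℕ} (ha : a ≠ 0) :
    evalComul m n (DY0.t i j (a : ℤ)) -
      (constHom m n (signDiag m n _ i j (DY0.t i j (a : ℤ))) +
        AddMonoidAlgebra.single ((a : ℤ) - 1) (evalMat m n (DY0 m n) i j)) ∈
        lauFilt m n k ((a : ℤ) - 1) := by
  have h0 := evalComul_sub_mem_of_ser (k := k) (w := 1) mapSer_evalComul_tSer (fun a i j => by
    rw [coeff_tSer_sub_one]
    split_ifs with ha
    · rw [map_zero, map_zero]
      exact zero_mem _
    have h := signDiag_t_mem i j (r := (a : ℤ)) (by lia)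
    rw [degTwo, if_pos (by lia)] at h
    rwa [one_mul]) (fun a i j => by
    rw [coeff_evalSer, lowGeom]
    split_ifs with ha
    · rw [zero_mul]
      exact zero_mem _
    rw [T_mul_constHom, one_mul]
    exact single_evalMat_mem _ i j) a i j
  rwa [coeff_tSer_sub_one, coeff_evalSer, lowGeom, if_neg ha, if_neg ha,
    T_mul_constHom, one_mul] at h0

/-- Generators are primitive up to lower degree; as the error is of lower degree, `k` is arbitrary.
With `T` in degree one, the exponent of `T` in the linear part is the degree of the generator for
superscripts of either sign. -/
theorem evalComul_gen_mem (g : Gen m n) :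
    evalComul m n (DY0.t g.i g.j g.r) -
      (constHom m n (iotaHom m n (DY0.t g.i g.j g.r)) + genLin g) ∈
        lauFilt m n k (degTwo g.r) := by
  rw [genLin, iotaHom_t _ _ _ g.hr]
  have hr := g.hr
  rcases lt_or_gt_of_ne hr with h | h
  · have h0 := evalComul_neg_mem (k := k) g.i g.j (-g.r - 1).toNat
    rw [show -(((-g.r - 1).toNat : ℤ) + 1) = g.r by lia] at h0
    rwa [degTwo, if_neg (by lia)]
  · have h0 := evalComul_pos_mem (k := k) g.i g.j (a := g.r.toNat) (by lia)
    rw [Int.toNat_of_nonneg (by lia)] at h0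
    rwa [degTwo, if_pos h]

/-- The part of the image of a monomial under the comultiplication of degree one in the
representation. -/
def wordLin : List (Gen m n) → LauMat m n
  | [] => 0
  | g :: w => constHom m n (iotaHom m n (DY0.t g.i g.j g.r)) * wordLin w +
      genLin g * constHom m n (iotaHom m n (tWord w))

theorem wordLin_mem (w : List (Gen m n)) :
    wordLin w ∈ lauFilt m n (w.length - 1) (wordDeg w) := by
  induction w with
  | nil => exact zero_mem _
  | cons g w ih =>
    rw [wordLin, wordDeg_cons, List.length_cons]
    refine add_mem ?_ ?_
    · have h := mul_mem_lauFilt (constHom_iotaHom_gen_mem g) ih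
      rwa [show (1 : ℤ) + (w.length - 1) = ((w.length + 1 : ℕ) : ℤ) - 1 by push_cast; ring] at h
    · have h := mul_mem_lauFilt (single_evalMat_mem (degTwo g.r) g.i g.j)
        (constHom_iotaHom_tWord_mem w)
      rwa [show (0 : ℤ) + w.length = ((w.length + 1 : ℕ) : ℤ) - 1 by push_cast; ring] at h

/-- In the expanded product, choosing the representation for no factor or for one factor gives the
two subtracted terms. Every other term of top degree has at least two factors in the representation,
which leaves at most `w.length - 2` factors in the double Yangian. -/
theorem evalComul_tWord_mem (w : List (Gen m n)) :
    evalComul m n (tWord w) - (constHom m n (iotaHom m n (tWord w)) + wordLin w) ∈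
      lauFilt m n (w.length - 2) (wordDeg w) := by
  induction w with
  | nil => simp [wordLin]
  | cons g w ih =>
    -- The error for one letter is multiplied by a word of length `w.length`, while `w.length - 1`
    -- is allowed, hence `k = -1`.
    have hg := evalComul_gen_mem (k := -1) g
    rw [wordLin, tWord_cons, map_mul, map_mul, map_mul, wordDeg_cons, List.length_cons]
    have h1 := constHom_iotaHom_gen_mem g
    have h2 : genLin g ∈ lauFilt m n 0 (degTwo g.r) := single_evalMat_mem _ _ _
    have h3 := constHom_iotaHom_tWord_mem w
    have h4 := wordLin_mem w
    generalize evalComul m n (DY0.t g.i g.j g.r) = P at *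
    generalize constHom m n (iotaHom m n (DY0.t g.i g.j g.r)) = Q at *
    generalize evalComul m n (tWord w) = P' at *
    generalize constHom m n (iotaHom m n (tWord w)) = Q' at *
    generalize genLin g = G at *
    generalize wordLin w = W at *
    have h5 : P' ∈ lauFilt m n w.length (wordDeg w) := by
      have h := add_mem (lauFilt_mono (by lia) ih) (add_mem h3 (lauFilt_mono (by lia) h4))
      rwa [sub_add_cancel] at h
    have e : P * P' - (Q * Q' + (Q * W + G * Q')) =
        Q * (P' - (Q' + W)) + G * W + G * (P' - (Q' + W)) + (P - (Q + G)) * P' := by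
      simp only [mul_sub, sub_mul, mul_add, add_mul]
      abel
    rw [e]
    refine add_mem (add_mem (add_mem ?_ ?_) ?_) ?_
    · exact lauFilt_mono (by push_cast; lia) (mul_mem_lauFilt h1 ih)
    · exact lauFilt_mono (by push_cast; lia) (mul_mem_lauFilt h2 h4)
    · exact lauFilt_mono (by push_cast; lia) (mul_mem_lauFilt h2 ih)
    · exact lauFilt_mono (by push_cast; lia) (mul_mem_lauFilt hg h5)

/-- The skew derivation associated with a generator: a matrix entry of the linear part of the
comultiplication. -/
def skewDer (α : Gen m n) : DY0 m n →ₗ[ℂ] DY0 m n :=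
  (lauEntry (degTwo α.r) α.j α.i).comp
    ((evalComul m n).toLinearMap - ((constHom m n).comp (iotaHom m n)).toLinearMap)

/-- The value of a generator in the vector representation, up to sign. -/
def genVal (α : Gen m n) : ℂ := -(-1 : ℂ) ^ (parity α.i * parity α.j)

/-- The leading part of the value of a skew derivation on a monomial. -/
def wordDer (α : Gen m n) : List (Gen m n) → DY0 m n
  | [] => 0
  | g :: w => genSign g α.j • (DY0.t g.i g.j g.r * wordDer α w) +
      haveI := Classical.propDecidable (g = α)
      if g = α then (genVal α * wordSign w α.i) • tWord w else 0

/-- Positive superscripts have degrees `≥ 0` and negative ones degrees `< 0`. Hence the power of `T`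
determines the superscript, and the matrix position the two indices. -/
theorem degTwo_injective {r s : ℤ} (hr : r ≠ 0) (hs : s ≠ 0) (h : degTwo r = degTwo s) :
    r = s := by
  rw [degTwo, degTwo] at h
  split_ifs at h <;> lia

theorem gen_eq_iff (g α : Gen m n) :
    g = α ↔ degTwo g.r = degTwo α.r ∧ g.j = α.j ∧ g.i = α.i := by
  constructor
  · rintro rfl
    exact ⟨rfl, rfl, rfl⟩
  · rintro ⟨h1, h2, h3⟩
    have := degTwo_injective g.hr α.hr h1
    cases g
    cases α
    simp_all

theorem lauEntry_wordLin (α : Gen m n) (w : List (Gen m n)) :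
    lauEntry (degTwo α.r) α.j α.i (wordLin w) = wordDer α w := by
  induction w with
  | nil => rw [wordLin, wordDer, map_zero]
  | cons g w ih =>
    rw [wordLin, wordDer, map_add, iotaHom_gen, lauEntry_diagonal_mul, ih, smul_mul_assoc,
      genLin, constHom_apply, AddMonoidAlgebra.single_mul_single, add_zero, lauEntry_single,
      iotaHom_tWord, Matrix.mul_diagonal]
    congr 1
    rw [evalMat, Matrix.single_apply]
    by_cases h : g = α
    · subst h
      rw [if_pos rfl, if_pos ⟨rfl, rfl⟩, if_pos rfl, smul_mul_smul_comm, one_mul]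
      rfl
    · rw [if_neg h]
      have h' := (gen_eq_iff g α).not.1 h
      split_ifs with h1 h2
      · exact absurd ⟨h1, h2.1, h2.2⟩ h'
      · rw [zero_mul]
      · rfl

/-- The chosen matrix entry of the linear part is the sum over occurrences of `α` of the word
without that occurrence, up to signs; terms with two factors in the representation are shorter
still. -/
theorem skewDer_tWord_sub_mem (α : Gen m n) (w : List (Gen m n)) :
    skewDer α (tWord w) - wordDer α w ∈
      shortFilt m n (w.length - 2) (wordDeg w - degTwo α.r) := by
  have h := lauEntry_mem (evalComul_tWord_mem w) (degTwo α.r) α.j α.i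
  rw [← sub_sub, map_sub, lauEntry_wordLin] at h
  exact h

theorem skewDer_tWord_mem (α : Gen m n) (w : List (Gen m n)) :
    skewDer α (tWord w) ∈ shortFilt m n (w.length - 1) (wordDeg w - degTwo α.r) := by
  have h := lauEntry_mem (wordLin_mem w) (degTwo α.r) α.j α.i
  rw [lauEntry_wordLin] at h
  have h' := add_mem (shortFilt_mono (by lia) (skewDer_tWord_sub_mem α w)) h
  rwa [sub_add_cancel] at h'

theorem skewDer_mem_filt (α : Gen m n) {x : DY0 m n} (hx : x ∈ DY0.filt m n d) :
    skewDer α x ∈ DY0.filt m n (d - degTwo α.r) := by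
  have h : DY0.filt m n d ≤ (DY0.filt m n (d - degTwo α.r)).comap (skewDer α) := by
    refine Submodule.span_le.2 ?_
    rintro _ ⟨w, hw, rfl⟩
    refine DY0.filt_mono ?_ (shortFilt_le_filt (skewDer_tWord_mem α w))
    rw [wordDeg]
    lia
  exact h hx

theorem skewDer_mem_shortFilt (α : Gen m n) {x : DY0 m n} (hx : x ∈ shortFilt m n k d) :
    skewDer α x ∈ shortFilt m n (k - 1) (d - degTwo α.r) := by
  have h : shortFilt m n k d ≤ (shortFilt m n (k - 1) (d - degTwo α.r)).comap (skewDer α) := by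
    refine sup_le (Submodule.span_le.2 ?_) fun y hy => ?_
    · rintro _ ⟨w, hw, rfl, rfl⟩
      exact shortFilt_mono (by lia) (skewDer_tWord_mem α w)
    · exact filt_le_shortFilt (by lia) (skewDer_mem_filt α hy)
  exact h hx

end Derivations


/-! ### Linear independence of ordered monomials modulo lower degree -/

section Independence

variable {m n : ℕ} {d e k k' : ℤ}

theorem isRTTPair_one (m n : ℕ) (D : Type*) [Ring D] [Algebra ℂ D] :
    IsRTTPair (1 : PowerSeries (Matrix (Fin (m + n)) (Fin (m + n)) D)) 1 where
  low := (rtt_low_low _ _).2 (by rw [RTT, map_one, map_one, mul_one, mul_one, one_mul])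
  high := (rtt_high_high _ _).2 (by
    rw [RTT, map_one, map_one, mul_one, mul_one, one_mul, one_mul])
  mixed := (rtt_low_high _ _).2 (by rw [RTT, map_one, map_one, mul_one, mul_one, one_mul])

/-- The homomorphism which annihilates the generators. -/
def counitHom (m n : ℕ) : DY0 m n →ₐ[ℂ] ℂ :=
  DY0.lift (isRTTPair_one m n ℂ) (by simp)

theorem counitHom_gen (g : Gen m n) : counitHom m n (DY0.t g.i g.j g.r) = 0 := by
  have hr := g.hr
  rw [counitHom, DY0.lift_t]
  rcases lt_or_gt_of_ne hr with h | h
  · rw [freeLift_freeT_neg _ _ h, PowerSeries.coeff_one, sub_eq_zero]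
    by_cases h' : g.r = -1
    · simp [h']
    · rw [if_neg h', if_neg (by lia), Matrix.zero_apply]
  · rw [freeLift_freeT_pos _ _ h, PowerSeries.coeff_one, if_neg (by lia), Matrix.zero_apply]

theorem counitHom_tWord {w : List (Gen m n)} (hw : w ≠ []) : counitHom m n (tWord w) = 0 := by
  cases w with
  | nil => exact absurd rfl hw
  | cons g w => rw [tWord_cons, map_mul, counitHom_gen, zero_mul]

/-- The functional on the double Yangian associated with a word, the composition of the skew
derivations and the counit. -/
def wordFun : List (Gen m n) → DY0 m n →ₗ[ℂ] ℂ
  | [] => (counitHom m n).toLinearMap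
  | α :: w => (wordFun w).comp (skewDer α)

/-- Each skew derivation lowers the degree by that of its generator. At the end the element has
negative degree, and the counit kills all monomials but the empty one, which has degree zero. -/
theorem wordFun_filt (w : List (Gen m n)) {x : DY0 m n} (hx : x ∈ DY0.filt m n d)
    (hd : d < wordDeg w) : wordFun w x = 0 := by
  induction w generalizing x d with
  | nil =>
    have h : DY0.filt m n d ≤ LinearMap.ker (wordFun ([] : List (Gen m n))) := by
      refine Submodule.span_le.2 ?_
      rintro _ ⟨w, hw, rfl⟩
      refine counitHom_tWord (w := w) ?_
      rintro rfl
      rw [wordDeg_nil] at hd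
      simp at hw
      lia
    exact h hx
  | cons α w ih =>
    rw [wordDeg_cons] at hd
    exact ih (skewDer_mem_filt α hx) (by lia)

/-- Each derivation also removes one factor, up to lower degree. Too short a word runs out of
factors, and only elements of negative degree remain for the counit. -/
theorem wordFun_shortFilt (w : List (Gen m n)) {x : DY0 m n}
    (hx : x ∈ shortFilt m n k (wordDeg w)) (hk : k < w.length) : wordFun w x = 0 := by
  induction w generalizing x k with
  | nil =>
    refine wordFun_filt (d := -1) [] ?_ (by simp)
    have h : shortFilt m n k 0 ≤ DY0.filt m n (-1) := by
      refine sup_le (Submodule.span_le.2 ?_) le_rfl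
      rintro _ ⟨w, hw, -, rfl⟩
      rw [List.length_nil] at hk
      lia
    exact h hx
  | cons α w ih =>
    rw [List.length_cons] at hk
    have h := skewDer_mem_shortFilt α hx
    rw [wordDeg_cons, add_sub_cancel_left] at h
    exact ih h (by push_cast at hk; lia)

theorem wordFun_cons_tWord (α : Gen m n) (w v : List (Gen m n)) (hl : v.length = w.length + 1)
    (hd : wordDeg v = wordDeg (α :: w)) :
    wordFun (α :: w) (tWord v) = wordFun w (wordDer α v) := by
  have h := skewDer_tWord_sub_mem α v
  rw [hd, wordDeg_cons, add_sub_cancel_left] at h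
  have h' := wordFun_shortFilt w h (by rw [hl]; push_cast; lia)
  rw [map_sub, sub_eq_zero] at h'
  exact h'

theorem wordDer_mem_span (α : Gen m n) (v : List (Gen m n)) :
    wordDer α v ∈ Submodule.span ℂ {x | ∃ w, (α :: w).Perm v ∧ x = tWord w} := by
  induction v with
  | nil => exact zero_mem _
  | cons g v ih =>
    rw [wordDer]
    refine add_mem (Submodule.smul_mem _ _ ?_) ?_
    · have h : Submodule.span ℂ {x | ∃ w, (α :: w).Perm v ∧ x = tWord w} ≤
          (Submodule.span ℂ {x | ∃ w, (α :: w).Perm (g :: v) ∧ x = tWord w}).comap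
            (LinearMap.mulLeft ℂ (DY0.t g.i g.j g.r)) := by
        refine Submodule.span_le.2 ?_
        rintro _ ⟨w, hw, rfl⟩
        refine Submodule.subset_span ⟨g :: w, ?_, (tWord_cons g w).symm⟩
        exact (List.Perm.swap _ _ _).trans (hw.cons g)
      exact h ih
    · split_ifs with h
      · subst h
        exact Submodule.smul_mem _ _ (Submodule.subset_span ⟨v, List.Perm.refl _, rfl⟩)
      · exact zero_mem _

theorem wordDer_eq_zero {α : Gen m n} {v : List (Gen m n)} (h : α ∉ v) : wordDer α v = 0 := by
  induction v with
  | nil => rfl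
  | cons g v ih =>
    rw [List.mem_cons, not_or] at h
    rw [wordDer, ih h.2, mul_zero, smul_zero, if_neg (Ne.symm h.1), add_zero]

theorem wordDeg_perm {v w : List (Gen m n)} (h : v.Perm w) : wordDeg v = wordDeg w :=
  (h.map _).sum_eq

/-- The leading part of a derivation deletes one occurrence of its generator and keeps the others.
The functional is therefore nonzero on `v` only if the letters of `w` can be deleted from `v` one
after another. -/
theorem wordFun_tWord_eq_zero (w : List (Gen m n)) {v : List (Gen m n)}
    (hl : v.length = w.length) (hd : wordDeg v = wordDeg w) (hp : ¬ v.Perm w) :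
    wordFun w (tWord v) = 0 := by
  induction w generalizing v with
  | nil =>
    rw [List.length_nil, List.length_eq_zero_iff] at hl
    exact absurd (hl ▸ List.Perm.refl _) hp
  | cons α w ih =>
    rw [wordFun_cons_tWord α w v hl hd]
    have h : Submodule.span ℂ {x | ∃ w', (α :: w').Perm v ∧ x = tWord w'} ≤
        LinearMap.ker (wordFun w) := by
      refine Submodule.span_le.2 ?_
      rintro _ ⟨w', hw, rfl⟩
      refine ih ?_ ?_ fun h => hp (hw.symm.trans (h.cons α))
      · have := hw.length_eq
        rw [hl, List.length_cons, List.length_cons] at this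
        lia
      · have := wordDeg_perm hw
        rw [hd, wordDeg_cons, wordDeg_cons] at this
        lia
    exact h (wordDer_mem_span α v)

/-- A generator of even parity. -/
def EvenGen (g : Gen m n) : Prop := Even (parity g.i + parity g.j)

/-- The key of a generator for the lexicographic order. -/
def genKey (g : Gen m n) : Fin (m + n) ×ₗ Fin (m + n) ×ₗ ℤ := toLex (g.i, toLex (g.j, g.r))

theorem genKey_injective : Function.Injective (genKey (m := m) (n := n)) := by
  intro g h hgh
  have h1 := congrArg ofLex hgh
  simp only [genKey, ofLex_toLex, Prod.mk.injEq] at h1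
  have h2 := congrArg ofLex h1.2
  simp only [ofLex_toLex, Prod.mk.injEq] at h2
  cases g
  cases h
  simp_all

/-- The relation between consecutive factors of an ordered monomial: the factors increase, and
only even factors may be repeated. -/
def Precedes (g h : Gen m n) : Prop := genKey g < genKey h ∨ (g = h ∧ EvenGen g)

theorem Precedes.antisymm {g h : Gen m n} (h1 : Precedes g h) (h2 : Precedes h g) : g = h := by
  rcases h1 with h1 | h1
  · rcases h2 with h2 | h2
    · exact absurd (h1.trans h2) (lt_irrefl _)
    · exact h2.1.symm
  · exact h1.1

theorem genSign_of_even {α : Gen m n} (h : EvenGen α) (i : Fin (m + n)) : genSign α i = 1 :=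
  Even.neg_one_pow (h.mul_right _)

theorem wordSign_ne_zero (w : List (Gen m n)) (i : Fin (m + n)) : wordSign w i ≠ 0 := by
  rw [wordSign]
  refine List.prod_ne_zero ?_
  rw [List.mem_map]
  rintro ⟨g, -, hg⟩
  exact pow_ne_zero _ (by simp) hg

theorem genVal_ne_zero (α : Gen m n) : genVal α ≠ 0 :=
  neg_ne_zero.2 (pow_ne_zero _ (by simp))

/-- `N` counts the copies of `α`, which all stand at the beginning of `v` by the ordering. An even
`α` contributes no signs, so the copies add up. -/
theorem wordDer_of_even {α : Gen m n} (hα : EvenGen α) {v : List (Gen m n)}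
    (hv : v.Pairwise Precedes) (h : ∀ g ∈ v, Precedes α g) :
    ∃ N : ℕ, DY0.t α.i α.j α.r * wordDer α v = (N * (genVal α * wordSign v α.i)) • tWord v := by
  induction v with
  | nil => exact ⟨0, by simp [wordDer]⟩
  | cons g v ih =>
    rw [List.pairwise_cons] at hv
    by_cases hg : g = α
    · subst hg
      obtain ⟨N, hN⟩ := ih hv.2 hv.1
      refine ⟨N + 1, ?_⟩
      have hs : wordSign (g :: v) g.i = wordSign v g.i := by
        rw [wordSign, List.map_cons, List.prod_cons, genSign_of_even hα, one_mul, wordSign]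
      rw [wordDer, if_pos rfl, genSign_of_even hα, one_smul, hN, hs, ← add_smul, mul_smul_comm,
        tWord_cons]
      congr 1
      push_cast
      ring
    · refine ⟨0, ?_⟩
      rw [wordDer_eq_zero, mul_zero, Nat.cast_zero, zero_mul, zero_smul]
      rw [List.mem_cons, not_or]
      refine ⟨Ne.symm hg, fun h' => ?_⟩
      exact hg ((hv.1 α h').antisymm (h g List.mem_cons_self))

/-- An even first letter of multiplicity `N + 1` gives `N + 1` equal terms, which is nonzero in
characteristic zero. An odd letter could give cancelling terms, but it occurs only once in an
ordered word. -/
theorem wordDer_cons_self {α : Gen m n} {v : List (Gen m n)}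
    (hv : (α :: v).Pairwise Precedes) : ∃ c : ℂ, c ≠ 0 ∧ wordDer α (α :: v) = c • tWord v := by
  rw [List.pairwise_cons] at hv
  rw [wordDer, if_pos rfl]
  by_cases hα : EvenGen α
  · obtain ⟨N, hN⟩ := wordDer_of_even hα hv.2 hv.1
    refine ⟨(N + 1 : ℕ) * (genVal α * wordSign v α.i), mul_ne_zero (Nat.cast_ne_zero.2 (by simp))
      (mul_ne_zero (genVal_ne_zero α) (wordSign_ne_zero _ _)), ?_⟩
    rw [genSign_of_even hα, one_smul, hN, ← add_smul]
    congr 1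
    push_cast
    ring
  · refine ⟨genVal α * wordSign v α.i, mul_ne_zero (genVal_ne_zero α) (wordSign_ne_zero _ _), ?_⟩
    rw [wordDer_eq_zero, mul_zero, smul_zero, zero_add]
    intro h
    rcases hv.1 α h with h' | h'
    · exact lt_irrefl _ h'
    · exact hα h'.2

theorem wordFun_self {w : List (Gen m n)} (hw : w.Pairwise Precedes) :
    wordFun w (tWord w) ≠ 0 := by
  induction w with
  | nil => simp [wordFun]
  | cons α w ih =>
    rw [wordFun_cons_tWord α w _ (List.length_cons) rfl]
    obtain ⟨c, hc, h⟩ := wordDer_cons_self hw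
    rw [h, map_smul, smul_eq_mul]
    exact mul_ne_zero hc (ih (List.pairwise_cons.1 hw).2)

/-- The ordered monomials of degree `e` are linearly independent modulo the elements of smaller
degree. -/
theorem ordered_independent (c : List (Gen m n) →₀ ℂ)
    (hs : ∀ w ∈ c.support, w.Pairwise Precedes) (he : ∀ w ∈ c.support, wordDeg w = e)
    (h : (c.sum fun w a => a • tWord w) ∈ DY0.filt m n (e - 1)) : c = 0 := by
  by_contra hc
  -- Test against the functional of a longest word: it kills shorter words of the same degree, and
  -- words of the same length unless they are permutations of `w`. A permutation of `w` which is
  -- also ordered equals `w`.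
  obtain ⟨w, hw, hmax⟩ := Finset.exists_max_image c.support List.length
    (Finsupp.support_nonempty_iff.2 hc)
  have h1 := wordFun_filt w h (by rw [he w hw]; lia)
  rw [Finsupp.sum, map_sum, Finset.sum_eq_single w] at h1
  · rw [map_smul, smul_eq_zero] at h1
    exact h1.elim (Finsupp.mem_support_iff.1 hw) (wordFun_self (hs w hw))
  · intro v hv hvw
    rw [map_smul]
    have hd : wordDeg v = wordDeg w := (he v hv).trans (he w hw).symm
    rcases (hmax v hv).lt_or_eq with hl | hl
    · rw [wordFun_shortFilt w (k := v.length) (hd ▸ tWord_mem_shortFilt le_rfl rfl)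
        (by exact_mod_cast hl), smul_zero]
    · rw [wordFun_tWord_eq_zero w hl hd, smul_zero]
      intro hp
      exact hvw (hp.eq_of_pairwise (fun a b _ _ => Precedes.antisymm) (hs v hv) (hs w hw))
  · exact fun h => absurd hw h

end Independence


/-! ### Ordered words in the generators span; formal and actual degree agree -/

section Spanning

variable {m n : ℕ} {ℓ : ℕ} {H : Set ℤ} {d e k : ℤ}

theorem isClosed_filt (d : ℤ) : IsClosed (DY0.filt m n d : Set (DY0 m n)) := by
  refine (DY0.filt m n d).toAddSubgroup.isClosed_of_isOpen ?_
  refine (DY0.filt m n d).toAddSubgroup.isOpen_of_mem_nhds (g := 0) ?_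
  refine (DY0.ringSubgroupsBasis m n).hasBasis_nhds_zero.mem_iff.mpr ⟨(-d).toNat, trivial, ?_⟩
  intro x hx
  exact DY0.filt_mono (by lia) hx

/-- The filtration subspaces are open subgroups, hence closed, and the topology is induced from the
completion. Taking closures therefore adds no element of the double Yangian. -/
theorem toCDY_mem_iff {x : DY0 m n} : toCDY m n x ∈ cfilt m n d ↔ x ∈ DY0.filt m n d := by
  refine ⟨fun h => ?_, toCDY_mem⟩
  have h1 := (UniformSpace.Completion.isUniformInducing_coe
    (DY0 m n)).isInducing.closure_eq_preimage_closure_image (DY0.filt m n d : Set (DY0 m n))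
  rw [(isClosed_filt d).closure_eq] at h1
  have h2 : x ∈ (DY0.filt m n d : Set (DY0 m n)) := by
    rw [h1]
    exact h
  exact h2

/-- The product of the elements `b_{ij}^{(r)}` along a word. -/
def bWord (ℓ : ℕ) (w : List (Gen m n)) : CDY m n := (w.map (genEl ℓ)).prod

@[simp] theorem bWord_nil : bWord ℓ ([] : List (Gen m n)) = 1 := rfl

@[simp] theorem bWord_cons (g : Gen m n) (w : List (Gen m n)) :
    bWord ℓ (g :: w) = genEl ℓ g * bWord ℓ w := by simp [bWord]

theorem bWord_mem_form {w : List (Gen m n)} (hw : ∀ g ∈ w, g.r ∈ H) (hd : wordDeg w ≤ d) :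
    bWord ℓ w ∈ form ℓ H d :=
  form_mono hd (word_mem_form hw)

/-- The span of the products of formal degree `d` with less than `k` factors and the elements of
smaller formal degree. -/
def shortForm (m n ℓ : ℕ) (H : Set ℤ) (k : ℕ) (d : ℤ) : Submodule ℂ (CDY m n) :=
  Submodule.span ℂ {x | ∃ w : List (Gen m n), (∀ g ∈ w, g.r ∈ H) ∧ w.length < k ∧
    wordDeg w = d ∧ x = bWord ℓ w} ⊔ form ℓ H (d - 1)

theorem form_le_shortForm {k : ℕ} (h : e < d) : form ℓ H e ≤ shortForm m n ℓ H k d :=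
  (form_mono (by lia)).trans le_sup_right

theorem bWord_mem_shortForm {k : ℕ} {w : List (Gen m n)} (hw : ∀ g ∈ w, g.r ∈ H)
    (hk : w.length < k) (hd : wordDeg w = d) : bWord ℓ w ∈ shortForm m n ℓ H k d :=
  Submodule.mem_sup_left (Submodule.subset_span ⟨w, hw, hk, hd, rfl⟩)

theorem genEl_mul_mem_shortForm {k : ℕ} {g : Gen m n} (hg : g.r ∈ H) {x : CDY m n}
    (hx : x ∈ shortForm m n ℓ H k d) :
    genEl ℓ g * x ∈ shortForm m n ℓ H (k + 1) (degTwo g.r + d) := by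
  have h : shortForm m n ℓ H k d ≤ (shortForm m n ℓ H (k + 1) (degTwo g.r + d)).comap
      (LinearMap.mulLeft ℂ (genEl ℓ g)) := by
    refine sup_le (Submodule.span_le.2 ?_) fun y hy => ?_
    · rintro _ ⟨w, hw, hk, rfl, rfl⟩
      rw [SetLike.mem_coe, Submodule.mem_comap, LinearMap.mulLeft_apply, ← bWord_cons]
      exact bWord_mem_shortForm (List.forall_mem_cons.2 ⟨hg, hw⟩) (by simpa using hk)
        (wordDeg_cons g w)
    · exact form_le_shortForm (by lia) (form_mul (genEl_mem_form hg) hy)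
  exact h hx

theorem topForm_mul_mem_shortForm {x : CDY m n} (hx : x ∈ topForm ℓ H d) {w : List (Gen m n)}
    (hw : ∀ g ∈ w, g.r ∈ H) :
    x * bWord ℓ w ∈ shortForm m n ℓ H (w.length + 2) (d + wordDeg w) := by
  have h : topForm ℓ H d ≤ (shortForm m n ℓ H (w.length + 2) (d + wordDeg w)).comap
      (LinearMap.mulRight ℂ (bWord ℓ w)) := by
    refine sup_le (Submodule.span_le.2 ?_) fun y hy => ?_
    · rintro _ ⟨g, hg, rfl, rfl⟩
      rw [SetLike.mem_coe, Submodule.mem_comap, LinearMap.mulRight_apply, ← bWord_cons]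
      exact bWord_mem_shortForm (List.forall_mem_cons.2 ⟨hg, hw⟩) (by simp)
        (wordDeg_cons g w)
    · exact form_le_shortForm (by lia) (form_mul hy (bWord_mem_form hw le_rfl))
  exact h hx

/-- A swap of neighbours costs their supercommutator, in which two letters are replaced by one
letter of the same total degree, up to lower formal degree. -/
theorem exists_bWord_perm (hH : SignClosed H) {v w : List (Gen m n)} (h : v.Perm w)
    (hv : ∀ g ∈ v, g.r ∈ H) :
    ∃ c : ℂ, bWord ℓ v - c • bWord ℓ w ∈ shortForm m n ℓ H v.length (wordDeg v) := by
  induction h with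
  | nil => exact ⟨1, by simp⟩
  | cons g h ih =>
    rw [List.forall_mem_cons] at hv
    obtain ⟨c, hc⟩ := ih hv.2
    refine ⟨c, ?_⟩
    rw [bWord_cons, bWord_cons, ← mul_smul_comm, ← mul_sub, wordDeg_cons, List.length_cons]
    exact genEl_mul_mem_shortForm hv.1 hc
  | swap a b l =>
    rw [List.forall_mem_cons, List.forall_mem_cons] at hv
    refine ⟨(-1 : ℂ) ^ ((parity b.i + parity b.j) * (parity a.i + parity a.j)), ?_⟩
    have h := topForm_mul_mem_shortForm (sComm_genEl_mem hH hv.1 hv.2.1) hv.2.2 (ℓ := ℓ)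
    rw [sComm, sub_mul, smul_mul_assoc, mul_assoc, mul_assoc, add_assoc] at h
    simpa using h
  | trans h1 h2 ih1 ih2 =>
    obtain ⟨c, hc⟩ := ih1 hv
    obtain ⟨c', hc'⟩ := ih2 fun g hg => hv g (h1.symm.subset hg)
    refine ⟨c * c', ?_⟩
    rw [← h1.length_eq, ← wordDeg_perm h1] at hc'
    have h := add_mem hc (Submodule.smul_mem _ c hc')
    rwa [smul_sub, smul_smul, sub_add_sub_cancel] at h

/-- The ordered words of degree `e` in the generators with nonzero leading terms. -/
def ordWords (m n ℓ : ℕ) (H : Set ℤ) (e : ℤ) : Set (List (Gen m n)) :=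
  {w | (∀ g ∈ w, g.r ∈ H ∧ lead ℓ g ≠ 0) ∧ w.Pairwise Precedes ∧ wordDeg w = e}

/-- A weakly sorted word is ordered in the strict sense unless an odd letter is repeated. -/
theorem pairwise_precedes_or {v : List (Gen m n)} (hv : v.Pairwise fun g h => genKey g ≤ genKey h) :
    v.Pairwise Precedes ∨ ∃ x w, ¬ EvenGen x ∧ v.Perm (x :: x :: w) := by
  induction v with
  | nil => exact Or.inl List.Pairwise.nil
  | cons a v ih =>
    rw [List.pairwise_cons] at hv
    rcases ih hv.2 with h | ⟨x, w, hx, h⟩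
    · by_cases ha : ∀ b ∈ v, Precedes a b
      · exact Or.inl (List.pairwise_cons.2 ⟨ha, h⟩)
      · push Not at ha
        obtain ⟨b, hb, hab⟩ := ha
        rw [Precedes, not_or, not_and] at hab
        have e : a = b := genKey_injective ((hv.1 b hb).lt_or_eq.resolve_left hab.1)
        obtain ⟨w, hw⟩ : ∃ w, v.Perm (b :: w) := by
          classical exact ⟨_, List.perm_cons_erase hb⟩
        subst e
        exact Or.inr ⟨a, w, hab.2 rfl, hw.cons a⟩
    · refine Or.inr ⟨x, a :: w, hx, (h.cons a).trans ?_⟩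
      exact (List.Perm.swap x a _).trans ((List.Perm.swap x a w).cons x)

theorem exists_sorted (w : List (Gen m n)) :
    ∃ v, w.Perm v ∧ v.Pairwise fun g h => genKey g ≤ genKey h := by
  classical
  have : Std.Total fun g h : Gen m n => genKey g ≤ genKey h := ⟨fun g h => le_total _ _⟩
  have : IsTrans (Gen m n) fun g h => genKey g ≤ genKey h := ⟨fun _ _ _ => le_trans⟩
  exact ⟨w.insertionSort fun g h => genKey g ≤ genKey h, (List.perm_insertionSort _ w).symm,
    List.pairwise_insertionSort _ w⟩

/-- For odd `x` the supercommutator of `x` with itself is `2 x²`, and it is linear up to lower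
formal degree. -/
theorem sq_mem_topForm (hH : SignClosed H) {g : Gen m n} (hg : g.r ∈ H) (ho : ¬ EvenGen g) :
    genEl ℓ g * genEl ℓ g ∈ topForm ℓ H (degTwo g.r + degTwo g.r) := by
  have h := sComm_genEl_mem (ℓ := ℓ) hH hg hg
  have ho' : Odd (parity g.i + parity g.j) := Nat.not_even_iff_odd.1 ho
  rw [sComm, (ho'.mul ho').neg_one_pow, neg_one_smul, sub_neg_eq_add, ← two_smul ℂ (genEl ℓ g * genEl ℓ g)] at h
  have h' := Submodule.smul_mem _ (2⁻¹ : ℂ) h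
  rwa [smul_smul, inv_mul_cancel₀ two_ne_zero, one_smul] at h'

/-- Induction on the length, modulo lower formal degree. A letter with zero leading scalar lowers
the formal degree; otherwise the word is sorted, and a repeated odd letter is replaced by shorter
words. -/
theorem bWord_mem_ordered (hH : SignClosed H) (w : List (Gen m n)) (hw : ∀ g ∈ w, g.r ∈ H) :
    bWord ℓ w ∈ Submodule.span ℂ (bWord ℓ '' ordWords m n ℓ H (wordDeg w)) ⊔
      form ℓ H (wordDeg w - 1) := by
  induction hl : w.length using Nat.strong_induction_on generalizing w with
  | _ L ih =>
    have hshort : shortForm m n ℓ H w.length (wordDeg w) ≤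
        Submodule.span ℂ (bWord ℓ '' ordWords m n ℓ H (wordDeg w)) ⊔
          form ℓ H (wordDeg w - 1) := by
      refine sup_le (Submodule.span_le.2 ?_) le_sup_right
      rintro _ ⟨v, hv, hvl, hd, rfl⟩
      exact hd ▸ ih v.length (hl ▸ hvl) v hv rfl
    -- By induction shorter words are harmless, so `w` may be replaced by any permutation of it.
    have key : ∀ v, w.Perm v →
        bWord ℓ v ∈ Submodule.span ℂ (bWord ℓ '' ordWords m n ℓ H (wordDeg w)) ⊔
          form ℓ H (wordDeg w - 1) →
        bWord ℓ w ∈ Submodule.span ℂ (bWord ℓ '' ordWords m n ℓ H (wordDeg w)) ⊔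
          form ℓ H (wordDeg w - 1) := by
      intro v hwv hv
      obtain ⟨c, hc⟩ := exists_bWord_perm (ℓ := ℓ) hH hwv hw
      have h := add_mem (hshort hc) (Submodule.smul_mem _ c hv)
      rwa [sub_add_cancel] at h
    by_cases h0 : ∃ g ∈ w, lead ℓ g = 0
    · obtain ⟨g, hg, hg0⟩ := h0
      obtain ⟨v, hv⟩ : ∃ v, w.Perm (g :: v) := by
        classical exact ⟨_, List.perm_cons_erase hg⟩
      refine key _ hv (Submodule.mem_sup_right ?_)
      have hd := wordDeg_perm hv
      rw [wordDeg_cons] at hd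
      rw [bWord_cons, show wordDeg w - 1 = (degTwo g.r - 1) + wordDeg v by lia]
      exact form_mul (genEl_mem_form_of_lead_eq_zero hH (hw g hg) hg0)
        (bWord_mem_form (fun x hx => hw x (hv.symm.subset (List.mem_cons_of_mem g hx))) le_rfl)
    · push Not at h0
      obtain ⟨v, hv, hvs⟩ := exists_sorted w
      rcases pairwise_precedes_or hvs with hp | ⟨x, u, hx, hu⟩
      · refine key v hv (Submodule.mem_sup_left (Submodule.subset_span ⟨v, ⟨?_, hp, ?_⟩, rfl⟩))
        · exact fun g hg => ⟨hw g (hv.symm.subset hg), h0 g (hv.symm.subset hg)⟩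
        · exact (wordDeg_perm hv).symm
      · have hwu := hv.trans hu
        have hH' : ∀ g ∈ x :: x :: u, g.r ∈ H := fun g hg => hw g (hwu.symm.subset hg)
        rw [List.forall_mem_cons, List.forall_mem_cons] at hH'
        refine key _ hwu (hshort ?_)
        have h := topForm_mul_mem_shortForm (sq_mem_topForm (ℓ := ℓ) hH hH'.1 hx) hH'.2.2
        rw [wordDeg_perm hwu, hwu.length_eq, bWord_cons, bWord_cons, wordDeg_cons, wordDeg_cons,
          ← mul_assoc, ← add_assoc]
        exact h

theorem form_le_ordered (hH : SignClosed H) (e : ℤ) : form ℓ H e ≤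
    Submodule.span ℂ (bWord ℓ '' ordWords m n ℓ H e) ⊔ form ℓ H (e - 1) := by
  refine Submodule.span_le.2 ?_
  rintro _ ⟨w, hw, hd, rfl⟩
  rcases hd.lt_or_eq with h | rfl
  · exact Submodule.mem_sup_right (bWord_mem_form hw (by lia))
  · exact bWord_mem_ordered hH w hw

theorem genEl_mem_cfilt (g : Gen m n) : genEl ℓ g ∈ cfilt m n (degTwo g.r) := by
  have h := add_mem (cfilt_mono (by lia) (genEl_sub_lead_mem (ℓ := ℓ) g))
    (Submodule.smul_mem _ (lead ℓ g) (tC_mem g.i g.j g.hr))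
  rwa [sub_add_cancel] at h

theorem bWord_mem_cfilt (w : List (Gen m n)) : bWord ℓ w ∈ cfilt m n (wordDeg w) := by
  induction w with
  | nil => exact SetLike.one_mem_graded (cfilt m n)
  | cons g w ih =>
    rw [bWord_cons, wordDeg_cons]
    exact SetLike.mul_mem_graded (A := cfilt m n) (genEl_mem_cfilt g) ih

theorem form_le_cfilt : form ℓ H d ≤ cfilt m n d := by
  refine Submodule.span_le.2 ?_
  rintro _ ⟨w, -, hd, rfl⟩
  exact cfilt_mono hd (bWord_mem_cfilt w)

/-- The product of the leading coefficients of the factors of a word. -/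
def wordLead (ℓ : ℕ) (w : List (Gen m n)) : ℂ := (w.map (lead ℓ)).prod

theorem bWord_sub_mem (w : List (Gen m n)) :
    bWord ℓ w - wordLead ℓ w • toCDY m n (tWord w) ∈ cfilt m n (wordDeg w - 1) := by
  induction w with
  | nil => simp [wordLead]
  | cons g w ih =>
    rw [bWord_cons, wordDeg_cons, tWord_cons, map_mul, wordLead, List.map_cons, List.prod_cons,
      ← smul_mul_smul_comm]
    have h1 := SetLike.mul_mem_graded (A := cfilt m n) (genEl_sub_lead_mem (ℓ := ℓ) g)
      (bWord_mem_cfilt (ℓ := ℓ) w)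
    have h2 := SetLike.mul_mem_graded (A := cfilt m n)
      (Submodule.smul_mem _ (lead ℓ g) (tC_mem g.i g.j g.hr)) ih
    rw [sub_add_eq_add_sub] at h1
    rw [← add_sub_assoc] at h2
    have h := add_mem h1 h2
    rw [sub_mul, mul_sub, sub_add_sub_cancel] at h
    exact h

/-- Write `x` as a combination of ordered words of degree `e` plus lower formal degree. If the
actual degree drops, the combination of leading monomials has degree at most `e - 1`, so all its
coefficients vanish by independence. -/
theorem mem_form_of_mem_cfilt (hH : SignClosed H) {x : CDY m n} (hx : x ∈ form ℓ H e)
    (hx' : x ∈ cfilt m n (e - 1)) : x ∈ form ℓ H (e - 1) := by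
  obtain ⟨y, hy, z, hz, rfl⟩ := Submodule.mem_sup.1 (form_le_ordered hH e hx)
  obtain ⟨c, hc, rfl⟩ := (Finsupp.mem_span_image_iff_linearCombination ℂ).1 hy
  rw [Finsupp.mem_supported] at hc
  have h1 : Finsupp.linearCombination ℂ (bWord ℓ) c ∈ cfilt m n (e - 1) := by
    simpa using sub_mem hx' (form_le_cfilt hz)
  suffices h : c = 0 by
    rw [h, map_zero, zero_add]
    exact hz
  -- The coefficients of the leading monomials. The factors `wordLead` are nonzero for ordered words
  -- with nonzero leading scalars, so `c' = 0` forces `c = 0`.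
  set c' : List (Gen m n) →₀ ℂ := Finsupp.onFinset c.support (fun w => c w * wordLead ℓ w)
    fun w hw => Finsupp.mem_support_iff.2 (left_ne_zero_of_mul hw) with hc'
  have hsub : ∀ w ∈ c'.support, w ∈ ordWords m n ℓ H e := fun w hw =>
    hc (Finsupp.support_onFinset_subset hw)
  have h0 : c' = 0 := by
    refine ordered_independent c' (fun w hw => (hsub w hw).2.1) (fun w hw => (hsub w hw).2.2) ?_
    rw [← toCDY_mem_iff, hc', Finsupp.onFinset_sum _ (fun w => zero_smul ℂ (tWord w)), map_sum]
    rw [Finsupp.linearCombination_apply, Finsupp.sum] at h1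
    have h2 : ∑ w ∈ c.support, c w • (bWord ℓ w - wordLead ℓ w • toCDY m n (tWord w)) ∈
        cfilt m n (e - 1) :=
      sum_mem fun w hw => Submodule.smul_mem _ _ ((hc hw).2.2 ▸ bWord_sub_mem w)
    have h3 := sub_mem h1 h2
    rw [← Finset.sum_sub_distrib] at h3
    convert h3 using 2 with w hw
    rw [smul_sub, sub_sub_cancel, smul_smul, map_smul]
  ext w
  by_contra hw
  have hw' : c w ≠ 0 := hw
  have h2 : c' w = 0 := by rw [h0]; rfl
  rw [hc', Finsupp.onFinset_apply, mul_eq_zero] at h2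
  refine h2.elim hw' fun h3 => ?_
  rw [wordLead, List.prod_eq_zero_iff, List.mem_map] at h3
  obtain ⟨g, hg, hg0⟩ := h3
  exact ((hc (Finsupp.mem_support_iff.2 hw')).1 g hg).2 hg0

/-- The formal degree is finite to begin with and can be lowered by one as long as it exceeds the
actual degree. -/
theorem form_inf_cfilt (hH : SignClosed H) {x : CDY m n} (hx : x ∈ form ℓ H e)
    (hx' : x ∈ cfilt m n d) : x ∈ form ℓ H d := by
  rcases le_total e d with h | h
  · exact form_mono h hx
  obtain ⟨k, rfl⟩ : ∃ k : ℕ, e = d + k := ⟨(e - d).toNat, by lia⟩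
  induction k with
  | zero => simpa using hx
  | succ k ih =>
    refine ih ?_ (by lia)
    have h1 := mem_form_of_mem_cfilt hH hx (cfilt_mono (by push_cast; lia) hx')
    rwa [show d + ((k + 1 : ℕ) : ℤ) - 1 = d + k by push_cast; ring] at h1

end Spanning

/-! ### Generation of the associated graded algebra -/

section Symbols

variable {m n : ℕ} {ℓ : ℕ} {H : Set ℤ} {d e : ℤ} {S : Subalgebra ℂ (CDY m n)}

/-- The elements of `S` of degree at most `d` whose images in the component of degree `d` belong
to the subalgebra `A` of the associated graded algebra. -/
def symbolIn (A : Subalgebra ℂ (GrTwo S)) (d : ℤ) : Submodule ℂ (CDY m n) :=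
  (((Subalgebra.toSubmodule A).comap ((DirectSum.lof ℂ ℤ
    (GrPiece (inducedFilt (cfilt m n) S)) d).comp (grMk (inducedFilt (cfilt m n) S) d))).map
      (inducedFilt (cfilt m n) S d).subtype).map S.val.toLinearMap

theorem mem_symbolIn (A : Subalgebra ℂ (GrTwo S)) {x : CDY m n} : x ∈ symbolIn A d ↔
    ∃ y : ↥(inducedFilt (cfilt m n) S d),
      symbol (inducedFilt (cfilt m n) S) d y ∈ A ∧ y.1.1 = x := by
  constructor
  · rintro ⟨_, ⟨y, hy, rfl⟩, rfl⟩
    exact ⟨y, hy, rfl⟩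
  · rintro ⟨y, hy, rfl⟩
    exact ⟨_, ⟨y, hy, rfl⟩, rfl⟩

theorem symbolIn_one (A : Subalgebra ℂ (GrTwo S)) : (1 : CDY m n) ∈ symbolIn A 0 :=
  (mem_symbolIn A).2 ⟨⟨1, SetLike.one_mem_graded (inducedFilt (cfilt m n) S)⟩, A.one_mem, rfl⟩

theorem symbolIn_mul (A : Subalgebra ℂ (GrTwo S)) {x y : CDY m n} (hx : x ∈ symbolIn A d)
    (hy : y ∈ symbolIn A e) : x * y ∈ symbolIn A (d + e) := by
  rw [mem_symbolIn] at hx hy ⊢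
  obtain ⟨x, hx, rfl⟩ := hx
  obtain ⟨y, hy, rfl⟩ := hy
  refine ⟨⟨x.1 * y.1, SetLike.mul_mem_graded x.2 y.2⟩, ?_, rfl⟩
  have h := A.mul_mem hx hy
  rw [symbol, symbol, DirectSum.of_mul_of] at h
  exact h

theorem symbolIn_of_lt (A : Subalgebra ℂ (GrTwo S)) {x : CDY m n} (hx : x ∈ S)
    (hx' : x ∈ cfilt m n (d - 1)) : x ∈ symbolIn A d := by
  refine (mem_symbolIn A).2 ⟨⟨⟨x, hx⟩, cfilt_mono (by lia) hx'⟩, ?_, rfl⟩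
  rw [symbol, grMk_eq_zero, map_zero]
  · exact A.zero_mem
  · exact hx'

theorem form_le_subalgebra (hS : ∀ g : Gen m n, g.r ∈ H → genEl ℓ g ∈ S) :
    form ℓ H d ≤ Subalgebra.toSubmodule S := by
  refine Submodule.span_le.2 ?_
  rintro _ ⟨w, hw, -, rfl⟩
  refine S.list_prod_mem ?_
  intro x hx
  obtain ⟨g, hg, rfl⟩ := List.mem_map.1 hx
  exact hS g (hw g hg)

theorem exists_mem_form {X : Set (CDY m n)} (hX : ∀ x ∈ X, ∃ g : Gen m n, g.r ∈ H ∧ x = genEl ℓ g)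
    {x : CDY m n} (hx : x ∈ Algebra.adjoin ℂ X) : ∃ e, x ∈ form ℓ H e := by
  induction hx using Algebra.adjoin_induction with
  | mem x hx =>
    obtain ⟨g, hg, rfl⟩ := hX x hx
    exact ⟨_, genEl_mem_form hg⟩
  | algebraMap c =>
    rw [Algebra.algebraMap_eq_smul_one]
    exact ⟨0, Submodule.smul_mem _ _ (SetLike.one_mem_graded (form ℓ H))⟩
  | add x y _ _ hx hy =>
    obtain ⟨d, hd⟩ := hx
    obtain ⟨e, he⟩ := hy
    exact ⟨max d e, add_mem (form_mono (le_max_left _ _) hd) (form_mono (le_max_right _ _) he)⟩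
  | mul x y _ _ hx hy =>
    obtain ⟨d, hd⟩ := hx
    obtain ⟨e, he⟩ := hy
    exact ⟨_, form_mul hd he⟩

/-- A criterion for the images of generators to generate the associated graded algebra. -/
theorem graded_generation (hH : SignClosed H) (hS : ∀ g : Gen m n, g.r ∈ H → genEl ℓ g ∈ S)
    (hS' : ∀ x ∈ S, ∃ e, x ∈ form ℓ H e) (A : Subalgebra ℂ (GrTwo S))
    (hA : ∀ g : Gen m n, g.r ∈ H → lead ℓ g ≠ 0 → genEl ℓ g ∈ symbolIn A (degTwo g.r)) :
    A = ⊤ := by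
  have hword : ∀ w : List (Gen m n), (∀ g ∈ w, g.r ∈ H ∧ lead ℓ g ≠ 0) →
      bWord ℓ w ∈ symbolIn A (wordDeg w) := by
    intro w hw
    induction w with
    | nil => exact symbolIn_one A
    | cons g w ih =>
      rw [List.forall_mem_cons] at hw
      rw [bWord_cons, wordDeg_cons]
      exact symbolIn_mul A (hA g hw.1.1 hw.1.2) (ih hw.2)
  -- An element of formal degree at most `d` is a combination of words in good letters plus terms of
  -- degree at most `d - 1`, whose images in the component of degree `d` are zero.
  have hform : ∀ d, form ℓ H d ≤ symbolIn A d := by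
    intro d
    refine (form_le_ordered hH d).trans (sup_le (Submodule.span_le.2 ?_) ?_)
    · rintro _ ⟨w, hw, rfl⟩
      exact hw.2.2 ▸ hword w hw.1
    · exact fun x hx => symbolIn_of_lt A (form_le_subalgebra hS hx) (form_le_cfilt hx)
  refine Algebra.eq_top_iff.2 fun ξ => ?_
  induction ξ using DirectSum.induction_on with
  | zero => exact A.zero_mem
  | of d a =>
    obtain ⟨x, rfl⟩ := grMk_surjective _ d a
    obtain ⟨e, he⟩ := hS' x.1.1 x.1.2
    -- The comparison of the filtrations is used here: `x` has some formal degree `e`, and its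
    -- actual degree `d` bounds the formal one as well.
    obtain ⟨y, hy, hyx⟩ := (mem_symbolIn A).1 (hform d (form_inf_cfilt hH he x.2))
    have : y = x := Subtype.ext (Subtype.ext hyx)
    exact this ▸ hy
  | add x y hx hy => exact A.add_mem hx hy

theorem eps_eq_iff (i j : Fin (m + n)) : eps ℓ i = eps ℓ j ↔ (i, j) ∈ I0 m n ℓ := by
  rw [eps, eps, I0, Set.mem_ofPred_eq]
  have h : (1 : ℂ) ≠ -1 := by norm_num
  split_ifs with h1 h2 h2
  · simp [h1, h2]
  · simp [h1, h2, h]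
  · simp [h1, h2, h.symm]
  · simp [not_lt.1 h1, not_lt.1 h2]

theorem mem_I1_iff (i j : Fin (m + n)) : (i, j) ∈ I1 m n ℓ ↔ (i, j) ∉ I0 m n ℓ := by
  simp only [I1, I0, Set.mem_ofPred_eq]
  lia

theorem eps_eq_neg (i j : Fin (m + n)) (h : (i, j) ∉ I0 m n ℓ) : eps ℓ j = -eps ℓ i := by
  rw [← eps_eq_iff] at h
  rw [eps, eps] at h ⊢
  split_ifs at h ⊢ <;> simp_all

theorem genEl_of_pos {g : Gen m n} (h : 0 < g.r) : genEl ℓ g = b ℓ g.i g.j g.r.toNat := if_pos h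

theorem genEl_of_neg {g : Gen m n} (h : g.r < 0) : genEl ℓ g = bPlus ℓ g.i g.j (-g.r).toNat :=
  if_neg (by lia)

/-- The scalar `ε_j - (-1)^r ε_i` vanishes for even `r` in equal blocks and for odd `r` in different
blocks. -/
theorem mem_GammaIndex {g : Gen m n} (h : 0 < g.r) (hl : lead ℓ g ≠ 0) :
    (g.i, g.j, g.r.toNat) ∈ GammaIndex m n ℓ := by
  refine ⟨by simp only; lia, ?_⟩
  simp only
  rw [lead, if_pos h] at hl
  by_cases h0 : (g.i, g.j) ∈ I0 m n ℓ
  · refine Or.inl ⟨h0, ?_⟩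
    by_contra ho
    rw [Nat.not_odd_iff_even] at ho
    rw [ho.neg_one_pow, one_mul, (eps_eq_iff _ _).2 h0, sub_self] at hl
    exact hl rfl
  · refine Or.inr ⟨(mem_I1_iff _ _).2 h0, ?_⟩
    by_contra ho
    rw [Nat.not_even_iff_odd] at ho
    rw [ho.neg_one_pow, eps_eq_neg _ _ h0, neg_one_mul, sub_self] at hl
    exact hl rfl

/-- The parities are opposite to those of the other family because `b_{ij}^{(-r)}` is a coefficient
at `u^{r-1}`. -/
theorem mem_GammaPlusIndex {g : Gen m n} (h : g.r < 0) (hl : lead ℓ g ≠ 0) :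
    (g.i, g.j, (-g.r).toNat) ∈ GammaPlusIndex m n ℓ := by
  refine ⟨by simp only; lia, ?_⟩
  simp only
  rw [lead, if_neg (by lia)] at hl
  have e : (-g.r).toNat = (-g.r - 1).toNat + 1 := by lia
  rw [e, Nat.even_add_one, Nat.odd_add_one, Nat.not_even_iff_odd, Nat.not_odd_iff_even]
  by_cases h0 : (g.i, g.j) ∈ I0 m n ℓ
  · refine Or.inl ⟨h0, ?_⟩
    by_contra ho
    rw [Nat.not_odd_iff_even] at ho
    rw [ho.neg_one_pow, one_mul, (eps_eq_iff _ _).2 h0, sub_self] at hl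
    exact hl rfl
  · refine Or.inr ⟨(mem_I1_iff _ _).2 h0, ?_⟩
    by_contra ho
    rw [Nat.not_even_iff_odd] at ho
    rw [ho.neg_one_pow, eps_eq_neg _ _ h0, neg_one_mul, sub_self] at hl
    exact hl rfl

theorem genEl_mem_symbolIn_of_pos (hS : reflB m n ℓ ≤ S) {A : Subalgebra ℂ (GrTwo S)}
    (hA : gammaBar S hS ⊆ A) {g : Gen m n} (h : 0 < g.r) (hl : lead ℓ g ≠ 0) :
    genEl ℓ g ∈ symbolIn A (degTwo g.r) := by
  have hi := mem_GammaIndex h hl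
  rw [genEl_of_pos h, degTwo, if_pos h]
  have e : g.r - 1 = (g.r.toNat : ℤ) - 1 := by lia
  rw [e]
  exact (mem_symbolIn A).2 ⟨_, hA ⟨g.i, g.j, g.r.toNat, hi, rfl⟩, rfl⟩

theorem genEl_mem_symbolIn_of_neg (hS : reflBPlus m n ℓ ≤ S) {A : Subalgebra ℂ (GrTwo S)}
    (hA : gammaBarPlus S hS ⊆ A) {g : Gen m n} (h : g.r < 0) (hl : lead ℓ g ≠ 0) :
    genEl ℓ g ∈ symbolIn A (degTwo g.r) := by
  have hi := mem_GammaPlusIndex h hl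
  rw [genEl_of_neg h, degTwo, if_neg (by lia)]
  have e : g.r = -((-g.r).toNat : ℤ) := by lia
  rw [show symbolIn A g.r = symbolIn A (-((-g.r).toNat : ℤ)) by rw [← e]]
  exact (mem_symbolIn A).2 ⟨_, hA ⟨g.i, g.j, (-g.r).toNat, hi, rfl⟩, rfl⟩

theorem genEl_mem_reflB {g : Gen m n} (h : 0 < g.r) : genEl ℓ g ∈ reflB m n ℓ := by
  rw [genEl_of_pos h]
  exact b_mem_reflB ℓ _ _ (by lia)

theorem genEl_mem_reflBPlus {g : Gen m n} (h : g.r < 0) : genEl ℓ g ∈ reflBPlus m n ℓ := by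
  rw [genEl_of_neg h]
  exact bPlus_mem_reflBPlus ℓ _ _ (by lia)

theorem b_eq_genEl (i j : Fin (m + n)) {r : ℕ} (hr : 1 ≤ r) :
    ∃ g : Gen m n, 0 < g.r ∧ b ℓ i j r = genEl ℓ g :=
  ⟨⟨i, j, r, by lia⟩, by simp only; lia, by rw [genEl_of_pos (by simp only; lia)]; rfl⟩

theorem bPlus_eq_genEl (i j : Fin (m + n)) {r : ℕ} (hr : 1 ≤ r) :
    ∃ g : Gen m n, g.r < 0 ∧ bPlus ℓ i j r = genEl ℓ g := by
  refine ⟨⟨i, j, -(r : ℤ), by lia⟩, by simp only; lia, ?_⟩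
  rw [genEl_of_neg (by simp only; lia)]
  simp

end Symbols

end DYang

end

theorem mainTheorem8 (m n ℓ : ℕ) (hmn : m ≠ n) (hℓ : 1 ≤ ℓ) (hℓ' : ℓ ≤ m + n) :
    Algebra.adjoin ℂ (DYang.gammaBar (DYang.reflB m n ℓ) le_rfl) = ⊤ ∧
    Algebra.adjoin ℂ (DYang.gammaBarPlus (DYang.reflBPlus m n ℓ) le_rfl) = ⊤ ∧
    Algebra.adjoin ℂ
      (DYang.gammaBar (DYang.reflDB m n ℓ) (DYang.reflB_le_reflDB m n ℓ) ∪
        DYang.gammaBarPlus (DYang.reflDB m n ℓ) (DYang.reflBPlus_le_reflDB m n ℓ)) = ⊤ := by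
  refine ⟨?_, ?_, ?_⟩
  -- `H` selects the superscripts of the generators of the subalgebra: positive, negative and all
  -- nonzero ones in the three cases. Each is closed under superscripts of the same sign, so
  -- unitarity and the supercommutators stay inside the algebra.
  · refine DYang.graded_generation (ℓ := ℓ) (H := {r | 0 < r}) ?_
      (fun g hg => DYang.genEl_mem_reflB hg) (fun x hx => DYang.exists_mem_form ?_ hx) _
      fun g hg hl => DYang.genEl_mem_symbolIn_of_pos (S := DYang.reflB m n ℓ) le_rfl
        Algebra.subset_adjoin hg hl
    · exact fun r hr s _ h => h.1 hr
    · rintro _ ⟨i, j, r, hr, rfl⟩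
      exact DYang.b_eq_genEl i j hr
  · refine DYang.graded_generation (ℓ := ℓ) (H := {r | r < 0}) ?_
      (fun g hg => DYang.genEl_mem_reflBPlus hg) (fun x hx => DYang.exists_mem_form ?_ hx) _
      fun g hg hl => DYang.genEl_mem_symbolIn_of_neg (S := DYang.reflBPlus m n ℓ) le_rfl
        Algebra.subset_adjoin hg hl
    · intro r hr s hs h
      rw [Set.mem_ofPred_eq] at hr ⊢
      lia
    · rintro _ ⟨i, j, r, hr, rfl⟩
      exact DYang.bPlus_eq_genEl i j hr
  · refine DYang.graded_generation (ℓ := ℓ) (H := {r | r ≠ 0}) ?_ (fun g hg => ?_)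
      (fun x hx => DYang.exists_mem_form ?_ hx) _ fun g hg hl => ?_
    · exact fun r _ s hs _ => hs
    · rcases lt_or_gt_of_ne g.hr with h | h
      · exact DYang.reflBPlus_le_reflDB m n ℓ (DYang.genEl_mem_reflBPlus h)
      · exact DYang.reflB_le_reflDB m n ℓ (DYang.genEl_mem_reflB h)
    · rintro _ (⟨i, j, r, hr, rfl⟩ | ⟨i, j, r, hr, rfl⟩)
      · obtain ⟨g, -, h⟩ := DYang.b_eq_genEl (ℓ := ℓ) i j hr
        exact ⟨g, g.hr, h⟩
      · obtain ⟨g, -, h⟩ := DYang.bPlus_eq_genEl (ℓ := ℓ) i j hr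
        exact ⟨g, g.hr, h⟩
    · rcases lt_or_gt_of_ne g.hr with h | h
      · exact DYang.genEl_mem_symbolIn_of_neg (DYang.reflBPlus_le_reflDB m n ℓ)
          (Set.subset_union_right.trans Algebra.subset_adjoin) h hl
      · exact DYang.genEl_mem_symbolIn_of_pos (DYang.reflB_le_reflDB m n ℓ)
          (Set.subset_union_left.trans Algebra.subset_adjoin) h hl
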